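/- **Notation.** For real $t$ let $[t]=\{n\in\mathbb Z: 1\le n\le t\}$, and let $\mathbb E_{x\in S}$ denote the average over a finite set $S$. A function $f:\mathbb Z\to\mathbb C$ is $1$-bounded if $|f(x)|\le 1$ for all $x$. Write $\Delta_hf(x)=f(x+h)\overline{f(x)}$, $\Delta_{h_1,\dots,h_s}f=\Delta_{h_1}\cdots\Delta_{h_s}f$, and, for $\delta,M>0$, $$\mu_{\delta,M}(h)=\frac{\#\{(h_1,h_2)\in[\delta M]^2:h_1-h_2=h\}}{\delta^2M}.$$ For finitely supported $f$ let $\|f\|_{U^s}^{2^s}=\sum_{x,h_1,\dots,h_s\in\mathbb Z}\Delta_{h_1,\dots,h_s}f(x)$, and $\|f\|_{U^s(T)}=\|f1_T\|_{U^s}$ for $T\subset\mathbb Z$. All implied constants below are absolute. **Lemma 5.5.** There is an absolute constant $C>0$ such that the following holds. Let $N>0$ be real, $M=N^{1/2}$, and let $\delta_1,\delta_2,\delta_3,\delta_4>0$ satisfy $\delta_1/\delta_2<C\delta_4$ and $\delta_3<C\delta_1^3\delta_4$. For all but $O(\delta_1\delta_2M)$ of the $b\in[\delta_2M]$ the following is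 true: for every $1$-bounded $f:\mathbb Z\to\mathbb C$ supported in $[N]$, if $$\mathbb E_{a\in[\delta_2M]}\sum_{x,h_1,h_2\in\mathbb Z}\mu_{\delta_3,M}(h_1)\mu_{\delta_3,M}(h_2)\Delta_{2(a+b)h_1,\,2ah_2}f(x)\ \ge\ \delta_4NM^2,$$ then $$\|f\|_{U^4}^{2^4}\gg(\delta_3\delta_4)^{2^{20}}N^5.$$ **Corollary 5.6.** There is an absolute constant $C>0$ such that the following holds. Let $q$ be a positive integer, $N\ge q$ real, $M=(N/q)^{1/2}$, let $\delta_2,\delta_3,\delta_4>0$ with $\delta_3<C\delta_2^3\delta_4^4$, and for each $b\in[\delta_2M]$ let $f_b:\mathbb Z\to\mathbb C$ be a $1$-bounded function supported in $[N]$. If $$\mathbb E_{b\in[\delta_2M]}\,\mathbb E_{a\in[\delta_2M]}\sum_{x,h_1,h_2\in\mathbb Z}\mu_{\delta_3,M}(h_1)\mu_{\delta_3,M}(h_2)\Delta_{2q(a+b)h_1,\,2qah_2}f_b(x)\ \ge\ \delta_4NM^2,$$ then $$\mathbb E_{u\in[q]}\,\mathbb E_{b\in[\delta_2M]}\|f_b\|_{U^4(u+q\mathbb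 Z)}^{2^4}\gg(\delta_3\delta_4)^{2^{21}}(N/q)^5.$$ -/

import Mathlib

open scoped BigOperators

noncomputable section

/-- The set `[t] = {n ∈ ℤ : 1 ≤ n ≤ t}`, for a real number `t`. -/
def initInterval (t : ℝ) : Finset ℤ := Finset.Icc 1 ⌊t⌋

/-- `f : ℤ → ℂ` is `1`-bounded. -/
def IsOneBounded (f : ℤ → ℂ) : Prop := ∀ x : ℤ, ‖f x‖ ≤ 1

/-- The Fejér-type weight `μ_{δ,M}(h) = #{(h₁, h₂) ∈ [δM]² : h₁ - h₂ = h} / (δ² M)`. -/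
def fejerWeight (δ M : ℝ) (h : ℤ) : ℝ :=
  (((initInterval (δ * M) ×ˢ initInterval (δ * M)).filter
    (fun p : ℤ × ℤ => p.1 - p.2 = h)).card : ℝ) / (δ ^ 2 * M)

/-- The multiplicative difference operator `Δ_h f(x) = f(x + h) * conj (f x)`. -/
def mulDiff (h : ℤ) (f : ℤ → ℂ) : ℤ → ℂ := fun x => f (x + h) * (starRingEnd ℂ) (f x)

/-- The iterated difference operator `Δ_{h₁,…,hₛ} f = Δ_{h₁} ⋯ Δ_{hₛ} f`. -/
def mulDiffs (hs : List ℤ) (f : ℤ → ℂ) : ℤ → ℂ := hs.foldr mulDiff f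

/-- The `U^s`-norm of a finitely supported `f : ℤ → ℂ`, normalized by
`‖f‖_{U^s}^{2^s} = ∑_{x, h₁, …, hₛ} Δ_{h₁,…,hₛ} f(x)`. For finitely supported `f` only finitely
many terms are nonzero (and the sum is a nonnegative real for `s ≥ 1`). -/
def gowersNorm (s : ℕ) (f : ℤ → ℂ) : ℝ :=
  (∑' p : ℤ × (Fin s → ℤ), mulDiffs (List.ofFn p.2) f p.1).re ^ ((1 : ℝ) / 2 ^ s)

/-- The `U^s`-norm localized to `T ⊆ ℤ`, that is `‖f 1_T‖_{U^s}`. -/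
def gowersNormOn (s : ℕ) (T : Set ℤ) (f : ℤ → ℂ) : ℝ := gowersNorm s (T.indicator f)

/-- The residue class `u + qℤ`. -/
def residueClass (q : ℕ) (u : ℤ) : Set ℤ := {x : ℤ | ∃ k : ℤ, x = u + q * k}

/-- The average of weighted box sums
`𝔼_{a ∈ [δM]} ∑_{x, h₁, h₂} μ_{δ',M}(h₁) μ_{δ',M}(h₂) Δ_{2q(a+b)h₁, 2qah₂} f(x)`
for finitely supported `f`. The sum has finitely many nonzero terms and its value is real. -/
def boxAverage (q : ℕ) (δ δ' M : ℝ) (b : ℤ) (f : ℤ → ℂ) : ℝ :=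
  (𝔼 a ∈ initInterval (δ * M), ∑' p : ℤ × ℤ × ℤ,
    (fejerWeight δ' M p.2.1 : ℂ) * (fejerWeight δ' M p.2.2 : ℂ) *
      mulDiffs [2 * q * (a + b) * p.2.1, 2 * q * a * p.2.2] f p.1).re

end

open scoped BigOperators ComplexConjugate

/-! The argument is a quantitative concatenation. Place `f` in a finite cyclic group with no
wraparound and regard the hypothesis as a lower bound for an average, over `a`, of box sums with
sides `p a i = 2(a+b)i` and `q a j = 2aj`. One Cauchy–Schwarz removes a corner `f x`, and a box
Cauchy–Schwarz over the resulting pairs `(a, a')` produces thin box norms of `Δ_h f`, where `h = p a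
i - p a i' + p a' k - p a' k'` and the two remaining directions are `q a` and `q a'`.

For most pairs `(a, a')` the numbers `a + b` and `a' + b` have small gcd and `a' + b` is not small.
Such `h` are then spread out: no value has many more representations than average
(`hasFewReps_progressions`). Hence the sum over special `h` is dominated by a sum over all `h` in
the group (`HasFewReps.sum_le`), and the direction `p` becomes free. Two more applications of the
same principle to the `q` directions, each preceded by Cauchy–Schwarz (`sq_sum_diffSumSq_le`), free
them too. What remains is the `U³`-norm, bounded below by a power of the density `θ`; a last
Cauchy–Schwarz passes to `U⁴`.

The representation count holds for each fixed `b` with `0 ≤ b ≤ A`, because only pairs `(a, a')` are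
discarded. Therefore the exceptional set of `b` can be taken empty.

Large parameters need separate care: a direct count of the nonvanishing differences
(`norm_boxSum_le_of_long`) shows that the hypothesis itself forces `δ₄ δ₃² ≤ 64`, which makes `θ =
2⁻²⁰ (δ₃ δ₄)²` admissible.

For modulus `q`, all shifts are multiples of `q`, so the box average splits over residue classes
into rescaled averages of modulus one. A positive proportion of pairs `(b, u)` has a large average,
and the one-class theorem applies to each. -/

/-! ### Cauchy–Schwarz for boxes -/

theorem norm_sum_mul_sq_le {ι : Type*} [Fintype ι] (u v : ι → ℂ) :
    ‖∑ i, u i * v i‖ ^ 2 ≤ (∑ i, ‖u i‖ ^ 2) * ∑ i, ‖v i‖ ^ 2 := by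
  refine le_trans ?_ (Finset.sum_mul_sq_le_sq_mul_sq _ _ _)
  gcongr
  refine (norm_sum_le _ _).trans (le_of_eq ?_)
  simp

theorem norm_sum_sq_eq {ι : Type*} [Fintype ι] (z : ι → ℂ) :
    ((‖∑ i, z i‖ ^ 2 : ℝ) : ℂ) = ∑ i, ∑ j, z i * conj (z j) := by
  rw [← Complex.normSq_eq_norm_sq, ← Complex.mul_conj, map_sum, Finset.sum_mul_sum]

/-- One Cauchy–Schwarz step: the factor `a`, independent of `w`, is eliminated by doubling `w`. -/
theorem norm_sum_sq_le_doubling {X W : Type*} [Fintype X] [Fintype W] (a : X → ℂ)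
    (z : X → W → ℂ) {α : ℝ} (hα : ∑ t, ‖a t‖ ^ 2 ≤ α) :
    ‖∑ t : X × W, a t.1 * z t.1 t.2‖ ^ 2 ≤
      α * ‖∑ t : X × W × W, z t.1 t.2.1 * conj (z t.1 t.2.2)‖ := by
  have h1 : ∑ t : X × W, a t.1 * z t.1 t.2 = ∑ t, a t * ∑ w, z t w := by
    simp only [Fintype.sum_prod_type, Finset.mul_sum]
  have h2 : ∑ t : X × W × W, z t.1 t.2.1 * conj (z t.1 t.2.2)
      = ((∑ t, ‖∑ w, z t w‖ ^ 2 : ℝ) : ℂ) := by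
    rw [Complex.ofReal_sum]
    simp only [norm_sum_sq_eq, Fintype.sum_prod_type]
  rw [h1, h2, Complex.norm_real, Real.norm_of_nonneg (by positivity)]
  exact (norm_sum_mul_sq_le _ _).trans (by gcongr)

/-- The Gowers–Cauchy–Schwarz inequality for three-variable boxes, in the form that keeps only the
factor depending on all three variables. -/
theorem norm_sum_pow_eight_le_box {S U V W : Type*} [Fintype S] [Fintype U] [Fintype V] [Fintype W]
    (M : S → U → V → W → ℂ) (A : S → U → V → ℂ) (B : S → V → W → ℂ) (C : S → U → W → ℂ)
    (hB : ∀ s v w, ‖B s v w‖ ≤ 1) (hC : ∀ s u w, ‖C s u w‖ ≤ 1) {α β γ : ℝ}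
    (hα : ∑ t : S × U × V, ‖A t.1 t.2.1 t.2.2‖ ^ 2 ≤ α)
    (hβ : ∑ t : S × V × W, ‖B t.1 t.2.1 t.2.2‖ ^ 2 ≤ β)
    (hγ : ∑ t : S × U × W, ‖C t.1 t.2.1 t.2.2‖ ^ 2 ≤ γ) :
    ‖∑ t : S × U × V × W, A t.1 t.2.1 t.2.2.1 * B t.1 t.2.2.1 t.2.2.2 * C t.1 t.2.1 t.2.2.2 *
        M t.1 t.2.1 t.2.2.1 t.2.2.2‖ ^ 8 ≤
      α ^ 4 * (β * Fintype.card W) ^ 2 * (γ * Fintype.card W * Fintype.card U) *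
        ∑ t : S × W × W × U × U, ‖∑ v, M t.1 t.2.2.2.1 v t.2.1 * conj (M t.1 t.2.2.2.1 v t.2.2.1) *
          conj (M t.1 t.2.2.2.2 v t.2.1 * conj (M t.1 t.2.2.2.2 v t.2.2.1))‖ ^ 2 := by
  have hα0 : 0 ≤ α := le_trans (by positivity) hα
  have hβ0 : 0 ≤ β := le_trans (by positivity) hβ
  have hγ0 : 0 ≤ γ := le_trans (by positivity) hγ
  set T := ∑ t : S × U × V × W, A t.1 t.2.1 t.2.2.1 * B t.1 t.2.2.1 t.2.2.2 * C t.1 t.2.1 t.2.2.2 *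
        M t.1 t.2.1 t.2.2.1 t.2.2.2 with hT
  set T₂ := ∑ t : (S × V × W × W) × U,
    (B t.1.1 t.1.2.1 t.1.2.2.1 * conj (B t.1.1 t.1.2.1 t.1.2.2.2)) *
    (C t.1.1 t.2 t.1.2.2.1 * conj (C t.1.1 t.2 t.1.2.2.2) *
      (M t.1.1 t.2 t.1.2.1 t.1.2.2.1 * conj (M t.1.1 t.2 t.1.2.1 t.1.2.2.2))) with hT₂
  set T₃ := ∑ t : (S × W × W × U × U) × V,
    (C t.1.1 t.1.2.2.2.1 t.1.2.1 * conj (C t.1.1 t.1.2.2.2.1 t.1.2.2.1) *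
      conj (C t.1.1 t.1.2.2.2.2 t.1.2.1 * conj (C t.1.1 t.1.2.2.2.2 t.1.2.2.1))) *
    (M t.1.1 t.1.2.2.2.1 t.2 t.1.2.1 * conj (M t.1.1 t.1.2.2.2.1 t.2 t.1.2.2.1) *
          conj (M t.1.1 t.1.2.2.2.2 t.2 t.1.2.1 * conj (M t.1.1 t.1.2.2.2.2 t.2 t.1.2.2.1))) with hT₃
  have s1 : ‖T‖ ^ 2 ≤ α * ‖T₂‖ := by
    have := norm_sum_sq_le_doubling (X := S × U × V) (W := W) (fun t => A t.1 t.2.1 t.2.2)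
      (fun t w => B t.1 t.2.2 w * C t.1 t.2.1 w * M t.1 t.2.1 t.2.2 w) hα
    convert this using 2
    · congr 1
      refine Fintype.sum_equiv ⟨fun t => ((t.1, t.2.1, t.2.2.1), t.2.2.2),
        fun t => (t.1.1, t.1.2.1, t.1.2.2, t.2), fun _ => rfl, fun _ => rfl⟩ _ _ ?_
      intro t
      simp only [Equiv.coe_fn_mk]
      ring
    · congr 1
      refine Fintype.sum_equiv ⟨fun t => ((t.1.1, t.2, t.1.2.1), t.1.2.2.1, t.1.2.2.2),
        fun t => ((t.1.1, t.1.2.2, t.2.1, t.2.2), t.1.2.1), fun _ => rfl, fun _ => rfl⟩ _ _ ?_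
      intro t
      simp only [Equiv.coe_fn_mk, map_mul]
      ring
  have s2 : ‖T₂‖ ^ 2 ≤ (β * Fintype.card W) * ‖T₃‖ := by
    -- One of the two bounded factors is dropped, so the doubled variable costs only a factor `card
    -- W`.
    have hb : ∑ t : S × V × W × W, ‖B t.1 t.2.1 t.2.2.1 * conj (B t.1 t.2.1 t.2.2.2)‖ ^ 2
        ≤ β * Fintype.card W := by
      calc _ ≤ ∑ t : S × V × W × W, ‖B t.1 t.2.1 t.2.2.1‖ ^ 2 := by
            gcongr with t
            rw [norm_mul, RCLike.norm_conj]
            exact mul_le_of_le_one_right (norm_nonneg _) (hB _ _ _)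
        _ = (∑ t : S × V × W, ‖B t.1 t.2.1 t.2.2‖ ^ 2) * Fintype.card W := by
            simp only [Fintype.sum_prod_type, Finset.sum_const, Finset.card_univ, nsmul_eq_mul,
              Finset.sum_mul]
            simp only [mul_comm]
        _ ≤ _ := by gcongr
    have := norm_sum_sq_le_doubling (X := S × V × W × W) (W := U) _
      (fun t u => C t.1 u t.2.2.1 * conj (C t.1 u t.2.2.2) *
      (M t.1 u t.2.1 t.2.2.1 * conj (M t.1 u t.2.1 t.2.2.2))) hb
    convert this using 2
    congr 1
    refine Fintype.sum_equiv ⟨fun t => ((t.1.1, t.2, t.1.2.1, t.1.2.2.1), t.1.2.2.2.1, t.1.2.2.2.2),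
        fun t => ((t.1.1, t.1.2.2.1, t.1.2.2.2, t.2.1, t.2.2), t.1.2.1), fun _ => rfl,
        fun _ => rfl⟩ _ _ ?_
    intro t
    simp only [Equiv.coe_fn_mk, map_mul]
    ring
  -- The last application does not double `v`: the factors `C` do not involve `v`, so the sum over
  -- `v` stays inside the modulus.
  have s3 : ‖T₃‖ ^ 2 ≤ (γ * Fintype.card W * Fintype.card U) *
      ∑ t : S × W × W × U × U, ‖∑ v, M t.1 t.2.2.2.1 v t.2.1 * conj (M t.1 t.2.2.2.1 v t.2.2.1) *
          conj (M t.1 t.2.2.2.2 v t.2.1 * conj (M t.1 t.2.2.2.2 v t.2.2.1))‖ ^ 2 := by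
    have hc : ∑ t : S × W × W × U × U, ‖C t.1 t.2.2.2.1 t.2.1 * conj (C t.1 t.2.2.2.1 t.2.2.1) *
      conj (C t.1 t.2.2.2.2 t.2.1 * conj (C t.1 t.2.2.2.2 t.2.2.1))‖ ^ 2
        ≤ γ * Fintype.card W * Fintype.card U := by
      calc _ ≤ ∑ t : S × W × W × U × U, ‖C t.1 t.2.2.2.1 t.2.1‖ ^ 2 := by
            gcongr with t
            simp only [norm_mul, RCLike.norm_conj]
            rw [mul_assoc]
            refine mul_le_of_le_one_right (norm_nonneg _) ?_
            exact mul_le_one₀ (hC _ _ _) (by positivity)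
              (mul_le_one₀ (hC _ _ _) (norm_nonneg _) (hC _ _ _))
        _ = ∑ t : (S × U × W) × W × U, ‖C t.1.1 t.1.2.1 t.1.2.2‖ ^ 2 := by
            refine Fintype.sum_equiv ⟨fun t => ((t.1, t.2.2.2.1, t.2.1), t.2.2.1, t.2.2.2.2),
              fun t => (t.1.1, t.1.2.2, t.2.1, t.1.2.1, t.2.2), fun _ => rfl,
              fun _ => rfl⟩ _ _ ?_
            intro t
            rfl
        _ = (∑ t : S × U × W, ‖C t.1 t.2.1 t.2.2‖ ^ 2) * Fintype.card W * Fintype.card U := by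
            rw [Fintype.sum_prod_type]
            simp only [Finset.sum_const, Finset.card_univ, nsmul_eq_mul, Fintype.card_prod,
              ← Finset.mul_sum]
            push_cast
            ring
        _ ≤ _ := by gcongr
    have e : T₃ = ∑ t : S × W × W × U × U,
        (C t.1 t.2.2.2.1 t.2.1 * conj (C t.1 t.2.2.2.1 t.2.2.1) *
          conj (C t.1 t.2.2.2.2 t.2.1 * conj (C t.1 t.2.2.2.2 t.2.2.1))) *
        ∑ v, M t.1 t.2.2.2.1 v t.2.1 * conj (M t.1 t.2.2.2.1 v t.2.2.1) *
          conj (M t.1 t.2.2.2.2 v t.2.1 * conj (M t.1 t.2.2.2.2 v t.2.2.1)) := by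
      rw [hT₃, Fintype.sum_prod_type]
      simp only [Finset.mul_sum]
    rw [e]
    exact (norm_sum_mul_sq_le _ _).trans (by gcongr)
  set Z := ∑ t : S × W × W × U × U, ‖∑ v, M t.1 t.2.2.2.1 v t.2.1 * conj (M t.1 t.2.2.2.1 v t.2.2.1) *
          conj (M t.1 t.2.2.2.2 v t.2.1 * conj (M t.1 t.2.2.2.2 v t.2.2.1))‖ ^ 2
  calc ‖T‖ ^ 8 = (‖T‖ ^ 2) ^ 4 := by ring
    _ ≤ (α * ‖T₂‖) ^ 4 := by gcongr
    _ = α ^ 4 * (‖T₂‖ ^ 2) ^ 2 := by ring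
    _ ≤ α ^ 4 * ((β * Fintype.card W) * ‖T₃‖) ^ 2 := by gcongr
    _ = α ^ 4 * (β * Fintype.card W) ^ 2 * ‖T₃‖ ^ 2 := by ring
    _ ≤ α ^ 4 * (β * Fintype.card W) ^ 2 * ((γ * Fintype.card W * Fintype.card U) * Z) := by gcongr
    _ = _ := by ring

/-! ### Box sums along families of shifts in a finite abelian group -/

/-- The multiplicative derivative on an abelian group. -/
def groupDiff {G : Type*} [AddCommGroup G] (h : G) (f : G → ℂ) : G → ℂ :=
  fun x => f (x + h) * conj (f x)

/-- The (unnormalized) box norm of `g` along the two families of shifts `q` and `q'`. -/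
noncomputable def thinBox {G κ : Type*} [AddCommGroup G] [Fintype G] [Fintype κ] (q q' : κ → G) (g : G → ℂ) : ℝ :=
  ∑ t : κ × κ × G, ‖∑ l, g (t.2.2 + q' l + q t.1) * conj (g (t.2.2 + q' l + q t.2.1))‖ ^ 2

theorem sum_prod_shift {R G E : Type*} [Fintype R] [AddCommGroup G] [Fintype G] [AddCommMonoid E]
    (c : R → G) (g : R → G → E) :
    ∑ t : R × G, g t.1 t.2 = ∑ t : R × G, g t.1 (t.2 + c t.1) := by
  rw [Fintype.sum_prod_type, Fintype.sum_prod_type]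
  refine Finset.sum_congr rfl fun r _ => ?_
  exact (Equiv.sum_comp (Equiv.addRight (c r)) (g r)).symm

theorem sum_shift {G E : Type*} [AddCommGroup G] [Fintype G] [AddCommMonoid E]
    (c : G) (g : G → E) : ∑ x, g (x + c) = ∑ x, g x :=
  Equiv.sum_comp (Equiv.addRight c) g

theorem thinBox_eq_sum_shift {G κ : Type*} [AddCommGroup G] [Fintype G] [Fintype κ]
    (q q' : κ → G) (g : G → ℂ) (c : G) :
    thinBox q q' g = ∑ t : (κ × κ) × G,
      ‖∑ l, g (t.2 + c + q' l + q t.1.1) * conj (g (t.2 + c + q' l + q t.1.2))‖ ^ 2 := by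
  rw [← sum_prod_shift (R := κ × κ) (fun _ => c)
    (fun r y => ‖∑ l, g (y + q' l + q r.1) * conj (g (y + q' l + q r.2))‖ ^ 2)]
  unfold thinBox
  simp only [Fintype.sum_prod_type]

theorem sum_norm_sq_shift_le {G : Type*} [AddCommGroup G] [Fintype G] {f : G → ℂ}
    (hf : ∀ x, ‖f x‖ ≤ 1) {I : Finset G} (hI : ∀ x ∉ I, f x = 0) {L : ℝ} (hL : (I.card : ℝ) ≤ L) :
    ∑ x, ‖f x‖ ^ 2 ≤ L := by
  classical
  refine le_trans ?_ hL
  rw [← Finset.sum_subset (Finset.subset_univ I) (fun x _ hx => by simp [hI x hx])]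
  rw [Finset.card_eq_sum_ones]
  push_cast
  gcongr with x
  exact pow_le_one₀ (norm_nonneg _) (hf x)

/-- The square sum over `(r, y)` of a product with a shifted copy of `f` as a factor. -/
theorem sum_norm_sq_mul_le {R G : Type*} [Fintype R] [AddCommGroup G] [Fintype G] {f : G → ℂ}
    (hf : ∀ x, ‖f x‖ ≤ 1) {I : Finset G} (hI : ∀ x ∉ I, f x = 0) {L : ℝ} (hL : (I.card : ℝ) ≤ L)
    (c : R → G) (g : R → G → ℂ) (hg : ∀ r x, ‖g r x‖ ≤ 1) :
    ∑ t : R × G, ‖f (t.2 + c t.1) * g t.1 t.2‖ ^ 2 ≤ Fintype.card R * L := by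
  calc _ ≤ ∑ t : R × G, ‖f (t.2 + c t.1)‖ ^ 2 := by
        gcongr with t
        rw [norm_mul]
        exact mul_le_of_le_one_right (norm_nonneg _) (hg _ _)
    _ = ∑ t : R × G, ‖f t.2‖ ^ 2 := (sum_prod_shift c (fun _ x => ‖f x‖ ^ 2)).symm
    _ = Fintype.card R * ∑ x, ‖f x‖ ^ 2 := by
        rw [Fintype.sum_prod_type]; simp
    _ ≤ _ := by
        gcongr
        exact sum_norm_sq_shift_le hf hI hL

/-- The average of box sums along the families of shifts `p a`, `q a`. -/
noncomputable def familyBoxSum {G ι κ : Type*} [AddCommGroup G] [Fintype G] [Fintype ι] [Fintype κ]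
    (p q : ι → κ → G) (f : G → ℂ) : ℂ :=
  ∑ t : (ι × κ × κ × κ × κ) × G,
    f (t.2 + p t.1.1 t.1.2.1 + q t.1.1 t.1.2.2.2.1) *
    conj (f (t.2 + p t.1.1 t.1.2.2.1 + q t.1.1 t.1.2.2.2.1)) *
    conj (f (t.2 + p t.1.1 t.1.2.1 + q t.1.1 t.1.2.2.2.2)) *
    f (t.2 + p t.1.1 t.1.2.2.1 + q t.1.1 t.1.2.2.2.2)

set_option maxHeartbeats 400000 in
/-- Two rounds of Cauchy–Schwarz turn the average of box sums into an average over pairs of box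
norms in which one of the directions is a sum of two progressions. -/
theorem le_sum_thinBox_of_familyBoxSum {G ι κ : Type*} [AddCommGroup G] [Fintype G]
    [Fintype ι] [Fintype κ] [Nonempty ι] [Nonempty κ] (p q : ι → κ → G) {f : G → ℂ}
    (hf : ∀ x, ‖f x‖ ≤ 1) {I : Finset G} (hI : ∀ x ∉ I, f x = 0) {L θ : ℝ} (hL : (I.card : ℝ) ≤ L)
    (hL0 : 0 < L) (hθ : 0 ≤ θ)
    (hT : θ * Fintype.card ι * Fintype.card κ ^ 4 * L ≤ ‖familyBoxSum p q f‖) :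
    θ ^ 16 * Fintype.card ι ^ 2 * Fintype.card κ ^ 8 * L ≤
      ∑ t : (ι × ι) × κ × κ × κ × κ, thinBox (q t.1.1) (q t.1.2)
        (groupDiff (p t.1.1 t.2.1 - p t.1.1 t.2.2.1 + p t.1.2 t.2.2.2.1 - p t.1.2 t.2.2.2.2) f) := by
  set a : ℝ := (Fintype.card ι : ℝ) with ha
  set k : ℝ := (Fintype.card κ : ℝ) with hk
  have ha0 : 0 < a := by rw [ha]; exact_mod_cast Fintype.card_pos
  have hk0 : 0 < k := by rw [hk]; exact_mod_cast Fintype.card_pos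
  have hLf : ∑ x, ‖f x‖ ^ 2 ≤ L := sum_norm_sq_shift_le hf hI hL
  -- Translating by `p a i + q a j` turns the first corner into `f x`, independent of all
  -- parameters; `E` is the product of the other three corners.
  let E : (ι × κ × κ × κ × κ) → G → ℂ := fun r x =>
    conj (f (x + p r.1 r.2.2.1 - p r.1 r.2.1)) * conj (f (x + q r.1 r.2.2.2.2 - q r.1 r.2.2.2.1)) *
      f (x + p r.1 r.2.2.1 - p r.1 r.2.1 + q r.1 r.2.2.2.2 - q r.1 r.2.2.2.1)
  let F : G → ℂ := fun x => ∑ r, E r x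
  have h0 : familyBoxSum p q f = ∑ x, f x * F x := by
    unfold familyBoxSum
    rw [sum_prod_shift (fun r : ι × κ × κ × κ × κ => - p r.1 r.2.1 - q r.1 r.2.2.2.1)
      (fun r x => f (x + p r.1 r.2.1 + q r.1 r.2.2.2.1) *
        conj (f (x + p r.1 r.2.2.1 + q r.1 r.2.2.2.1)) *
        conj (f (x + p r.1 r.2.1 + q r.1 r.2.2.2.2)) *
        f (x + p r.1 r.2.2.1 + q r.1 r.2.2.2.2)), Fintype.sum_prod_type_right]
    simp only [F, Finset.mul_sum]
    refine Finset.sum_congr rfl fun x _ => Finset.sum_congr rfl fun r _ => ?_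
    simp only [E]
    rw [mul_assoc, mul_assoc, mul_assoc (conj _)]
    congr 1
    · congr 1; abel
    congr 1
    · congr 2; abel
    congr 1
    · congr 2; abel
    · congr 1; abel
  set V : ℝ := ∑ x, ‖F x‖ ^ 2 with hV
  have hV1 : θ ^ 2 * a ^ 2 * k ^ 8 * L ≤ V := by
    have h1 : ‖familyBoxSum p q f‖ ^ 2 ≤ L * V := by
      rw [h0]
      exact (norm_sum_mul_sq_le _ _).trans (by gcongr)
    have h2 : (θ * a * k ^ 4 * L) ^ 2 ≤ L * V := le_trans (by gcongr) h1
    refine le_of_mul_le_mul_left (a := L) ?_ hL0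
    calc _ = (θ * a * k ^ 4 * L) ^ 2 := by ring
      _ ≤ _ := h2
  -- Expanding `V` pairs the tuples `(a,i,i',j,j')` and `(a',k,k',l,l')`. After a translation by `p
  -- a i + q a j + p a' k + q a' l`, the active variables are `u = (i', k)`, `v = l` and `w = j`,
  -- the rest being frozen in `s`. Of the six factors only `M` involves all three; `A`, `B` and `C`
  -- omit `w`, `u` and `v` respectively.
  let S := (ι × ι × κ × κ × κ × κ) × G
  let M : S → κ × κ → κ → κ → ℂ := fun s u v w =>
    conj (f (s.2 + (p s.1.1 u.1 + p s.1.2.1 u.2) + q s.1.2.1 v + q s.1.1 w))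
  let A : S → κ × κ → κ → ℂ := fun s u v =>
    conj (f (s.2 + p s.1.1 s.1.2.2.1 + q s.1.1 s.1.2.2.2.1 + p s.1.2.1 u.2 + q s.1.2.1 v)) *
    f (s.2 + p s.1.1 u.1 + q s.1.1 s.1.2.2.2.1 + p s.1.2.1 u.2 + q s.1.2.1 v)
  let B : S → κ → κ → ℂ := fun s v w =>
    f (s.2 + p s.1.1 s.1.2.2.1 + q s.1.1 w + p s.1.2.1 s.1.2.2.2.2.1 + q s.1.2.1 v) *
    conj (f (s.2 + p s.1.1 s.1.2.2.1 + q s.1.1 w + p s.1.2.1 s.1.2.2.2.2.1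
      + q s.1.2.1 s.1.2.2.2.2.2))
  let C : S → κ × κ → κ → ℂ := fun s u w =>
    f (s.2 + p s.1.1 s.1.2.2.1 + q s.1.1 w + p s.1.2.1 u.2 + q s.1.2.1 s.1.2.2.2.2.2)
  have h3 : (V : ℂ) = ∑ t : S × (κ × κ) × κ × κ, A t.1 t.2.1 t.2.2.1 * B t.1 t.2.2.1 t.2.2.2 *
      C t.1 t.2.1 t.2.2.2 * M t.1 t.2.1 t.2.2.1 t.2.2.2 := by
    have e1 : (V : ℂ) = ∑ t : ((ι × κ × κ × κ × κ) × (ι × κ × κ × κ × κ)) × G,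
        E t.1.1 t.2 * conj (E t.1.2 t.2) := by
      rw [hV, Complex.ofReal_sum]
      simp only [F, norm_sum_sq_eq]
      rw [Fintype.sum_prod_type_right]
      simp only [Fintype.sum_prod_type (α₁ := ι × κ × κ × κ × κ)]
    rw [e1, sum_prod_shift (fun r : (ι × κ × κ × κ × κ) × (ι × κ × κ × κ × κ) =>
      p r.1.1 r.1.2.1 + q r.1.1 r.1.2.2.2.1 + p r.2.1 r.2.2.1 + q r.2.1 r.2.2.2.2.1)
      (fun r x => E r.1 x * conj (E r.2 x))]
    refine Fintype.sum_equiv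
      ⟨fun t => (((t.1.1.1, t.1.2.1, t.1.1.2.1, t.1.1.2.2.2.2, t.1.2.2.2.1, t.1.2.2.2.2.2), t.2),
        (t.1.1.2.2.1, t.1.2.2.1), t.1.2.2.2.2.1, t.1.1.2.2.2.1),
       fun t => (((t.1.1.1, t.1.1.2.2.1, t.2.1.1, t.2.2.2, t.1.1.2.2.2.1),
        (t.1.1.2.1, t.2.1.2, t.1.1.2.2.2.2.1, t.2.2.1, t.1.1.2.2.2.2.2)), t.1.2),
       fun _ => rfl, fun _ => rfl⟩ _ _ ?_
    rintro ⟨⟨⟨a, i, i', j, j'⟩, ⟨a', k, k', l, l'⟩⟩, y⟩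
    simp only [E, M, A, B, C, Equiv.coe_fn_mk, map_mul, Complex.conj_conj]
    have t1 : y + (p a i + q a j + p a' k + q a' l) + p a i' - p a i
      = y + (p a i' + p a' k) + q a' l + q a j := by abel
    have t2 : y + (p a i + q a j + p a' k + q a' l) + q a j' - q a j
      = y + p a i + q a j' + p a' k + q a' l := by abel
    have t3 : y + (p a i' + p a' k) + q a' l + q a j + q a j' - q a j
      = y + p a i' + q a j' + p a' k + q a' l := by abel
    have t4 : y + (p a i + q a j + p a' k + q a' l) + p a' k' - p a' k
      = y + p a i + q a j + p a' k' + q a' l := by abel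
    have t5 : y + (p a i + q a j + p a' k + q a' l) + q a' l' - q a' l
      = y + p a i + q a j + p a' k + q a' l' := by abel
    have t6 : y + p a i + q a j + p a' k' + q a' l + q a' l' - q a' l
      = y + p a i + q a j + p a' k' + q a' l' := by abel
    rw [t1, t2, t3, t4, t5, t6]
    ring
  have hV0 : 0 ≤ V := by positivity
  have hA : ∑ t : S × (κ × κ) × κ, ‖A t.1 t.2.1 t.2.2‖ ^ 2 ≤ a ^ 2 * k ^ 7 * L := by
    have := sum_norm_sq_mul_le (R := (ι × ι × κ × κ × κ × κ) × (κ × κ) × κ) hf hI hL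
      (fun r => p r.1.1 r.2.1.1 + q r.1.1 r.1.2.2.2.1 + p r.1.2.1 r.2.1.2 + q r.1.2.1 r.2.2)
      (fun r x => conj (f (x + p r.1.1 r.1.2.2.1 + q r.1.1 r.1.2.2.2.1 + p r.1.2.1 r.2.1.2
        + q r.1.2.1 r.2.2))) (fun r x => by rw [RCLike.norm_conj]; exact hf _)
    refine le_trans (le_of_eq ?_) (this.trans (le_of_eq ?_))
    · refine Fintype.sum_equiv ⟨fun t => ((t.1.1, t.2), t.1.2), fun t => ((t.1.1, t.2), t.1.2),
        fun _ => rfl, fun _ => rfl⟩ _ _ ?_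
      intro t
      simp only [A, Equiv.coe_fn_mk, add_assoc, mul_comm]
    · simp only [Fintype.card_prod, ha, hk]; push_cast; ring
  have hB : ∑ t : S × κ × κ, ‖B t.1 t.2.1 t.2.2‖ ^ 2 ≤ a ^ 2 * k ^ 6 * L := by
    have := sum_norm_sq_mul_le (R := (ι × ι × κ × κ × κ × κ) × κ × κ) hf hI hL
      (fun r => p r.1.1 r.1.2.2.1 + q r.1.1 r.2.2 + p r.1.2.1 r.1.2.2.2.2.1 + q r.1.2.1 r.2.1)
      (fun r x => conj (f (x + p r.1.1 r.1.2.2.1 + q r.1.1 r.2.2 + p r.1.2.1 r.1.2.2.2.2.1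
      + q r.1.2.1 r.1.2.2.2.2.2))) (fun r x => by rw [RCLike.norm_conj]; exact hf _)
    refine le_trans (le_of_eq ?_) (this.trans (le_of_eq ?_))
    · refine Fintype.sum_equiv ⟨fun t => ((t.1.1, t.2), t.1.2), fun t => ((t.1.1, t.2), t.1.2),
        fun _ => rfl, fun _ => rfl⟩ _ _ ?_
      intro t
      simp only [B, Equiv.coe_fn_mk, add_assoc]
    · simp only [Fintype.card_prod, ha, hk]; push_cast; ring
  have hC : ∑ t : S × (κ × κ) × κ, ‖C t.1 t.2.1 t.2.2‖ ^ 2 ≤ a ^ 2 * k ^ 7 * L := by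
    have := sum_norm_sq_mul_le (R := (ι × ι × κ × κ × κ × κ) × (κ × κ) × κ) hf hI hL
      (fun r => p r.1.1 r.1.2.2.1 + q r.1.1 r.2.2 + p r.1.2.1 r.2.1.2
        + q r.1.2.1 r.1.2.2.2.2.2)
      (fun r x => 1) (fun r x => by simp)
    refine le_trans (le_of_eq ?_) (this.trans (le_of_eq ?_))
    · refine Fintype.sum_equiv ⟨fun t => ((t.1.1, t.2), t.1.2), fun t => ((t.1.1, t.2), t.1.2),
        fun _ => rfl, fun _ => rfl⟩ _ _ ?_
      intro t
      simp only [C, Equiv.coe_fn_mk, add_assoc, mul_one]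
    · simp only [Fintype.card_prod, ha, hk]; push_cast; ring
  have key := norm_sum_pow_eight_le_box M A B C
    (fun s v w => by
      simp only [B, norm_mul, RCLike.norm_conj]
      exact mul_le_one₀ (hf _) (norm_nonneg _) (hf _))
    (fun s u w => hf _) hA hB hC
  rw [← h3, Complex.norm_real, Real.norm_of_nonneg hV0] at key
  -- `M` sees only `a`, `a'` and `y` among the frozen variables, and the other four, `i, j', k',
  -- l'`, contribute the factor `k ^ 4`. Doubling `u` gives the derivative with shift `p a i - p a
  -- i' + p a' k - p a' k'`; doubling `w` and keeping the sum over `v` gives the thin box.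
  have hZ : ∑ t : S × κ × κ × (κ × κ) × (κ × κ),
      ‖∑ v, M t.1 t.2.2.2.1 v t.2.1 * conj (M t.1 t.2.2.2.1 v t.2.2.1) *
        conj (M t.1 t.2.2.2.2 v t.2.1 * conj (M t.1 t.2.2.2.2 v t.2.2.1))‖ ^ 2
      = k ^ 4 * ∑ t : (ι × ι) × κ × κ × κ × κ, thinBox (q t.1.1) (q t.1.2)
        (groupDiff (p t.1.1 t.2.1 - p t.1.1 t.2.2.1 + p t.1.2 t.2.2.2.1 - p t.1.2 t.2.2.2.2) f) := by
    have e1 : ∀ (r : (ι × ι) × κ × κ × κ × κ), thinBox (q r.1.1) (q r.1.2)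
        (groupDiff (p r.1.1 r.2.1 - p r.1.1 r.2.2.1 + p r.1.2 r.2.2.2.1 - p r.1.2 r.2.2.2.2) f)
        = ∑ t : (κ × κ) × G,
        ‖∑ v, M ((r.1.1, r.1.2, r.2.1, r.2.1, r.2.1, r.2.1), t.2) (r.2.1, r.2.2.2.1) v t.1.1 *
          conj (M ((r.1.1, r.1.2, r.2.1, r.2.1, r.2.1, r.2.1), t.2) (r.2.1, r.2.2.2.1) v t.1.2) *
          conj (M ((r.1.1, r.1.2, r.2.1, r.2.1, r.2.1, r.2.1), t.2) (r.2.2.1, r.2.2.2.2) v t.1.1 *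
          conj (M ((r.1.1, r.1.2, r.2.1, r.2.1, r.2.1, r.2.1), t.2)
            (r.2.2.1, r.2.2.2.2) v t.1.2))‖ ^ 2 := by
      rintro ⟨⟨a, a'⟩, i, i', k, k'⟩
      rw [thinBox_eq_sum_shift _ _ _ (p a i' + p a' k')]
      refine Finset.sum_congr rfl ?_
      rintro ⟨⟨j, j'⟩, y⟩ -
      rw [← RCLike.norm_conj, map_sum]
      congr 2
      refine Finset.sum_congr rfl fun l _ => ?_
      simp only [groupDiff, M, map_mul, Complex.conj_conj]
      have t1 : ∀ j, y + (p a i' + p a' k') + q a' l + q a j + (p a i - p a i' + p a' k - p a' k')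
        = y + (p a i + p a' k) + q a' l + q a j := by intro j; abel
      rw [t1, t1]
      ring
    simp only [e1]
    rw [← Fintype.sum_prod_type']
    have hk4 : k ^ 4 = ∑ _ : κ × κ × κ × κ, (1 : ℝ) := by
      simp only [Finset.sum_const, Finset.card_univ, Fintype.card_prod, hk, nsmul_eq_mul]
      push_cast; ring
    rw [hk4, Finset.sum_mul_sum, ← Fintype.sum_prod_type']
    refine Fintype.sum_equiv ⟨fun t => ((t.1.1.2.2.1, t.1.1.2.2.2.1, t.1.1.2.2.2.2.1,
      t.1.1.2.2.2.2.2), (((t.1.1.1, t.1.1.2.1), t.2.2.2.1.1, t.2.2.2.2.1, t.2.2.2.1.2,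
        t.2.2.2.2.2), ((t.2.1, t.2.2.1), t.1.2))),
      fun t => (((t.2.1.1.1, t.2.1.1.2, t.1), t.2.2.2), t.2.2.1.1, t.2.2.1.2,
        (t.2.1.2.1, t.2.1.2.2.2.1), (t.2.1.2.2.1, t.2.1.2.2.2.2)),
        fun _ => rfl, fun _ => rfl⟩ _ _ fun t => ?_
    simp only [Equiv.coe_fn_mk, one_mul, M]
  rw [hZ] at key
  set Y := ∑ t : (ι × ι) × κ × κ × κ × κ, thinBox (q t.1.1) (q t.1.2)
        (groupDiff (p t.1.1 t.2.1 - p t.1.1 t.2.2.1 + p t.1.2 t.2.2.2.1 - p t.1.2 t.2.2.2.2) f)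
  have h8 : (θ ^ 2 * a ^ 2 * k ^ 8 * L) ^ 8 ≤ V ^ 8 := by gcongr
  have h9 := h8.trans key
  rw [Fintype.card_prod] at h9
  push_cast at h9
  rw [← hk] at h9
  refine le_of_mul_le_mul_left (a := a ^ 14 * k ^ 56 * L ^ 7) ?_ (by positivity)
  calc _ = (θ ^ 2 * a ^ 2 * k ^ 8 * L) ^ 8 := by ring
    _ ≤ _ := h9
    _ = _ := by ring

/-! ### Derivatives and trivial bounds -/

theorem groupDiff_comm {G : Type*} [AddCommGroup G] (d d' : G) (f : G → ℂ) :
    groupDiff d (groupDiff d' f) = groupDiff d' (groupDiff d f) := by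
  funext x
  simp only [groupDiff, map_mul, Complex.conj_conj, add_right_comm x d d']
  ring

theorem groupDiff_zero {G : Type*} [AddCommGroup G] (d : G) : groupDiff d (0 : G → ℂ) = 0 := by
  funext x
  simp [groupDiff]

theorem sum_sum_groupDiff {G : Type*} [AddCommGroup G] [Fintype G] (g : G → ℂ) :
    ∑ h, ∑ x, groupDiff h g x = ((‖∑ x, g x‖ ^ 2 : ℝ) : ℂ) := by
  rw [norm_sum_sq_eq, Finset.sum_comm]
  rw [Finset.sum_comm (f := fun i j => g i * conj (g j))]
  refine Finset.sum_congr rfl fun x _ => ?_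
  simp only [groupDiff]
  rw [← sum_shift x (fun h => g h * conj (g x))]
  simp only [add_comm]

theorem norm_groupDiff_le {G : Type*} [AddCommGroup G] {f : G → ℂ} (hf : ∀ x, ‖f x‖ ≤ 1) (h x : G) :
    ‖groupDiff h f x‖ ≤ 1 := by
  simp only [groupDiff, norm_mul, RCLike.norm_conj]
  exact mul_le_one₀ (hf _) (norm_nonneg _) (hf _)

theorem groupDiff_eq_zero_of_notMem {G : Type*} [AddCommGroup G] {f : G → ℂ} {I : Finset G}
    (hI : ∀ x ∉ I, f x = 0) (h x : G) (hx : x ∉ I) : groupDiff h f x = 0 := by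
  simp [groupDiff, hI x hx]

/-- The squared modulus of the sum of the second multiplicative derivative `Δ_{d,d'} f`. -/
noncomputable def diffSumSq {G : Type*} [AddCommGroup G] [Fintype G] (f : G → ℂ) (d d' : G) : ℝ :=
  ‖∑ x, groupDiff d (groupDiff d' f) x‖ ^ 2

theorem diffSumSq_nonneg {G : Type*} [AddCommGroup G] [Fintype G] (f : G → ℂ) (d d' : G) :
    0 ≤ diffSumSq f d d' := by
  unfold diffSumSq
  positivity

theorem diffSumSq_comm {G : Type*} [AddCommGroup G] [Fintype G] (f : G → ℂ) (d d' : G) :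
    diffSumSq f d d' = diffSumSq f d' d := by
  rw [diffSumSq, groupDiff_comm, diffSumSq]

theorem norm_sum_le_of_support {G : Type*} [AddCommGroup G] [Fintype G] {f : G → ℂ}
    (hf : ∀ x, ‖f x‖ ≤ 1) {I : Finset G} (hI : ∀ x ∉ I, f x = 0) {L : ℝ} (hL : (I.card : ℝ) ≤ L) :
    ‖∑ x, f x‖ ≤ L := by
  refine le_trans ?_ hL
  rw [← Finset.sum_subset (Finset.subset_univ I) (fun x _ hx => hI x hx), Finset.card_eq_sum_ones]
  push_cast
  exact (norm_sum_le _ _).trans (Finset.sum_le_sum fun x _ => hf x)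

theorem diffSumSq_le {G : Type*} [AddCommGroup G] [Fintype G] {f : G → ℂ}
    (hf : ∀ x, ‖f x‖ ≤ 1) {I : Finset G} (hI : ∀ x ∉ I, f x = 0) {L : ℝ} (hL : (I.card : ℝ) ≤ L)
    (d d' : G) : diffSumSq f d d' ≤ L ^ 2 := by
  unfold diffSumSq
  gcongr
  exact norm_sum_le_of_support (norm_groupDiff_le (norm_groupDiff_le hf _) _)
    (groupDiff_eq_zero_of_notMem (groupDiff_eq_zero_of_notMem hI _) _) hL

theorem thinBox_nonneg {G κ : Type*} [AddCommGroup G] [Fintype G] [Fintype κ]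
    (q q' : κ → G) (g : G → ℂ) : 0 ≤ thinBox q q' g := by
  unfold thinBox
  positivity

/-- Cauchy–Schwarz in `l` leaves four free indices and one translated copy of `g`, whose square sum
is at most `L`. This controls the exceptional pairs. -/
theorem thinBox_le {G κ : Type*} [AddCommGroup G] [Fintype G] [Fintype κ]
    (q q' : κ → G) {g : G → ℂ} (hg : ∀ x, ‖g x‖ ≤ 1) {I : Finset G} (hI : ∀ x ∉ I, g x = 0) {L : ℝ}
    (hL : (I.card : ℝ) ≤ L) : thinBox q q' g ≤ Fintype.card κ ^ 4 * L := by
  have h1 : ∀ (y : G) (j j' : κ), ‖∑ l, g (y + q' l + q j) * conj (g (y + q' l + q j'))‖ ^ 2 ≤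
      Fintype.card κ * ∑ l, ‖g (y + q' l + q j)‖ ^ 2 := by
    intro y j j'
    have := norm_sum_mul_sq_le (fun _ : κ => (1 : ℂ))
      (fun l => g (y + q' l + q j) * conj (g (y + q' l + q j')))
    simp only [one_mul, norm_one, one_pow, Finset.sum_const, Finset.card_univ, nsmul_eq_mul,
      mul_one] at this
    refine this.trans ?_
    gcongr with l
    rw [norm_mul, RCLike.norm_conj]
    exact mul_le_of_le_one_right (norm_nonneg _) (hg _)
  calc thinBox q q' g
      ≤ ∑ t : κ × κ × G, Fintype.card κ * ∑ l, ‖g (t.2.2 + q' l + q t.1)‖ ^ 2 :=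
        Finset.sum_le_sum fun t _ => h1 _ _ _
    _ = ∑ j : κ, ∑ _ : κ, Fintype.card κ * ∑ l, ∑ y, ‖g (y + (q' l + q j))‖ ^ 2 := by
        simp only [Fintype.sum_prod_type, ← Finset.mul_sum]
        simp only [add_assoc]
        refine congrArg _ (Finset.sum_congr rfl fun j _ => Finset.sum_congr rfl fun _ _ => ?_)
        exact Finset.sum_comm
    _ = (Fintype.card κ : ℝ) ^ 4 * ∑ y, ‖g y‖ ^ 2 := by
        simp only [fun c => sum_shift c (fun y => ‖g y‖ ^ 2), Finset.sum_const, Finset.card_univ,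
          nsmul_eq_mul]
        ring
    _ ≤ _ := by
        gcongr
        exact sum_norm_sq_shift_le hg hI hL

theorem thinBox_eq_sum_groupDiff {G κ : Type*} [AddCommGroup G] [Fintype G] [Fintype κ]
    (q q' : κ → G) (g : G → ℂ) :
    (thinBox q q' g : ℂ) = ∑ j, ∑ j', ∑ l, ∑ l', ∑ y,
      groupDiff (q j - q j') (groupDiff (q' l - q' l') g) y := by
  unfold thinBox
  rw [Complex.ofReal_sum]
  simp only [norm_sum_sq_eq, Fintype.sum_prod_type]
  refine Finset.sum_congr rfl fun j _ => Finset.sum_congr rfl fun j' _ => ?_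
  rw [Finset.sum_comm]
  refine Finset.sum_congr rfl fun l _ => ?_
  rw [Finset.sum_comm]
  refine Finset.sum_congr rfl fun l' _ => ?_
  rw [← sum_shift (q' l' + q j')
    (fun y => groupDiff (q j - q j') (groupDiff (q' l - q' l') g) y)]
  refine Finset.sum_congr rfl fun y _ => ?_
  simp only [groupDiff, map_mul, Complex.conj_conj]
  have t1 : y + (q' l' + q j') + (q j - q j') + (q' l - q' l') = y + q' l + q j := by abel
  have t2 : y + (q' l' + q j') + (q j - q j') = y + q' l' + q j := by abel
  have t3 : y + (q' l' + q j') + (q' l - q' l') = y + q' l + q j' := by abel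
  have t4 : y + (q' l' + q j') = y + q' l' + q j' := by abel
  rw [t1, t2, t3, t4]
  ring

/-- Derivatives commute, so `Δ_h` can be moved outermost; summing over every `h` and the base point
then closes up into the squared modulus of a sum. This is the gain from having a free direction. -/
theorem sum_thinBox_groupDiff {G κ : Type*} [AddCommGroup G] [Fintype G] [Fintype κ]
    (q q' : κ → G) (f : G → ℂ) :
    ∑ h, thinBox q q' (groupDiff h f) =
      ∑ j, ∑ j', ∑ l, ∑ l', diffSumSq f (q j - q j') (q' l - q' l') := by
  rw [← Complex.ofReal_inj]
  simp only [Complex.ofReal_sum, thinBox_eq_sum_groupDiff]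
  rw [Finset.sum_comm]
  refine Finset.sum_congr rfl fun j _ => ?_
  rw [Finset.sum_comm]
  refine Finset.sum_congr rfl fun j' _ => ?_
  rw [Finset.sum_comm]
  refine Finset.sum_congr rfl fun l _ => ?_
  rw [Finset.sum_comm]
  refine Finset.sum_congr rfl fun l' _ => ?_
  rw [diffSumSq, ← sum_sum_groupDiff]
  refine Finset.sum_congr rfl fun h _ => ?_
  rw [groupDiff_comm _ h, groupDiff_comm _ h]

/-! ### Representation counts and concatenation -/

/-- Quantitative equidistribution of the sums of two progressions of the family `p`: outside a
proportion `η` of the pairs, no element has more than `R η` representations. -/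
def HasFewReps {G ι κ : Type*} [AddCommGroup G] [Fintype ι] [Fintype κ] [DecidableEq G]
    (p : ι → κ → G) (R : ℝ → ℝ) : Prop :=
  ∀ η : ℝ, 0 < η → η ≤ 1 → ∃ bad : Finset (ι × ι), (bad.card : ℝ) ≤ η * Fintype.card ι ^ 2 ∧
    ∀ t ∉ bad, ∀ h : G, (((Finset.univ : Finset (κ × κ × κ × κ)).filter fun s =>
      p t.1 s.1 - p t.1 s.2.1 + p t.2 s.2.2.1 - p t.2 s.2.2.2 = h).card : ℝ) ≤ R η

/-- Replaces special shifts by all shifts. For a good pair, grouping the parameters by the shift `h`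
they produce costs at most the multiplicity `R η`; for a bad pair the bound `B` is used. -/
theorem HasFewReps.sum_le {G ι κ : Type*} [AddCommGroup G] [Fintype G] [Fintype ι] [Fintype κ]
    [DecidableEq G] {p : ι → κ → G} {R : ℝ → ℝ} (hp : HasFewReps p R) {η : ℝ} (hη : 0 < η)
    (hη1 : η ≤ 1) (w : ι × ι → G → ℝ) {B : ℝ} (hw0 : ∀ t h, 0 ≤ w t h) (hwB : ∀ t h, w t h ≤ B)
    (hR : 0 ≤ R η) :
    ∑ t : (ι × ι) × κ × κ × κ × κ,
      w t.1 (p t.1.1 t.2.1 - p t.1.1 t.2.2.1 + p t.1.2 t.2.2.2.1 - p t.1.2 t.2.2.2.2) ≤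
    η * Fintype.card ι ^ 2 * Fintype.card κ ^ 4 * B + R η * ∑ t, ∑ h, w t h := by
  classical
  obtain ⟨bad, hbad, hgood⟩ := hp η hη hη1
  rw [Fintype.sum_prod_type]
  have h1 : ∀ t ∉ bad, ∑ s : κ × κ × κ × κ,
      w t (p t.1 s.1 - p t.1 s.2.1 + p t.2 s.2.2.1 - p t.2 s.2.2.2) ≤ R η * ∑ h, w t h := by
    intro t ht
    rw [← Finset.sum_fiberwise (Finset.univ : Finset (κ × κ × κ × κ))
      (fun s => p t.1 s.1 - p t.1 s.2.1 + p t.2 s.2.2.1 - p t.2 s.2.2.2), Finset.mul_sum]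
    refine Finset.sum_le_sum fun h _ => ?_
    rw [Finset.sum_congr rfl (g := fun _ => w t h)
      (fun s hs => by rw [(Finset.mem_filter.1 hs).2]), Finset.sum_const, nsmul_eq_mul]
    exact mul_le_mul_of_nonneg_right (hgood t ht h) (hw0 t h)
  have h2 : ∀ t, ∑ s : κ × κ × κ × κ,
      w t (p t.1 s.1 - p t.1 s.2.1 + p t.2 s.2.2.1 - p t.2 s.2.2.2) ≤ Fintype.card κ ^ 4 * B := by
    intro t
    refine (Finset.sum_le_sum fun s _ => hwB t _).trans (le_of_eq ?_)
    simp only [Finset.sum_const, Finset.card_univ, Fintype.card_prod, nsmul_eq_mul]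
    push_cast; ring
  have hB : bad.Nonempty → 0 ≤ B := fun ⟨t, _⟩ => (hw0 t 0).trans (hwB t 0)
  rw [← Finset.sum_add_sum_compl bad]
  have h3 : ∑ t ∈ bad, ∑ s : κ × κ × κ × κ,
      w t (p t.1 s.1 - p t.1 s.2.1 + p t.2 s.2.2.1 - p t.2 s.2.2.2) ≤
      bad.card * (Fintype.card κ ^ 4 * B) := by
    refine (Finset.sum_le_sum fun t _ => h2 t).trans (le_of_eq ?_)
    rw [Finset.sum_const, nsmul_eq_mul]
  have h4 : ∑ t ∈ badᶜ, ∑ s : κ × κ × κ × κ,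
      w t (p t.1 s.1 - p t.1 s.2.1 + p t.2 s.2.2.1 - p t.2 s.2.2.2) ≤ R η * ∑ t, ∑ h, w t h := by
    refine (Finset.sum_le_sum fun t ht => h1 t (Finset.mem_compl.1 ht)).trans ?_
    rw [← Finset.mul_sum]
    gcongr
    · exact fun t _ _ => Finset.sum_nonneg fun h _ => hw0 t h
    · exact Finset.subset_univ _
  refine add_le_add (h3.trans ?_) h4
  -- The sign of `B` is known only when some pair exists; without pairs both sides vanish.
  by_cases hι : Nonempty (ι × ι)
  · obtain ⟨t⟩ := hι
    have hB0 : 0 ≤ B := (hw0 t 0).trans (hwB t 0)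
    calc _ ≤ (η * Fintype.card ι ^ 2) * (Fintype.card κ ^ 4 * B) := by gcongr
      _ = _ := by ring
  · rw [not_nonempty_iff] at hι
    have : bad = ∅ := Finset.eq_empty_of_isEmpty bad
    have h0 : (Fintype.card ι : ℝ) ^ 2 = 0 := by
      have := Fintype.card_eq_zero (α := ι × ι)
      rw [Fintype.card_prod] at this
      rw [sq]; exact_mod_cast this
    simp [this, h0]

/-- Concatenation of the one-dimensional box norms along the family `q`. -/
theorem sq_sum_diffSumSq_le {G ι κ : Type*} [AddCommGroup G] [Fintype G] [Fintype ι] [Fintype κ]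
    (q : ι → κ → G) {f : G → ℂ} (hf : ∀ x, ‖f x‖ ≤ 1) {I D : Finset G} (hI : ∀ x ∉ I, f x = 0)
    {L : ℝ} (hL : (I.card : ℝ) ≤ L) (hD : ∀ h ∉ D, groupDiff h f = 0) (hDL : (D.card : ℝ) ≤ 2 * L)
    (d' : G) :
    (∑ t : ι × κ × κ, diffSumSq f (q t.1 t.2.1 - q t.1 t.2.2) d') ^ 2 ≤
      2 * L ^ 2 * ∑ t : (ι × ι) × κ × κ × κ × κ,
        diffSumSq f (q t.1.1 t.2.1 - q t.1.1 t.2.2.1 + q t.1.2 t.2.2.2.1 - q t.1.2 t.2.2.2.2) d' := by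
  classical
  have hL0 : 0 ≤ L := le_trans (by positivity) hL
  let g : G → G → ℂ := fun h => groupDiff h (groupDiff d' f)
  have hg0 : ∀ h ∉ D, g h = 0 := fun h hh => by
    simp only [g]
    rw [groupDiff_comm, hD h hh, groupDiff_zero]
  -- Opening the square with a new shift `h` makes `d` enter through a single derivative of `g h`.
  have hΨ : ∀ d, (diffSumSq f d d' : ℂ) = ∑ h, ∑ y, groupDiff d (g h) y := by
    intro d
    rw [diffSumSq, ← sum_sum_groupDiff]
    refine Finset.sum_congr rfl fun h _ => ?_
    rw [groupDiff_comm h d]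
  set X := ∑ t : ι × κ × κ, diffSumSq f (q t.1 t.2.1 - q t.1 t.2.2) d' with hX
  let Y : G → ℂ := fun h => ∑ t : ι × κ × κ, ∑ y, groupDiff (q t.1 t.2.1 - q t.1 t.2.2) (g h) y
  let K : G → G → ℂ := fun h y => ∑ t : ι × κ × κ, g h (y + (q t.1 t.2.1 - q t.1 t.2.2))
  have hXY : (X : ℂ) = ∑ h : D, 1 * Y h := by
    rw [hX, Complex.ofReal_sum]
    simp only [hΨ, one_mul]
    rw [Finset.sum_comm, Finset.sum_coe_sort D Y, Finset.sum_subset (Finset.subset_univ D)]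
    intro h _ hh
    simp [Y, hg0 h hh, groupDiff_zero]
  -- The factor `conj (g h y)` does not involve the family parameters, so Cauchy–Schwarz removes it
  -- and squares the sum over them.
  have hYK : ∀ h, Y h = ∑ y, conj (g h y) * K h y := by
    intro h
    simp only [Y, K, Finset.mul_sum, groupDiff]
    rw [Finset.sum_comm]
    refine Finset.sum_congr rfl fun y _ => Finset.sum_congr rfl fun t _ => mul_comm _ _
  have hK : ∀ h, ((∑ y, ‖K h y‖ ^ 2 : ℝ) : ℂ) = ∑ t : (ι × ι) × κ × κ × κ × κ, ∑ y,
      groupDiff (q t.1.1 t.2.1 - q t.1.1 t.2.2.1 + q t.1.2 t.2.2.2.1 - q t.1.2 t.2.2.2.2)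
        (g h) y := by
    intro h
    rw [Complex.ofReal_sum]
    simp only [K, norm_sum_sq_eq]
    rw [Finset.sum_comm, Finset.sum_congr rfl fun _ _ => Finset.sum_comm,
      ← Fintype.sum_prod_type']
    -- Squaring yields a difference of two shifts; swapping the last two indices writes it as the
    -- sum counted in `HasFewReps`.
    refine Fintype.sum_equiv ⟨fun t => ((t.1.1, t.2.1), t.1.2.1, t.1.2.2, t.2.2.2, t.2.2.1),
      fun t => ((t.1.1, t.2.1, t.2.2.1), (t.1.2, t.2.2.2.2, t.2.2.2.1)), fun _ => rfl,
      fun _ => rfl⟩ _ _ ?_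
    rintro ⟨⟨a, j, j'⟩, ⟨a', k, k'⟩⟩
    simp only [Equiv.coe_fn_mk, groupDiff]
    rw [← sum_shift (q a' k - q a' k') (fun y => g h (y + (q a j - q a j' + q a' k' - q a' k)) *
      conj (g h y))]
    have e : ∀ y, y + (q a' k - q a' k') + (q a j - q a j' + q a' k' - q a' k)
      = y + (q a j - q a j') := fun y => by abel
    simp only [e]
  have hKsum : ∑ h, ∑ y, ‖K h y‖ ^ 2 = ∑ t : (ι × ι) × κ × κ × κ × κ,
      diffSumSq f (q t.1.1 t.2.1 - q t.1.1 t.2.2.1 + q t.1.2 t.2.2.2.1 - q t.1.2 t.2.2.2.2) d' := by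
    rw [← Complex.ofReal_inj, Complex.ofReal_sum, Complex.ofReal_sum]
    simp only [hK, hΨ]
    exact Finset.sum_comm
  have hX2 : X ^ 2 ≤ 2 * L * ∑ h : D, ‖Y h‖ ^ 2 := by
    have := norm_sum_mul_sq_le (fun _ : D => (1 : ℂ)) (fun h => Y h)
    rw [← hXY, Complex.norm_real, Real.norm_eq_abs, sq_abs] at this
    refine this.trans ?_
    gcongr
    simpa using hDL
  have hY2 : ∀ h, ‖Y h‖ ^ 2 ≤ L * ∑ y, ‖K h y‖ ^ 2 := by
    intro h
    rw [hYK]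
    refine (norm_sum_mul_sq_le _ _).trans ?_
    gcongr
    simp only [RCLike.norm_conj]
    exact sum_norm_sq_shift_le (norm_groupDiff_le (norm_groupDiff_le hf _) _)
      (groupDiff_eq_zero_of_notMem (groupDiff_eq_zero_of_notMem hI _) _) hL
  calc X ^ 2 ≤ 2 * L * ∑ h : D, ‖Y h‖ ^ 2 := hX2
    _ ≤ 2 * L * ∑ h : D, L * ∑ y, ‖K h y‖ ^ 2 := by gcongr with h; exact hY2 h
    _ ≤ 2 * L * ∑ h, L * ∑ y, ‖K h y‖ ^ 2 := by
        gcongr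
        rw [Finset.sum_coe_sort D (fun h => L * ∑ y, ‖K h y‖ ^ 2)]
        exact Finset.sum_le_sum_of_subset_of_nonneg (Finset.subset_univ D)
          fun h _ _ => by positivity
    _ = _ := by
        rw [← Finset.mul_sum, hKsum]
        ring

theorem two_mul_pow_succ_le {θ : ℝ} (hθ : 0 < θ) (hθ1 : θ ≤ 1 / 1000) (n : ℕ) :
    1000 * θ ^ (n + 1) ≤ θ ^ n := by
  rw [pow_succ]
  nlinarith [pow_pos hθ n]

/-- The exceptional contribution is absorbed into the left side: smallness of `θ` makes the error at
most `8/1000` of the main term, at the price of one power of `θ`. -/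
theorem pow_mul_le_of_le_add {θ P Q : ℝ} (hθ : 0 < θ) (hθ1 : θ ≤ 1 / 1000) (hP : 0 ≤ P) (n : ℕ)
    (h : θ ^ n * P ≤ 8 * θ ^ (n + 1) * P + Q) : θ ^ (n + 1) * P ≤ Q := by
  have := mul_le_mul_of_nonneg_right (two_mul_pow_succ_le hθ hθ1 n) hP
  have h2 : 0 ≤ θ ^ (n + 1) * P := by positivity
  nlinarith

section Concatenation

variable {G ι κ : Type*} [AddCommGroup G] [Fintype G] [DecidableEq G] [Fintype ι] [Fintype κ]

theorem sum_pair_rearrange {E : Type*} [AddCommMonoid E] (w : ι × κ × κ → ι × κ × κ → E) :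
    ∑ t : (ι × ι) × κ × κ × κ × κ, w (t.1.1, t.2.1, t.2.2.1) (t.1.2, t.2.2.2.1, t.2.2.2.2) =
      ∑ s, ∑ t, w t s := by
  rw [← Fintype.sum_prod_type' (f := fun s t => w t s)]
  let e : (ι × ι) × κ × κ × κ × κ ≃ (ι × κ × κ) × ι × κ × κ :=
    ⟨fun t => ((t.1.2, t.2.2.2.1, t.2.2.2.2), t.1.1, t.2.1, t.2.2.1),
      fun t => ((t.2.1, t.1.1), t.2.2.1, t.2.2.2, t.1.2), fun _ => rfl, fun _ => rfl⟩
  exact Fintype.sum_equiv e _ _ fun _ => rfl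

/-- Frees the direction `p`. A proportion `θ ^ 17` of bad pairs is negligible against the main term
`θ ^ 16`. The exponent is `54 = 17 + 3 + 2 * 17`, the last two terms being the cost of the
multiplicity bound at `η = θ ^ 17`. -/
theorem sum_sum_diffSumSq_ge_of_sum_thinBox [Nonempty ι] [Nonempty κ] {p q : ι → κ → G} {f : G → ℂ}
    (hf : ∀ x, ‖f x‖ ≤ 1) {I : Finset G} (hI : ∀ x ∉ I, f x = 0)
    {L θ : ℝ} (hL : (I.card : ℝ) ≤ L) (hL0 : 0 < L) (hθ : 0 < θ) (hθ1 : θ ≤ 1 / 1000)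
    (hp : HasFewReps p fun η => Fintype.card κ ^ 4 / (L * θ ^ 3 * η ^ 2))
    (hT : θ ^ 16 * Fintype.card ι ^ 2 * Fintype.card κ ^ 8 * L ≤
      ∑ t : (ι × ι) × κ × κ × κ × κ, thinBox (q t.1.1) (q t.1.2)
        (groupDiff (p t.1.1 t.2.1 - p t.1.1 t.2.2.1 + p t.1.2 t.2.2.2.1 - p t.1.2 t.2.2.2.2) f)) :
    θ ^ 54 * Fintype.card ι ^ 2 * Fintype.card κ ^ 4 * L ^ 2 ≤
      ∑ s : ι × κ × κ, ∑ t : ι × κ × κ,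
        diffSumSq f (q t.1 t.2.1 - q t.1 t.2.2) (q s.1 s.2.1 - q s.1 s.2.2) := by
  set a : ℝ := (Fintype.card ι : ℝ) with ha
  set k : ℝ := (Fintype.card κ : ℝ) with hk
  have ha0 : 0 < a := by rw [ha]; exact_mod_cast Fintype.card_pos
  have hk0 : 0 < k := by rw [hk]; exact_mod_cast Fintype.card_pos
  have h := hp.sum_le (η := θ ^ 17) (by positivity) (pow_le_one₀ hθ.le (by linarith))
    (fun t h => thinBox (q t.1) (q t.2) (groupDiff h f)) (B := k ^ 4 * L)
    (fun t h => thinBox_nonneg _ _ _)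
    (fun t h => thinBox_le _ _ (norm_groupDiff_le hf _) (groupDiff_eq_zero_of_notMem hI _) hL)
    (by positivity)
  have h1 := hT.trans h
  have e : ∑ t : ι × ι, ∑ h, thinBox (q t.1) (q t.2) (groupDiff h f) =
      ∑ s : ι × κ × κ, ∑ t : ι × κ × κ,
        diffSumSq f (q t.1 t.2.1 - q t.1 t.2.2) (q s.1 s.2.1 - q s.1 s.2.2) := by
    simp only [sum_thinBox_groupDiff]
    rw [← sum_pair_rearrange fun t s =>
      diffSumSq f (q t.1 t.2.1 - q t.1 t.2.2) (q s.1 s.2.1 - q s.1 s.2.2)]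
    simp only [Fintype.sum_prod_type]
  rw [e, ← hk, ← ha] at h1
  set Y := ∑ s : ι × κ × κ, ∑ t : ι × κ × κ,
        diffSumSq f (q t.1 t.2.1 - q t.1 t.2.2) (q s.1 s.2.1 - q s.1 s.2.2)
  have h2 : θ ^ (16 + 1) * (a ^ 2 * k ^ 8 * L) ≤ k ^ 4 / (L * θ ^ 3 * (θ ^ 17) ^ 2) * Y := by
    refine pow_mul_le_of_le_add hθ hθ1 (by positivity) 16 ?_
    have : 0 ≤ θ ^ 17 * (a ^ 2 * k ^ 8 * L) := by positivity
    linarith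
  rw [div_mul_eq_mul_div, le_div_iff₀ (by positivity)] at h2
  refine le_of_mul_le_mul_left (a := k ^ 4) ?_ (by positivity)
  calc _ = θ ^ (16 + 1) * (a ^ 2 * k ^ 8 * L) * (L * θ ^ 3 * (θ ^ 17) ^ 2) := by ring
    _ ≤ _ := h2

/-- Combines the concatenation inequality with the representation bound: one direction ranging over
differences of the family `q` is exchanged for a free one. -/
theorem sq_sum_diffSumSq_le_add {q : ι → κ → G} {f : G → ℂ}
    (hf : ∀ x, ‖f x‖ ≤ 1) {I D : Finset G} (hI : ∀ x ∉ I, f x = 0)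
    {L : ℝ} (hL : (I.card : ℝ) ≤ L) (hD : ∀ h ∉ D, groupDiff h f = 0)
    (hDL : (D.card : ℝ) ≤ 2 * L) {R : ℝ → ℝ} (hq : HasFewReps q R) {η : ℝ} (hη : 0 < η)
    (hη1 : η ≤ 1) (hR : 0 ≤ R η) (d' : G) :
    (∑ t : ι × κ × κ, diffSumSq f (q t.1 t.2.1 - q t.1 t.2.2) d') ^ 2 ≤
      2 * L ^ 2 * (η * Fintype.card ι ^ 2 * Fintype.card κ ^ 4 * L ^ 2 +
        R η * Fintype.card ι ^ 2 * ∑ d, diffSumSq f d d') := by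
  refine (sq_sum_diffSumSq_le q hf hI hL hD hDL d').trans ?_
  gcongr
  refine (hq.sum_le hη hη1 (fun _ h => diffSumSq f h d') (fun _ _ => diffSumSq_nonneg _ _ _)
    (fun _ _ => diffSumSq_le hf hI hL _ _) hR).trans (le_of_eq ?_)
  congr 1
  simp only [Finset.sum_const, Finset.card_univ, Fintype.card_prod, nsmul_eq_mul]
  push_cast
  ring

/-- Frees the first `q` direction for each fixed second one. Squaring turns `54` into `108`, so bad
pairs of proportion `θ ^ 110` are harmless; then `333 = 109 + 3 + 2 * 110 + 1`, the final power
absorbing a factor `2`. -/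
theorem sum_diffSumSq_family_ge [Nonempty ι] [Nonempty κ] {q : ι → κ → G} {f : G → ℂ}
    (hf : ∀ x, ‖f x‖ ≤ 1) {I D : Finset G} (hI : ∀ x ∉ I, f x = 0)
    {L θ : ℝ} (hL : (I.card : ℝ) ≤ L) (hL0 : 0 < L) (hθ : 0 < θ) (hθ1 : θ ≤ 1 / 1000)
    (hD : ∀ h ∉ D, groupDiff h f = 0) (hDL : (D.card : ℝ) ≤ 2 * L)
    (hq : HasFewReps q fun η => Fintype.card κ ^ 4 / (L * θ ^ 3 * η ^ 2))
    (hT : θ ^ 54 * Fintype.card ι ^ 2 * Fintype.card κ ^ 4 * L ^ 2 ≤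
      ∑ s : ι × κ × κ, ∑ t : ι × κ × κ,
        diffSumSq f (q t.1 t.2.1 - q t.1 t.2.2) (q s.1 s.2.1 - q s.1 s.2.2)) :
    θ ^ 333 * Fintype.card ι * Fintype.card κ ^ 2 * L ^ 3 ≤
      ∑ d, ∑ s : ι × κ × κ, diffSumSq f (q s.1 s.2.1 - q s.1 s.2.2) d := by
  set a : ℝ := (Fintype.card ι : ℝ) with ha
  set k : ℝ := (Fintype.card κ : ℝ) with hk
  have ha0 : 0 < a := by rw [ha]; exact_mod_cast Fintype.card_pos
  have hk0 : 0 < k := by rw [hk]; exact_mod_cast Fintype.card_pos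
  let X : G → ℝ := fun d => ∑ t : ι × κ × κ, diffSumSq f (q t.1 t.2.1 - q t.1 t.2.2) d
  set W := ∑ d, ∑ s : ι × κ × κ, diffSumSq f (q s.1 s.2.1 - q s.1 s.2.2) d with hW
  have hX : ∀ d, X d ^ 2 ≤ 2 * L ^ 2 * (θ ^ 110 * a ^ 2 * k ^ 4 * L ^ 2 +
      k ^ 4 / (L * θ ^ 3 * (θ ^ 110) ^ 2) * a ^ 2 * ∑ d', diffSumSq f d' d) :=
    fun d => sq_sum_diffSumSq_le_add hf hI hL hD hDL hq (η := θ ^ 110) (by positivity) (pow_le_one₀ hθ.le (by linarith)) (by positivity) d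
  have h1 : (∑ s : ι × κ × κ, X (q s.1 s.2.1 - q s.1 s.2.2)) ^ 2 ≤
      (a * k ^ 2) * ∑ s : ι × κ × κ, X (q s.1 s.2.1 - q s.1 s.2.2) ^ 2 := by
    refine sq_sum_le_card_mul_sum_sq.trans (le_of_eq ?_)
    simp only [Finset.card_univ, Fintype.card_prod, ha, hk]
    push_cast; ring
  have h2 : ∑ s : ι × κ × κ, X (q s.1 s.2.1 - q s.1 s.2.2) ^ 2 ≤
      2 * L ^ 2 * (a * k ^ 2 * (θ ^ 110 * a ^ 2 * k ^ 4 * L ^ 2) +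
        k ^ 4 / (L * θ ^ 3 * (θ ^ 110) ^ 2) * a ^ 2 * W) := by
    refine (Finset.sum_le_sum fun s _ => hX _).trans (le_of_eq ?_)
    rw [← Finset.mul_sum, Finset.sum_add_distrib, Finset.sum_const, ← Finset.mul_sum,
      Finset.sum_comm]
    simp only [Finset.card_univ, Fintype.card_prod, nsmul_eq_mul, hW,
      diffSumSq_comm f _ (q _ _ - q _ _)]
    push_cast
    rw [← ha, ← hk]
    ring
  have h3 : (θ ^ 54 * a ^ 2 * k ^ 4 * L ^ 2) ^ 2 ≤ _ := (pow_le_pow_left₀ (by positivity) hT 2).trans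
    (h1.trans (mul_le_mul_of_nonneg_left h2 (by positivity)))
  have h4 : θ ^ (108 + 1) * (a ^ 4 * k ^ 8 * L ^ 4) ≤
      2 * a ^ 3 * k ^ 6 * L ^ 2 / (L * θ ^ 3 * (θ ^ 110) ^ 2) * W := by
    refine pow_mul_le_of_le_add hθ hθ1 (by positivity) 108 ?_
    have h5 : θ ^ 110 * (a ^ 4 * k ^ 8 * L ^ 4) ≤ θ ^ 109 * (a ^ 4 * k ^ 8 * L ^ 4) := by
      have : 1000 * θ ^ 110 ≤ θ ^ 109 := two_mul_pow_succ_le hθ hθ1 109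
      have : 0 < θ ^ 110 := by positivity
      gcongr ?_ * _
      linarith
    have h6 : 0 ≤ θ ^ 109 * (a ^ 4 * k ^ 8 * L ^ 4) := by positivity
    calc _ = (θ ^ 54 * a ^ 2 * k ^ 4 * L ^ 2) ^ 2 := by ring
      _ ≤ _ := h3
      _ = 2 * (θ ^ 110 * (a ^ 4 * k ^ 8 * L ^ 4)) +
          2 * a ^ 3 * k ^ 6 * L ^ 2 / (L * θ ^ 3 * (θ ^ 110) ^ 2) * W := by ring
      _ ≤ _ := by linarith
  rw [div_mul_eq_mul_div, le_div_iff₀ (by positivity)] at h4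
  refine le_of_mul_le_mul_left (a := 2 * a ^ 3 * k ^ 6 * L ^ 2) ?_ (by positivity)
  refine le_trans ?_ h4
  have h7 : 1000 * θ ^ 333 ≤ θ ^ 332 := two_mul_pow_succ_le hθ hθ1 332
  have h8 : 0 < θ ^ 333 := by positivity
  calc _ = (2 * θ ^ 333) * (a ^ 4 * k ^ 8 * L ^ 5) := by ring
    _ ≤ θ ^ 332 * (a ^ 4 * k ^ 8 * L ^ 5) := by
        gcongr ?_ * _
        linarith
    _ = _ := by ring

/-- Frees the second `q` direction. Squaring turns `333` into `666`, bad pairs have proportion `θ ^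
669`, and `2009 = 667 + 3 + 2 * 669 + 1`, where the final power absorbs a factor `4`. -/
theorem sum_diffSumSq_ge [Nonempty ι] [Nonempty κ] {q : ι → κ → G} {f : G → ℂ}
    (hf : ∀ x, ‖f x‖ ≤ 1) {I D : Finset G} (hI : ∀ x ∉ I, f x = 0)
    {L θ : ℝ} (hL : (I.card : ℝ) ≤ L) (hL0 : 0 < L) (hθ : 0 < θ) (hθ1 : θ ≤ 1 / 1000)
    (hD : ∀ h ∉ D, groupDiff h f = 0) (hDL : (D.card : ℝ) ≤ 2 * L)
    (hq : HasFewReps q fun η => Fintype.card κ ^ 4 / (L * θ ^ 3 * η ^ 2))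
    (hT : θ ^ 333 * Fintype.card ι * Fintype.card κ ^ 2 * L ^ 3 ≤
      ∑ d, ∑ s : ι × κ × κ, diffSumSq f (q s.1 s.2.1 - q s.1 s.2.2) d) :
    θ ^ 2009 * L ^ 4 ≤ ∑ d, ∑ d', diffSumSq f d d' := by
  set a : ℝ := (Fintype.card ι : ℝ) with ha
  set k : ℝ := (Fintype.card κ : ℝ) with hk
  have ha0 : 0 < a := by rw [ha]; exact_mod_cast Fintype.card_pos
  have hk0 : 0 < k := by rw [hk]; exact_mod_cast Fintype.card_pos
  let X : G → ℝ := fun d => ∑ t : ι × κ × κ, diffSumSq f (q t.1 t.2.1 - q t.1 t.2.2) d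
  set W := ∑ d, ∑ d', diffSumSq f d d' with hW
  have hX : ∀ d, X d ^ 2 ≤ 2 * L ^ 2 * (θ ^ 669 * a ^ 2 * k ^ 4 * L ^ 2 +
      k ^ 4 / (L * θ ^ 3 * (θ ^ 669) ^ 2) * a ^ 2 * ∑ d', diffSumSq f d' d) :=
    fun d => sq_sum_diffSumSq_le_add hf hI hL hD hDL hq (η := θ ^ 669) (by positivity) (pow_le_one₀ hθ.le (by linarith)) (by positivity) d
  have hX0 : ∀ d ∉ D, X d = 0 := by
    intro d hd
    refine Finset.sum_eq_zero fun t _ => ?_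
    rw [diffSumSq, hD d hd, groupDiff_zero]
    simp
  have e1 : ∑ d, X d = ∑ d ∈ D, X d :=
    (Finset.sum_subset (Finset.subset_univ D) fun d _ hd => hX0 d hd).symm
  have hW0 : ∀ d, 0 ≤ ∑ d', diffSumSq f d' d :=
    fun d => Finset.sum_nonneg fun _ _ => diffSumSq_nonneg _ _ _
  -- Only shifts in `D` contribute, so Cauchy–Schwarz costs `2 * L` and not the order of the group.
  have h1 : (∑ d, X d) ^ 2 ≤ 2 * L * ∑ d ∈ D, X d ^ 2 := by
    rw [e1]
    refine sq_sum_le_card_mul_sum_sq.trans ?_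
    gcongr
  have h2 : ∑ d ∈ D, X d ^ 2 ≤ 2 * L ^ 2 * (2 * L * (θ ^ 669 * a ^ 2 * k ^ 4 * L ^ 2) +
        k ^ 4 / (L * θ ^ 3 * (θ ^ 669) ^ 2) * a ^ 2 * W) := by
    refine (Finset.sum_le_sum fun s _ => hX _).trans ?_
    rw [← Finset.mul_sum, Finset.sum_add_distrib, Finset.sum_const, ← Finset.mul_sum, nsmul_eq_mul]
    refine mul_le_mul_of_nonneg_left (add_le_add ?_ ?_) (by positivity)
    · gcongr
    refine mul_le_mul_of_nonneg_left ?_ (by positivity)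
    rw [hW, Finset.sum_comm (f := fun d d' => diffSumSq f d d')]
    exact Finset.sum_le_sum_of_subset_of_nonneg (Finset.subset_univ D) fun d _ _ => hW0 d
  have h3 : (θ ^ 333 * a * k ^ 2 * L ^ 3) ^ 2 ≤ _ := (pow_le_pow_left₀ (by positivity) hT 2).trans
    (h1.trans (mul_le_mul_of_nonneg_left h2 (by positivity)))
  have h4 : θ ^ (666 + 1) * (a ^ 2 * k ^ 4 * L ^ 6) ≤
      4 * a ^ 2 * k ^ 4 * L ^ 3 / (L * θ ^ 3 * (θ ^ 669) ^ 2) * W := by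
    refine pow_mul_le_of_le_add hθ hθ1 (by positivity) 666 ?_
    have h5 : θ ^ 669 * (a ^ 2 * k ^ 4 * L ^ 6) ≤ θ ^ 667 * (a ^ 2 * k ^ 4 * L ^ 6) := by
      gcongr ?_ * _
      exact pow_le_pow_of_le_one hθ.le (by linarith) (by norm_num)
    have h6 : 0 ≤ θ ^ 667 * (a ^ 2 * k ^ 4 * L ^ 6) := by positivity
    calc _ = (θ ^ 333 * a * k ^ 2 * L ^ 3) ^ 2 := by ring
      _ ≤ _ := h3
      _ = 8 * (θ ^ 669 * (a ^ 2 * k ^ 4 * L ^ 6)) +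
          4 * a ^ 2 * k ^ 4 * L ^ 3 / (L * θ ^ 3 * (θ ^ 669) ^ 2) * W := by ring
      _ ≤ _ := by linarith
  rw [div_mul_eq_mul_div, le_div_iff₀ (by positivity)] at h4
  refine le_of_mul_le_mul_left (a := 4 * a ^ 2 * k ^ 4 * L ^ 3) ?_ (by positivity)
  refine le_trans ?_ h4
  have h7 : 1000 * θ ^ 2009 ≤ θ ^ 2008 := two_mul_pow_succ_le hθ hθ1 2008
  have h8 : 0 < θ ^ 2009 := by positivity
  calc _ = (4 * θ ^ 2009) * (a ^ 2 * k ^ 4 * L ^ 7) := by ring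
    _ ≤ θ ^ 2008 * (a ^ 2 * k ^ 4 * L ^ 7) := by
        gcongr ?_ * _
        linarith
    _ = _ := by ring

/-- If the average of the box sums of `f` along the families of progressions `p` and `q` is large,
and both families have well distributed sums, then `f` has a large `U³`-norm. -/
theorem sum_diffSumSq_ge_of_familyBoxSum [Nonempty ι] [Nonempty κ] {p q : ι → κ → G} {f : G → ℂ}
    (hf : ∀ x, ‖f x‖ ≤ 1) {I D : Finset G} (hI : ∀ x ∉ I, f x = 0)
    {L θ : ℝ} (hL : (I.card : ℝ) ≤ L) (hL0 : 0 < L) (hθ : 0 < θ) (hθ1 : θ ≤ 1 / 1000)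
    (hD : ∀ h ∉ D, groupDiff h f = 0) (hDL : (D.card : ℝ) ≤ 2 * L)
    (hp : HasFewReps p fun η => Fintype.card κ ^ 4 / (L * θ ^ 3 * η ^ 2))
    (hq : HasFewReps q fun η => Fintype.card κ ^ 4 / (L * θ ^ 3 * η ^ 2))
    (hT : θ * Fintype.card ι * Fintype.card κ ^ 4 * L ≤ ‖familyBoxSum p q f‖) :
    θ ^ 2009 * L ^ 4 ≤ ∑ d, ∑ d', diffSumSq f d d' :=
  sum_diffSumSq_ge hf hI hL hL0 hθ hθ1 hD hDL hq <|
    sum_diffSumSq_family_ge hf hI hL hL0 hθ hθ1 hD hDL hq <|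
      sum_sum_diffSumSq_ge_of_sum_thinBox hf hI hL hL0 hθ hθ1 hp <|
        le_sum_thinBox_of_familyBoxSum p q hf hI hL hL0 hθ.le hT

end Concatenation

/-! ### Common divisors and linear congruences -/

/-- An interval of length `A` contains at most `A / d + 1` multiples of `d`, and `d ≤ 2 * A` absorbs
the `1`. -/
theorem card_filter_dvd_add_le {A b d : ℤ} (hA : 1 ≤ A) (hd : 0 < d) (hdA : d ≤ 2 * A) :
    (((Finset.Icc 1 A).filter fun a => d ∣ a + b).card : ℝ) ≤ 3 * A / d := by
  have hd' : (0 : ℝ) < d := by exact_mod_cast hd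
  have h1 : ((Finset.Icc 1 A).filter fun a => d ∣ a + b).card ≤
      ((Finset.Ioc b (A + b)).filter fun a => d ∣ a).card := by
    refine Finset.card_le_card_of_injOn (fun a => a + b) ?_ ?_
    · intro a ha
      simp only [Finset.coe_filter, Finset.mem_Icc, Finset.mem_Ioc,
        Set.mem_ofPred_eq] at ha ⊢
      exact ⟨⟨by omega, by omega⟩, ha.2⟩
    · intro x _ y _ hxy
      simpa using hxy
  have h2 : ((((Finset.Ioc b (A + b)).filter fun a => d ∣ a).card : ℤ) : ℝ) ≤ A / d + 1 := by
    rw [Int.Ioc_filter_dvd_card b (A + b) hd]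
    have e1 := Int.floor_le (((A + b : ℤ) : ℚ) / d)
    have e2 := Int.lt_floor_add_one ((b : ℚ) / d)
    have h3 : ((max (⌊((A + b : ℤ) : ℚ) / d⌋ - ⌊(b : ℚ) / d⌋) 0 : ℤ) : ℚ) ≤ A / d + 1 := by
      push_cast
      refine max_le ?_ (by positivity)
      push_cast at e1
      rw [add_div] at e1
      rw [add_div]
      linarith
    exact_mod_cast h3
  have h4 : (1 : ℝ) ≤ 2 * A / d := by
    rw [le_div_iff₀ hd', one_mul]
    exact_mod_cast hdA
  calc (((Finset.Icc 1 A).filter fun a => d ∣ a + b).card : ℝ)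
      ≤ (((Finset.Ioc b (A + b)).filter fun a => d ∣ a).card : ℝ) := by exact_mod_cast h1
    _ ≤ A / d + 1 := by exact_mod_cast h2
    _ ≤ A / d + 2 * A / d := by linarith
    _ = _ := by ring

/-- Union bound over the value `d` of the gcd, which lies in `(g, 2A]`: each `d` accounts for at
most `(3A/d)²` pairs, and the tail of `∑ 1/d²` beyond `g` is at most `1/g`. -/
theorem card_filter_lt_gcd_le {A b : ℤ} (hA : 1 ≤ A) (hb : 0 ≤ b) (hbA : b ≤ A) {g : ℕ}
    (hg : 0 < g) :
    (((Finset.Icc 1 A ×ˢ Finset.Icc 1 A).filter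
      fun t : ℤ × ℤ => g < Int.gcd (t.1 + b) (t.2 + b)).card : ℝ) ≤ 9 * A ^ 2 / g := by
  have hA0 : (0 : ℝ) < A := by exact_mod_cast (by omega : 0 < A)
  have hsub : ((Finset.Icc 1 A ×ˢ Finset.Icc 1 A).filter
      fun t : ℤ × ℤ => g < Int.gcd (t.1 + b) (t.2 + b)) ⊆
      (Finset.Ioc g (2 * A).toNat).biUnion fun d =>
        ((Finset.Icc 1 A).filter fun a => (d : ℤ) ∣ a + b) ×ˢ
        ((Finset.Icc 1 A).filter fun a => (d : ℤ) ∣ a + b) := by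
    rintro ⟨x, y⟩ h
    simp only [Finset.mem_filter, Finset.mem_product, Finset.mem_Icc] at h
    simp only [Finset.mem_biUnion, Finset.mem_product, Finset.mem_filter, Finset.mem_Icc,
      Finset.mem_Ioc]
    obtain ⟨⟨hx, hy⟩, hlt⟩ := h
    refine ⟨Int.gcd (x + b) (y + b), ⟨hlt, ?_⟩, ⟨hx, Int.gcd_dvd_left ..⟩, ⟨hy, Int.gcd_dvd_right ..⟩⟩
    have := Int.le_of_dvd (by omega) (Int.gcd_dvd_left (x + b) (y + b))
    omega
  calc (((Finset.Icc 1 A ×ˢ Finset.Icc 1 A).filter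
      fun t : ℤ × ℤ => g < Int.gcd (t.1 + b) (t.2 + b)).card : ℝ)
      ≤ ∑ d ∈ Finset.Ioc g (2 * A).toNat, ((((Finset.Icc 1 A).filter
          fun a => (d : ℤ) ∣ a + b) ×ˢ ((Finset.Icc 1 A).filter
            fun a => (d : ℤ) ∣ a + b)).card : ℝ) := by
        exact_mod_cast (Finset.card_le_card hsub).trans Finset.card_biUnion_le
    _ ≤ ∑ d ∈ Finset.Ioc g (2 * A).toNat, 9 * (A : ℝ) ^ 2 * ((d : ℝ) ^ 2)⁻¹ := by
        refine Finset.sum_le_sum fun d hd => ?_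
        rw [Finset.mem_Ioc] at hd
        rw [Finset.card_product]
        push_cast
        have := card_filter_dvd_add_le (b := b) hA (d := d) (by omega) (by omega)
        calc _ ≤ (3 * (A : ℝ) / (d : ℤ)) * (3 * A / (d : ℤ)) := by gcongr
          _ = _ := by push_cast; ring
    _ = 9 * (A : ℝ) ^ 2 * ∑ d ∈ Finset.Ioc g (2 * A).toNat, ((d : ℝ) ^ 2)⁻¹ := by
        rw [Finset.mul_sum]
    _ ≤ 9 * (A : ℝ) ^ 2 * (g : ℝ)⁻¹ := by
        gcongr
        rcases le_total g (2 * A).toNat with h | h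
        · refine (sum_Ioc_inv_sq_le_sub hg.ne' h).trans ?_
          have : (0 : ℝ) ≤ (((2 * A).toNat : ℕ) : ℝ)⁻¹ := by positivity
          linarith
        · rw [Finset.Ioc_eq_empty (by omega)]
          simp
    _ = _ := by ring

/-- The number of solutions of a linear congruence in a box. -/
theorem card_filter_linear_eq_le {H α α' B : ℤ} (hH : 0 ≤ H) (hα' : 0 < α')
    (hα0 : 0 ≤ α) (hαB : α ≤ B) (hα'B : α' ≤ B) {Q : ℕ} (hQ : 8 * B * H < Q) (h : ZMod Q) :
    (((Finset.univ : Finset (Finset.Icc (1 : ℤ) H × Finset.Icc (1 : ℤ) H × Finset.Icc (1 : ℤ) H ×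
        Finset.Icc (1 : ℤ) H)).filter fun s =>
      ((2 * α * s.1 : ℤ) : ZMod Q) - ((2 * α * s.2.1 : ℤ) : ZMod Q) +
        ((2 * α' * s.2.2.1 : ℤ) : ZMod Q) - ((2 * α' * s.2.2.2 : ℤ) : ZMod Q) = h).card : ℝ) ≤
      (H : ℝ) ^ 2 * (1 + 4 * H * Int.gcd α α' / α') := by
  classical
  have hH' : (0 : ℝ) ≤ H := by exact_mod_cast hH
  have hα'r : (0 : ℝ) < α' := by exact_mod_cast hα'
  set F := (Finset.univ : Finset (Finset.Icc (1 : ℤ) H × Finset.Icc (1 : ℤ) H ×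
    Finset.Icc (1 : ℤ) H × Finset.Icc (1 : ℤ) H)).filter fun s =>
      ((2 * α * s.1 : ℤ) : ZMod Q) - ((2 * α * s.2.1 : ℤ) : ZMod Q) +
        ((2 * α' * s.2.2.1 : ℤ) : ZMod Q) - ((2 * α' * s.2.2.2 : ℤ) : ZMod Q) = h with hF
  -- With one solution fixed, the others are counted relative to it through a homogeneous equation.
  rcases F.eq_empty_or_nonempty with h0 | ⟨⟨i0, i0', k0, k0'⟩, hs0⟩
  · rw [h0]
    simp only [Finset.card_empty, Nat.cast_zero]
    positivity
  have hg : 0 < (Int.gcd α α' : ℤ) := by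
    have := Int.gcd_pos_of_ne_zero_right α hα'.ne'
    exact_mod_cast this
  obtain ⟨s, hs⟩ := Int.gcd_dvd_right α α'
  obtain ⟨r, hr⟩ := Int.gcd_dvd_left α α'
  have hs_pos : 0 < s := by
    by_contra hcon
    push Not at hcon
    nlinarith
  have hcop : IsCoprime s r := by
    rw [Int.isCoprime_iff_gcd_eq_one]
    have e : Int.gcd (Int.gcd α α' * s) (Int.gcd α α' * r) = Int.gcd α α' := by
      rw [← hs, ← hr, Int.gcd_comm]
    rw [Int.gcd_mul_left, Int.natAbs_natCast] at e
    exact Nat.eq_of_mul_eq_mul_left (by exact_mod_cast hg) (by rw [e, mul_one])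
  set c : ℤ := i0 - i0' with hc
  set c' : ℤ := k0 - k0' with hc'
  -- Twice the integer in question is divisible by `Q` but at most `8 * B * H < Q` in size, so the
  -- congruence is an equation in `ℤ`.
  have key : ∀ t ∈ F, α * ((t.1 : ℤ) - t.2.1 - c) + α' * ((t.2.2.1 : ℤ) - t.2.2.2 - c') = 0 := by
    intro t ht
    rw [hF, Finset.mem_filter] at ht hs0
    have e := ht.2.trans hs0.2.symm
    have e2 : ((2 * (α * ((t.1 : ℤ) - t.2.1 - c) + α' * ((t.2.2.1 : ℤ) - t.2.2.2 - c')) : ℤ) :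
        ZMod Q) = 0 := by
      have := sub_eq_zero.2 e
      rw [← this, hc, hc']
      push_cast
      ring
    rw [ZMod.intCast_zmod_eq_zero_iff_dvd] at e2
    obtain ⟨⟨x, hx⟩, ⟨x', hx'⟩, ⟨y, hy⟩, ⟨y', hy'⟩⟩ := t
    obtain ⟨i0, hi0⟩ := i0
    obtain ⟨i0', hi0'⟩ := i0'
    obtain ⟨k0, hk0⟩ := k0
    obtain ⟨k0', hk0'⟩ := k0'
    have r1 := Finset.mem_Icc.1 hx
    have r2 := Finset.mem_Icc.1 hx'
    have r3 := Finset.mem_Icc.1 hy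
    have r4 := Finset.mem_Icc.1 hy'
    have r5 := Finset.mem_Icc.1 hi0
    have r6 := Finset.mem_Icc.1 hi0'
    have r7 := Finset.mem_Icc.1 hk0
    have r8 := Finset.mem_Icc.1 hk0'
    simp only at hc hc' e2 ⊢
    have b1 : |x - x' - c| ≤ 2 * H := by rw [abs_le]; constructor <;> omega
    have b2 : |y - y' - c'| ≤ 2 * H := by rw [abs_le]; constructor <;> omega
    have b3 : |2 * (α * (x - x' - c) + α' * (y - y' - c'))| ≤ 8 * B * H := by
      rw [abs_mul, abs_two]
      have := abs_add_le (α * (x - x' - c)) (α' * (y - y' - c'))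
      rw [abs_mul, abs_mul, abs_of_nonneg hα0, abs_of_pos hα'] at this
      have m1 : α * |x - x' - c| ≤ B * (2 * H) := by gcongr; omega
      have m2 : α' * |y - y' - c'| ≤ B * (2 * H) := by gcongr; omega
      nlinarith
    have := Int.eq_zero_of_abs_lt_dvd e2 (by omega)
    omega
  have hdvd : ∀ t ∈ F, s ∣ (t.1 : ℤ) - t.2.1 - c := by
    intro t ht
    have e := key t ht
    refine hcop.dvd_of_dvd_mul_left ?_
    refine ⟨-((t.2.2.1 : ℤ) - t.2.2.2 - c'), ?_⟩
    refine mul_left_cancel₀ hg.ne' ?_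
    have hr' : (Int.gcd α α' : ℤ) * r = α := hr.symm
    have hs' : (Int.gcd α α' : ℤ) * s = α' := hs.symm
    rw [← mul_assoc, ← mul_assoc, hr', hs']
    linarith
  -- With `s = α' / gcd`, the difference `x - x' - c` is a multiple of `s` of size at most `2 * H`.
  -- The quotient together with `x` and `y` determines `x'`, and then the equation determines `y'`.
  have hcard : F.card ≤ ((Finset.univ : Finset (Finset.Icc (1 : ℤ) H × Finset.Icc (1 : ℤ) H)) ×ˢ
      Finset.Icc (-(2 * H / s)) (2 * H / s)).card := by
    refine Finset.card_le_card_of_injOn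
      (fun t => ((t.1, t.2.2.1), ((t.1 : ℤ) - t.2.1 - c) / s)) ?_ ?_
    · rintro ⟨⟨x, hx⟩, ⟨x', hx'⟩, ⟨y, hy⟩, ⟨y', hy'⟩⟩ ht
      obtain ⟨w, hw⟩ := hdvd _ ht
      obtain ⟨i0, hi0⟩ := i0
      obtain ⟨i0', hi0'⟩ := i0'
      simp only [Finset.mem_Icc] at hx hx' hi0 hi0' hw
      simp only [Finset.coe_product, Set.mem_prod, Finset.coe_univ, Set.mem_univ, Finset.coe_Icc,
        Set.mem_Icc, true_and]
      rw [hw, Int.mul_ediv_cancel_left _ hs_pos.ne']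
      constructor
      · have : -w ≤ 2 * H / s := by
          rw [Int.le_ediv_iff_mul_le hs_pos]
          nlinarith
        omega
      · rw [Int.le_ediv_iff_mul_le hs_pos]
        nlinarith
    · intro t ht t' ht' heq
      obtain ⟨w, hw⟩ := hdvd _ ht
      obtain ⟨w', hw'⟩ := hdvd _ ht'
      have k1 := key _ ht
      have k2 := key _ ht'
      obtain ⟨x, x', y, y'⟩ := t
      obtain ⟨z, z', u, u'⟩ := t'
      simp only [Prod.mk.injEq] at heq hw hw' k1 k2
      obtain ⟨⟨rfl, rfl⟩, h3⟩ := heq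
      rw [hw, hw', Int.mul_ediv_cancel_left _ hs_pos.ne', Int.mul_ediv_cancel_left _ hs_pos.ne']
        at h3
      subst h3
      have e1 : x' = z' := Subtype.ext (by omega)
      subst e1
      have e2 : α' * ((y : ℤ) - y' - c') = α' * ((y : ℤ) - u' - c') := by linarith
      have e3 := mul_left_cancel₀ hα'.ne' e2
      have e4 : y' = u' := Subtype.ext (by omega)
      rw [e4]
  have hT0 : 0 ≤ 2 * H / s := Int.ediv_nonneg (by omega) hs_pos.le
  have hc2 : (((Finset.univ : Finset (Finset.Icc (1 : ℤ) H × Finset.Icc (1 : ℤ) H)) ×ˢ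
      Finset.Icc (-(2 * H / s)) (2 * H / s)).card : ℤ) = H ^ 2 * (1 + 2 * (2 * H / s)) := by
    simp only [Finset.card_product, Finset.card_univ, Fintype.card_prod, Fintype.card_coe,
      Int.card_Icc]
    push_cast
    rw [Int.toNat_of_nonneg (by omega), Int.toNat_of_nonneg (by omega)]
    ring
  have hs_r : (0 : ℝ) < s := by exact_mod_cast hs_pos
  have hdiv : ((2 * H / s : ℤ) : ℝ) ≤ 2 * H * Int.gcd α α' / α' := by
    rw [le_div_iff₀ hα'r]
    have e1 : 2 * H / s * s ≤ 2 * H := Int.ediv_mul_le _ hs_pos.ne'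
    have e2 : 2 * H / s * α' ≤ 2 * H * Int.gcd α α' := by
      calc 2 * H / s * α' = 2 * H / s * s * Int.gcd α α' := by
            conv_lhs => rw [hs]
            ring
        _ ≤ _ := by gcongr
    exact_mod_cast e2
  calc (F.card : ℝ) ≤ (((Finset.univ : Finset (Finset.Icc (1 : ℤ) H × Finset.Icc (1 : ℤ) H)) ×ˢ
      Finset.Icc (-(2 * H / s)) (2 * H / s)).card : ℝ) := by exact_mod_cast hcard
    _ = (H : ℝ) ^ 2 * (1 + 2 * (2 * H / s : ℤ)) := by exact_mod_cast hc2
    _ ≤ (H : ℝ) ^ 2 * (1 + 2 * (2 * H * Int.gcd α α' / α')) := by gcongr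
    _ = _ := by ring

/-- A pair is bad if its second entry is below `η A / 2` or its gcd exceeds a multiple of `1/η`;
each condition excludes at most half of the allowed proportion. For the others the linear count
applies. In the factor `L * θ ^ 3`, two powers of `θ` compensate `L` through `h1` and `h2`, and the
third absorbs numerical constants. -/
theorem hasFewReps_progressions {A H b : ℤ} (hA : 1 ≤ A) (hH : 1 ≤ H) (hb : 0 ≤ b) (hbA : b ≤ A)
    {Q : ℕ} (hQ : 16 * A * H < Q) {L θ : ℝ} (hL : 0 < L) (hθ : 0 < θ) (hθ1 : θ ≤ 1 / 1000)
    (h1 : θ ^ 2 * L ≤ H ^ 2) (h2 : θ ^ 2 * L ≤ H * A) :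
    HasFewReps (fun (a : Finset.Icc (1 : ℤ) A) (i : Finset.Icc (1 : ℤ) H) =>
      ((2 * (a + b) * i : ℤ) : ZMod Q))
      fun η => (Fintype.card (Finset.Icc (1 : ℤ) H) : ℝ) ^ 4 / (L * θ ^ 3 * η ^ 2) := by
  classical
  intro η hη hη1
  have hA0 : (0 : ℝ) < A := by exact_mod_cast (by omega : 0 < A)
  have hH0 : (0 : ℝ) < H := by exact_mod_cast (by omega : 0 < H)
  have cA : (Fintype.card (Finset.Icc (1 : ℤ) A) : ℝ) = A := by
    have : ((Fintype.card (Finset.Icc (1 : ℤ) A) : ℤ)) = A := by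
      simp only [Fintype.card_coe, Int.card_Icc]; omega
    exact_mod_cast this
  have cH : (Fintype.card (Finset.Icc (1 : ℤ) H) : ℝ) = H := by
    have : ((Fintype.card (Finset.Icc (1 : ℤ) H) : ℤ)) = H := by
      simp only [Fintype.card_coe, Int.card_Icc]; omega
    exact_mod_cast this
  -- The constant `18` makes the gcd bound `9 A² / g` at most `(η / 2) A²`.
  set g : ℕ := ⌈18 / η⌉₊ with hg
  have hg1 : 18 / η ≤ g := Nat.le_ceil _
  have hg0 : (0 : ℝ) < g := lt_of_lt_of_le (by positivity) hg1
  have hg2 : (g : ℝ) ≤ 19 / η := by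
    have := (Nat.ceil_lt_add_one (a := 18 / η) (by positivity)).le
    have h3 : (1 : ℝ) ≤ 1 / η := by rw [le_div_iff₀ hη]; linarith
    calc (g : ℝ) ≤ 18 / η + 1 := this
      _ ≤ 18 / η + 1 / η := by linarith
      _ = _ := by ring
  let P : ℤ × ℤ → Prop := fun t => (t.2 : ℝ) < η * A / 2 ∨ g < Int.gcd (t.1 + b) (t.2 + b)
  refine ⟨Finset.univ.filter fun t => P (t.1, t.2), ?_, ?_⟩
  · have hle : (Finset.univ.filter fun t : Finset.Icc (1 : ℤ) A × Finset.Icc (1 : ℤ) A =>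
        P (t.1, t.2)).card ≤
        (Finset.Icc 1 A ×ˢ Finset.Icc 1 ⌊η * A / 2⌋ ∪ (Finset.Icc 1 A ×ˢ Finset.Icc 1 A).filter
          fun t : ℤ × ℤ => g < Int.gcd (t.1 + b) (t.2 + b)).card := by
      refine Finset.card_le_card_of_injOn (fun t => ((t.1 : ℤ), (t.2 : ℤ))) ?_ ?_
      · rintro ⟨⟨x, hx⟩, ⟨y, hy⟩⟩ ht
        rw [Finset.coe_filter] at ht
        simp only [Finset.coe_union, Set.mem_union, Finset.mem_coe, Finset.mem_product,
          Finset.mem_filter]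
        rcases ht.2 with h | h
        · left
          refine ⟨hx, ?_⟩
          rw [Finset.mem_Icc] at hy ⊢
          exact ⟨hy.1, Int.le_floor.2 h.le⟩
        · exact Or.inr ⟨⟨hx, hy⟩, h⟩
      · intro t _ t' _ h
        simp only [Prod.mk.injEq] at h
        exact Prod.ext (Subtype.ext h.1) (Subtype.ext h.2)
    have hfl : ((Finset.Icc 1 ⌊η * A / 2⌋).card : ℝ) ≤ η * A / 2 := by
      have h0 : 0 ≤ ⌊η * A / 2⌋ := Int.floor_nonneg.2 (by positivity)
      have : ((Finset.Icc 1 ⌊η * A / 2⌋).card : ℤ) = ⌊η * A / 2⌋ := by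
        rw [Int.card_Icc]; omega
      calc ((Finset.Icc 1 ⌊η * A / 2⌋).card : ℝ) = (⌊η * A / 2⌋ : ℝ) := by exact_mod_cast this
        _ ≤ _ := Int.floor_le _
    have hgc := card_filter_lt_gcd_le hA hb hbA (g := g) (by exact_mod_cast hg0)
    have h9 : 9 * (A : ℝ) ^ 2 / g ≤ η / 2 * A ^ 2 := by
      rw [div_le_iff₀ hg0]
      rw [div_le_iff₀ hη] at hg1
      have : 0 < (A : ℝ) ^ 2 := by positivity
      nlinarith
    rw [cA]
    calc ((Finset.univ.filter fun t : Finset.Icc (1 : ℤ) A × Finset.Icc (1 : ℤ) A =>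
        P (t.1, t.2)).card : ℝ) ≤ (Finset.Icc 1 A ×ˢ Finset.Icc 1 ⌊η * A / 2⌋).card +
          ((Finset.Icc 1 A ×ˢ Finset.Icc 1 A).filter
            fun t : ℤ × ℤ => g < Int.gcd (t.1 + b) (t.2 + b)).card := by
          exact_mod_cast hle.trans (Finset.card_union_le _ _)
      _ ≤ A * (η * A / 2) + 9 * A ^ 2 / g := by
          rw [Finset.card_product]
          push_cast
          refine add_le_add ?_ hgc
          rw [← cA, Fintype.card_coe]
          rw [← cA, Fintype.card_coe] at hfl
          gcongr
      _ ≤ A * (η * A / 2) + η / 2 * A ^ 2 := by gcongr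
      _ = _ := by ring
  · rintro ⟨⟨x, hx⟩, ⟨y, hy⟩⟩ ht h
    simp only [Finset.mem_filter, Finset.mem_univ, true_and, P, not_or, not_lt] at ht
    obtain ⟨ht1, ht2⟩ := ht
    rw [Finset.mem_Icc] at hx hy
    -- Both coefficients are at most `2 * A` since `b ≤ A`; this is where the modulus condition `16
    -- * A * H < Q` comes from.
    refine (card_filter_linear_eq_le (α := x + b) (α' := y + b) (B := 2 * A) (by omega) (by omega)
      (by omega) (by omega) (by omega) (by linarith) h).trans ?_
    rw [cH, le_div_iff₀ (by positivity)]
    have hyb : η * A / 2 ≤ ((y + b : ℤ) : ℝ) := by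
      push_cast
      have : (0 : ℝ) ≤ b := by exact_mod_cast hb
      linarith
    have hyb0 : (0 : ℝ) < ((y + b : ℤ) : ℝ) := lt_of_lt_of_le (by positivity) hyb
    have hgg : (Int.gcd (x + b) (y + b) : ℝ) ≤ 19 / η := le_trans (by exact_mod_cast ht2) hg2
    have e1 : 4 * (H : ℝ) * Int.gcd (x + b) (y + b) / ((y + b : ℤ) : ℝ) ≤ 152 * H / (η ^ 2 * A) := by
      calc _ ≤ 4 * (H : ℝ) * (19 / η) / (η * A / 2) := by gcongr
        _ = _ := by field_simp; norm_num
    calc (H : ℝ) ^ 2 * (1 + 4 * H * Int.gcd (x + b) (y + b) / ((y + b : ℤ) : ℝ)) *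
          (L * θ ^ 3 * η ^ 2)
        ≤ (H : ℝ) ^ 2 * (1 + 152 * H / (η ^ 2 * A)) * (L * θ ^ 3 * η ^ 2) := by gcongr
      _ = H ^ 2 * (θ * η ^ 2 * (θ ^ 2 * L) + 152 * θ * (H / A) * (θ ^ 2 * L)) := by
          field_simp
      _ ≤ H ^ 2 * (θ * 1 * H ^ 2 + 152 * θ * (H / A) * (H * A)) := by
          gcongr
          exact pow_le_one₀ hη.le hη1
      _ = 153 * θ * H ^ 4 := by field_simp; ring
      _ ≤ 1 * H ^ 4 := by gcongr; linarith
      _ = _ := one_mul _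

/-! ### Transfer between `ℤ` and `ℤ/Qℤ` -/

/-- Transport of a function on `ℤ` to `ℤ/Qℤ` through the representatives in `[0, Q)`. -/
def liftMod (Q : ℕ) (f : ℤ → ℂ) : ZMod Q → ℂ := fun z => f z.val

section Transfer

variable {f : ℤ → ℂ} {L : ℤ} {Q : ℕ} [NeZero Q]

/-- For negative `n` in this window the representative is `n + Q > L`, so both sides vanish. The
window is what permits shifts without wraparound. -/
theorem liftMod_intCast (hf : ∀ x ∉ Finset.Icc 1 L, f x = 0) {n : ℤ} (h1 : L - Q < n) (h2 : n < Q) :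
    liftMod Q f (n : ZMod Q) = f n := by
  unfold liftMod
  rw [ZMod.val_intCast]
  rcases le_or_gt 0 n with h | h
  · rw [Int.emod_eq_of_lt h h2]
  · have hQ : (Q : ℤ) ≠ 0 := by exact_mod_cast NeZero.ne Q
    rcases le_or_gt L 0 with hL | hL
    · rw [hf _ (by rw [Finset.mem_Icc]; omega), hf _ (by rw [Finset.mem_Icc]; omega)]
    · have e : n % Q = n + Q := by
        rw [← Int.add_emod_right, Int.emod_eq_of_lt (by omega) (by omega)]
      rw [e, hf _ (by rw [Finset.mem_Icc]; omega), hf _ (by rw [Finset.mem_Icc]; omega)]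

theorem liftMod_eq_zero (hf : ∀ x ∉ Finset.Icc 1 L, f x = 0) (z : ZMod Q)
    (hz : z ∉ (Finset.Icc 1 L).image (Int.cast : ℤ → ZMod Q)) : liftMod Q f z = 0 := by
  refine hf _ fun h => hz ?_
  rw [Finset.mem_image]
  exact ⟨_, h, by simp⟩

theorem sum_eq_sum_Icc_of_eq_zero (hLQ : L < Q) {g : ZMod Q → ℂ}
    (hg : ∀ z ∉ (Finset.Icc 1 L).image (Int.cast : ℤ → ZMod Q), g z = 0) :
    ∑ z, g z = ∑ x ∈ Finset.Icc 1 L, g (x : ZMod Q) := by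
  rw [← Finset.sum_subset (Finset.subset_univ _) fun z _ hz => hg z hz]
  refine Finset.sum_image ?_
  intro x hx y hy hxy
  rw [Finset.coe_Icc, Set.mem_Icc] at hx hy
  rw [ZMod.intCast_eq_intCast_iff, Int.ModEq, Int.emod_eq_of_lt (by omega) (by omega),
    Int.emod_eq_of_lt (by omega) (by omega)] at hxy
  exact hxy

theorem sum_groupDiff_liftMod (hf : ∀ x ∉ Finset.Icc 1 L, f x = 0) {d d' : ℤ}
    (hd : L + |d| + |d'| < Q) :
    ∑ z, groupDiff (d : ZMod Q) (groupDiff (d' : ZMod Q) (liftMod Q f)) z =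
      ∑ x ∈ Finset.Icc 1 L, mulDiff d (mulDiff d' f) x := by
  have a1 := neg_abs_le d
  have a2 := le_abs_self d
  have a3 := neg_abs_le d'
  have a4 := le_abs_self d'
  rw [sum_eq_sum_Icc_of_eq_zero (L := L) (by omega)
    (groupDiff_eq_zero_of_notMem (groupDiff_eq_zero_of_notMem (liftMod_eq_zero hf) _) _)]
  refine Finset.sum_congr rfl fun x hx => ?_
  rw [Finset.mem_Icc] at hx
  simp only [groupDiff, mulDiff, ← Int.cast_add]
  rw [liftMod_intCast hf (by omega) (by omega), liftMod_intCast hf (by omega) (by omega),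
    liftMod_intCast hf (by omega) (by omega), liftMod_intCast hf (by omega) (by omega)]

/-- If some value is nonzero, both `z` and `z + h` have representatives in `[1, L]`, so `h` is the
class of a difference of size less than `L`. -/
theorem groupDiff_liftMod_eq_zero (hf : ∀ x ∉ Finset.Icc 1 L, f x = 0) (h : ZMod Q)
    (hh : h ∉ (Finset.Ioo (-L) L).image (Int.cast : ℤ → ZMod Q)) :
    groupDiff h (liftMod Q f) = 0 := by
  funext z
  simp only [groupDiff, Pi.zero_apply, mul_eq_zero, map_eq_zero]
  by_contra! hcon
  obtain ⟨h1, h2⟩ := hcon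
  have m1 : ((z + h).val : ℤ) ∈ Finset.Icc 1 L := by_contra fun hn => h1 (hf _ hn)
  have m2 : (z.val : ℤ) ∈ Finset.Icc 1 L := by_contra fun hn => h2 (hf _ hn)
  rw [Finset.mem_Icc] at m1 m2
  refine hh (Finset.mem_image.2 ⟨(z + h).val - z.val, ?_, ?_⟩)
  · rw [Finset.mem_Ioo]; omega
  · push_cast
    simp

theorem sum_sum_diffSumSq_liftMod (hf : ∀ x ∉ Finset.Icc 1 L, f x = 0) (hLQ : 4 * L ≤ Q) :
    ∑ d, ∑ d', diffSumSq (liftMod Q f) d d' =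
      ∑ d ∈ Finset.Ioo (-L) L, ∑ d' ∈ Finset.Ioo (-L) L,
        ‖∑ x ∈ Finset.Icc 1 L, mulDiff d (mulDiff d' f) x‖ ^ 2 := by
  have hinj : Set.InjOn (Int.cast : ℤ → ZMod Q) (Finset.Ioo (-L) L) := by
    intro x hx y hy hxy
    rw [Finset.coe_Ioo, Set.mem_Ioo] at hx hy
    rw [← sub_eq_zero, ← Int.cast_sub, ZMod.intCast_zmod_eq_zero_iff_dvd] at hxy
    have := Int.eq_zero_of_abs_lt_dvd hxy (by rw [abs_lt]; constructor <;> omega)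
    omega
  have h0 : ∀ d d', (d ∉ (Finset.Ioo (-L) L).image (Int.cast : ℤ → ZMod Q) ∨
      d' ∉ (Finset.Ioo (-L) L).image (Int.cast : ℤ → ZMod Q)) →
      diffSumSq (liftMod Q f) d d' = 0 := by
    rintro d d' (h | h)
    · rw [diffSumSq_comm, diffSumSq, groupDiff_liftMod_eq_zero hf _ h, groupDiff_zero]
      simp
    · rw [diffSumSq, groupDiff_liftMod_eq_zero hf _ h, groupDiff_zero]
      simp
  rw [← Finset.sum_subset (Finset.subset_univ _)
    fun d _ hd => Finset.sum_eq_zero fun d' _ => h0 d d' (Or.inl hd), Finset.sum_image hinj]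
  refine Finset.sum_congr rfl fun d hd => ?_
  rw [← Finset.sum_subset (Finset.subset_univ _) fun d' _ hd' => h0 _ d' (Or.inr hd'),
    Finset.sum_image hinj]
  refine Finset.sum_congr rfl fun d' hd' => ?_
  rw [Finset.mem_Ioo] at hd hd'
  rw [diffSumSq, sum_groupDiff_liftMod hf]
  have a1 : |d| < L := by rw [abs_lt]; omega
  have a2 : |d'| < L := by rw [abs_lt]; omega
  omega

/-- The second family is written with `a + 0` so that it is the case `b = 0` of the first and the
same representation count serves both. -/
theorem familyBoxSum_liftMod (hf : ∀ x ∉ Finset.Icc 1 L, f x = 0) {A H b : ℤ}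
    (hb : 0 ≤ b) (hbA : b ≤ A) (hQ : L + 8 * A * H < Q) :
    familyBoxSum (fun (a : Finset.Icc (1 : ℤ) A) (i : Finset.Icc (1 : ℤ) H) =>
        ((2 * (a + b) * i : ℤ) : ZMod Q))
      (fun (a : Finset.Icc (1 : ℤ) A) (i : Finset.Icc (1 : ℤ) H) =>
        ((2 * (a + 0) * i : ℤ) : ZMod Q)) (liftMod Q f) =
      ∑ a ∈ Finset.Icc 1 A, ∑ i ∈ Finset.Icc 1 H, ∑ i' ∈ Finset.Icc 1 H, ∑ j ∈ Finset.Icc 1 H,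
        ∑ j' ∈ Finset.Icc 1 H, ∑ x ∈ Finset.Icc 1 L,
          mulDiff (2 * (a + b) * (i - i')) (mulDiff (2 * a * (j - j')) f) x := by
  unfold familyBoxSum
  rw [Fintype.sum_prod_type]
  have key : ∀ r : Finset.Icc (1 : ℤ) A × Finset.Icc (1 : ℤ) H × Finset.Icc (1 : ℤ) H ×
      Finset.Icc (1 : ℤ) H × Finset.Icc (1 : ℤ) H,
      ∑ z, liftMod Q f (z + ((2 * (r.1 + b) * r.2.1 : ℤ) : ZMod Q) +
          ((2 * (r.1 + 0) * r.2.2.2.1 : ℤ) : ZMod Q)) *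
        conj (liftMod Q f (z + ((2 * (r.1 + b) * r.2.2.1 : ℤ) : ZMod Q) +
          ((2 * (r.1 + 0) * r.2.2.2.1 : ℤ) : ZMod Q))) *
        conj (liftMod Q f (z + ((2 * (r.1 + b) * r.2.1 : ℤ) : ZMod Q) +
          ((2 * (r.1 + 0) * r.2.2.2.2 : ℤ) : ZMod Q))) *
        liftMod Q f (z + ((2 * (r.1 + b) * r.2.2.1 : ℤ) : ZMod Q) +
          ((2 * (r.1 + 0) * r.2.2.2.2 : ℤ) : ZMod Q)) =
      ∑ x ∈ Finset.Icc 1 L, mulDiff (2 * (r.1 + b) * (r.2.1 - r.2.2.1))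
        (mulDiff (2 * r.1 * (r.2.2.2.1 - r.2.2.2.2)) f) x := by
    rintro ⟨⟨a, ha⟩, ⟨i, hi⟩, ⟨i', hi'⟩, ⟨j, hj⟩, ⟨j', hj'⟩⟩
    rw [Finset.mem_Icc] at ha hi hi' hj hj'
    have b1 : |2 * (a + b) * (i - i')| ≤ 4 * A * H := by
      rw [abs_mul, abs_of_nonneg (by omega : 0 ≤ 2 * (a + b))]
      have : |i - i'| ≤ H := by rw [abs_le]; omega
      calc _ ≤ (4 * A) * H := mul_le_mul (by omega) this (abs_nonneg _) (by omega)
        _ = _ := by ring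
    have b2 : |2 * a * (j - j')| ≤ 4 * A * H := by
      rw [abs_mul, abs_of_nonneg (by omega : 0 ≤ 2 * a)]
      have : |j - j'| ≤ H := by rw [abs_le]; omega
      calc _ ≤ (4 * A) * H := mul_le_mul (by omega) this (abs_nonneg _) (by omega)
        _ = _ := by ring
    simp only
    rw [← sum_groupDiff_liftMod (Q := Q) hf (by linarith)]
    rw [← sum_shift (((2 * (a + b) * i' : ℤ) : ZMod Q) + ((2 * (a + 0) * j' : ℤ) : ZMod Q))
      (fun z => groupDiff ((2 * (a + b) * (i - i') : ℤ) : ZMod Q)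
        (groupDiff ((2 * a * (j - j') : ℤ) : ZMod Q) (liftMod Q f)) z)]
    refine Finset.sum_congr rfl fun z _ => ?_
    simp only [groupDiff]
    have t1 : z + (((2 * (a + b) * i' : ℤ) : ZMod Q) + ((2 * (a + 0) * j' : ℤ) : ZMod Q)) +
        ((2 * (a + b) * (i - i') : ℤ) : ZMod Q) + ((2 * a * (j - j') : ℤ) : ZMod Q) =
        z + ((2 * (a + b) * i : ℤ) : ZMod Q) + ((2 * (a + 0) * j : ℤ) : ZMod Q) := by
      push_cast; ring
    have t2 : z + (((2 * (a + b) * i' : ℤ) : ZMod Q) + ((2 * (a + 0) * j' : ℤ) : ZMod Q)) +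
        ((2 * (a + b) * (i - i') : ℤ) : ZMod Q) =
        z + ((2 * (a + b) * i : ℤ) : ZMod Q) + ((2 * (a + 0) * j' : ℤ) : ZMod Q) := by
      push_cast; ring
    have t3 : z + (((2 * (a + b) * i' : ℤ) : ZMod Q) + ((2 * (a + 0) * j' : ℤ) : ZMod Q)) +
        ((2 * a * (j - j') : ℤ) : ZMod Q) =
        z + ((2 * (a + b) * i' : ℤ) : ZMod Q) + ((2 * (a + 0) * j : ℤ) : ZMod Q) := by
      push_cast; ring
    rw [t1, t2, t3, ← add_assoc]
    simp only [map_mul, Complex.conj_conj]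
    ring
  rw [Finset.sum_congr rfl fun r _ => key r]
  simp only [Fintype.sum_prod_type]
  rw [← Finset.sum_coe_sort (Finset.Icc 1 A)]
  refine Finset.sum_congr rfl fun a _ => ?_
  rw [← Finset.sum_coe_sort (Finset.Icc 1 H)]
  refine Finset.sum_congr rfl fun i _ => ?_
  rw [← Finset.sum_coe_sort (Finset.Icc 1 H)]
  refine Finset.sum_congr rfl fun i' _ => ?_
  rw [← Finset.sum_coe_sort (Finset.Icc 1 H)]
  refine Finset.sum_congr rfl fun j _ => ?_
  rw [← Finset.sum_coe_sort (Finset.Icc 1 H)]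

end Transfer

/-- The inverse theorem on `ℤ`: a large average of box sums along the progressions `2(a+b)[H]` and
`2a[H]`, `a ≤ A`, forces a large `U³`-norm. -/
theorem sum_norm_sq_mulDiff_ge {f : ℤ → ℂ} (hf1 : IsOneBounded f) {A H b L : ℤ} (hA : 1 ≤ A)
    (hH : 1 ≤ H) (hL : 1 ≤ L) (hb : 0 ≤ b) (hbA : b ≤ A) (hf : ∀ x ∉ Finset.Icc 1 L, f x = 0)
    {θ : ℝ} (hθ : 0 < θ) (hθ1 : θ ≤ 1 / 1000) (h1 : θ ^ 2 * L ≤ H ^ 2) (h2 : θ ^ 2 * L ≤ H * A)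
    (hT : θ * A * H ^ 4 * L ≤
      ‖∑ a ∈ Finset.Icc 1 A, ∑ i ∈ Finset.Icc 1 H, ∑ i' ∈ Finset.Icc 1 H, ∑ j ∈ Finset.Icc 1 H,
        ∑ j' ∈ Finset.Icc 1 H, ∑ x ∈ Finset.Icc 1 L,
          mulDiff (2 * (a + b) * (i - i')) (mulDiff (2 * a * (j - j')) f) x‖) :
    θ ^ 2009 * L ^ 4 ≤ ∑ d ∈ Finset.Ioo (-L) L, ∑ d' ∈ Finset.Ioo (-L) L,
        ‖∑ x ∈ Finset.Icc 1 L, mulDiff d (mulDiff d' f) x‖ ^ 2 := by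
  classical
  have hAH : 0 < A * H := by positivity
  -- This modulus exceeds `16 * A * H` for the representation count, is at least `4 * L` to separate
  -- differences, and exceeds `L + 8 * A * H` so that box shifts do not wrap.
  obtain ⟨Q, hQ⟩ := Int.eq_ofNat_of_zero_le (by nlinarith : 0 ≤ 16 * A * H + 4 * L)
  have hQ0 : Q ≠ 0 := by rintro rfl; norm_num at hQ; nlinarith
  have : NeZero Q := ⟨hQ0⟩
  have : Nonempty (Finset.Icc (1 : ℤ) A) := ⟨⟨1, by rw [Finset.mem_Icc]; omega⟩⟩
  have : Nonempty (Finset.Icc (1 : ℤ) H) := ⟨⟨1, by rw [Finset.mem_Icc]; omega⟩⟩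
  have hLr : (0 : ℝ) < L := by exact_mod_cast hL
  have card_eq : ∀ n : ℤ, 1 ≤ n → (Fintype.card (Finset.Icc (1 : ℤ) n) : ℝ) = n := by
    intro n hn
    have : ((Fintype.card (Finset.Icc (1 : ℤ) n) : ℤ)) = n := by
      simp only [Fintype.card_coe, Int.card_Icc]; omega
    exact_mod_cast this
  rw [← sum_sum_diffSumSq_liftMod (Q := Q) hf (by nlinarith)]
  have hI : (((Finset.Icc 1 L).image (Int.cast : ℤ → ZMod Q)).card : ℝ) ≤ L := by
    have h := Finset.card_image_le (s := Finset.Icc 1 L) (f := (Int.cast : ℤ → ZMod Q))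
    rw [← card_eq L hL, Fintype.card_coe]
    exact_mod_cast h
  have hD : (((Finset.Ioo (-L) L).image (Int.cast : ℤ → ZMod Q)).card : ℝ) ≤ 2 * L := by
    have h := Finset.card_image_le (s := Finset.Ioo (-L) L) (f := (Int.cast : ℤ → ZMod Q))
    rw [Int.card_Ioo] at h
    have h' : ((((Finset.Ioo (-L) L).image (Int.cast : ℤ → ZMod Q)).card : ℕ) : ℤ) ≤ 2 * L := by
      omega
    exact_mod_cast h'
  refine sum_diffSumSq_ge_of_familyBoxSum (f := liftMod Q f) (fun z => hf1 _) (liftMod_eq_zero hf) hI hLr hθ hθ1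
    (groupDiff_liftMod_eq_zero hf) hD
    (hasFewReps_progressions hA hH hb hbA (by omega) hLr hθ hθ1 h1 h2)
    (hasFewReps_progressions hA hH le_rfl (by omega) (by omega) hLr hθ hθ1 h1 h2) ?_
  rw [familyBoxSum_liftMod hf hb hbA (by nlinarith), card_eq A hA, card_eq H hH]
  exact hT

/-! ### The `U⁴`-norm on `ℤ` -/

section GowersNorm

variable {f : ℤ → ℂ} {L : ℤ}

theorem mulDiff_eq_zero_of_notMem (hf : ∀ x ∉ Finset.Icc 1 L, f x = 0) (h x : ℤ)
    (hx : x ∉ Finset.Icc 1 L) : mulDiff h f x = 0 := by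
  simp [mulDiff, hf x hx]

theorem mulDiff_eq_zero_of_shift_notMem (hf : ∀ x ∉ Finset.Icc 1 L, f x = 0) {h : ℤ}
    (hh : h ∉ Finset.Ioo (-L) L) : mulDiff h f = 0 := by
  funext x
  rw [Finset.mem_Ioo] at hh
  by_cases hx : x ∈ Finset.Icc 1 L
  · have : x + h ∉ Finset.Icc 1 L := by
      rw [Finset.mem_Icc] at hx ⊢
      omega
    simp [mulDiff, hf _ this]
  · simp [mulDiff, hf _ hx]

theorem mulDiff_zero (h : ℤ) : mulDiff h 0 = 0 := by
  funext x
  simp [mulDiff]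

theorem sum_sum_mulDiff (hf : ∀ x ∉ Finset.Icc 1 L, f x = 0) :
    ∑ h ∈ Finset.Ioo (-L) L, ∑ x ∈ Finset.Icc 1 L, mulDiff h f x =
      ((‖∑ x ∈ Finset.Icc 1 L, f x‖ ^ 2 : ℝ) : ℂ) := by
  rw [← Finset.sum_coe_sort (Finset.Icc 1 L), norm_sum_sq_eq,
    Finset.sum_coe_sort (Finset.Icc 1 L) (fun x => ∑ j : Finset.Icc 1 L, f x * conj (f j)),
    Finset.sum_comm]
  simp only [fun x => Finset.sum_coe_sort (Finset.Icc 1 L) (fun y => f x * conj (f y))]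
  conv_rhs => rw [Finset.sum_comm]
  refine Finset.sum_congr rfl fun x hx => ?_
  simp only [mulDiff]
  rw [Finset.mem_Icc] at hx
  symm
  refine Finset.sum_of_injOn (fun y => y - x) (fun a _ b _ hab => by simpa using hab) ?_ ?_ ?_
  · intro y hy
    simp only [Finset.coe_Icc, Set.mem_Icc, Finset.coe_Ioo, Set.mem_Ioo] at hy ⊢
    omega
  · intro h _ hh
    have : x + h ∉ Finset.Icc 1 L := fun hm => hh ⟨x + h, by simpa using hm, by simp⟩
    rw [hf _ this, zero_mul]
  · intro y _
    simp

theorem tsum_mulDiffs_four (hf : ∀ x ∉ Finset.Icc 1 L, f x = 0) :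
    ∑' p : ℤ × (Fin 4 → ℤ), mulDiffs (List.ofFn p.2) f p.1 =
      ((∑ h₁ ∈ Finset.Ioo (-L) L, ∑ h₂ ∈ Finset.Ioo (-L) L, ∑ h₃ ∈ Finset.Ioo (-L) L,
        ‖∑ x ∈ Finset.Icc 1 L, mulDiff h₁ (mulDiff h₂ (mulDiff h₃ f)) x‖ ^ 2 : ℝ) : ℂ) := by
  -- The outermost shift is placed next to the base point, so that the two innermost sums close up
  -- into a squared modulus.
  let e : ℤ × ℤ × ℤ × ℤ × ℤ ≃ ℤ × (Fin 4 → ℤ) :=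
    { toFun := fun t => (t.2.2.2.2, ![t.2.2.2.1, t.1, t.2.1, t.2.2.1])
      invFun := fun p => (p.2 1, p.2 2, p.2 3, p.2 0, p.1)
      left_inv := fun _ => rfl
      right_inv := by
        rintro ⟨x, h⟩
        ext i
        · rfl
        · fin_cases i <;> rfl }
  rw [← e.tsum_eq]
  have h0 : ∀ t : ℤ × ℤ × ℤ × ℤ × ℤ, mulDiffs (List.ofFn (e t).2) f (e t).1 =
      mulDiff t.2.2.2.1 (mulDiff t.1 (mulDiff t.2.1 (mulDiff t.2.2.1 f))) t.2.2.2.2 := by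
    rintro ⟨a, b, c, d, x⟩
    simp only [mulDiffs, List.ofFn_succ, List.ofFn_zero, List.foldr]
    rfl
  simp only [h0]
  rw [tsum_eq_sum (s := Finset.Ioo (-L) L ×ˢ Finset.Ioo (-L) L ×ˢ Finset.Ioo (-L) L ×ˢ
    Finset.Ioo (-L) L ×ˢ Finset.Icc 1 L)]
  · simp only [Finset.sum_product]
    push_cast
    refine Finset.sum_congr rfl fun h₁ _ => Finset.sum_congr rfl fun h₂ _ =>
      Finset.sum_congr rfl fun h₃ _ => ?_
    rw [sum_sum_mulDiff]
    · push_cast; rfl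
    · exact mulDiff_eq_zero_of_notMem (mulDiff_eq_zero_of_notMem
        (mulDiff_eq_zero_of_notMem hf _) _) _
  · rintro ⟨a, b, c, d, x⟩ ht
    simp only [Finset.mem_product, not_and_or] at ht
    have s1 := mulDiff_eq_zero_of_notMem hf c
    have s2 := mulDiff_eq_zero_of_notMem s1 b
    have s3 := mulDiff_eq_zero_of_notMem s2 a
    have s4 := mulDiff_eq_zero_of_notMem s3 d
    rcases ht with h | h | h | h | h
    · simp only [mulDiff_eq_zero_of_shift_notMem s2 h, mulDiff_zero, Pi.zero_apply]
    · simp only [mulDiff_eq_zero_of_shift_notMem s1 h, mulDiff_zero, Pi.zero_apply]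
    · simp only [mulDiff_eq_zero_of_shift_notMem hf h, mulDiff_zero, Pi.zero_apply]
    · simp only [mulDiff_eq_zero_of_shift_notMem s3 h, Pi.zero_apply]
    · exact s4 x h

theorem gowersNorm_four_pow (hf : ∀ x ∉ Finset.Icc 1 L, f x = 0) :
    gowersNorm 4 f ^ (2 ^ 4) =
      ∑ h₁ ∈ Finset.Ioo (-L) L, ∑ h₂ ∈ Finset.Ioo (-L) L, ∑ h₃ ∈ Finset.Ioo (-L) L,
        ‖∑ x ∈ Finset.Icc 1 L, mulDiff h₁ (mulDiff h₂ (mulDiff h₃ f)) x‖ ^ 2 := by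
  rw [gowersNorm, tsum_mulDiffs_four hf, Complex.ofReal_re, ← Real.rpow_natCast,
    ← Real.rpow_mul (by positivity)]
  norm_num

/-- The `U³`-norm is controlled by the `U⁴`-norm. -/
theorem sq_sum_norm_sq_mulDiff_le (hL : 1 ≤ L) (hf : ∀ x ∉ Finset.Icc 1 L, f x = 0) :
    (∑ d ∈ Finset.Ioo (-L) L, ∑ d' ∈ Finset.Ioo (-L) L,
        ‖∑ x ∈ Finset.Icc 1 L, mulDiff d (mulDiff d' f) x‖ ^ 2) ^ 2 ≤
      8 * L ^ 3 * gowersNorm 4 f ^ (2 ^ 4) := by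
  rw [gowersNorm_four_pow hf]
  set D := Finset.Ioo (-L) L with hD
  -- A third shift opens the square, leaving a sum over at most `(2 * L) ^ 3` triples of shifts to
  -- which Cauchy–Schwarz applies.
  have e : ((∑ d ∈ D, ∑ d' ∈ D, ‖∑ x ∈ Finset.Icc 1 L, mulDiff d (mulDiff d' f) x‖ ^ 2 : ℝ) : ℂ) =
      ∑ t ∈ D ×ˢ D ×ˢ D, ∑ x ∈ Finset.Icc 1 L, mulDiff t.1 (mulDiff t.2.1 (mulDiff t.2.2 f)) x := by
    rw [Finset.sum_product_right]
    simp only [Finset.sum_product]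
    rw [Complex.ofReal_sum]
    refine Finset.sum_congr rfl fun d _ => ?_
    rw [Complex.ofReal_sum]
    refine Finset.sum_congr rfl fun d' _ => ?_
    rw [← sum_sum_mulDiff (mulDiff_eq_zero_of_notMem (mulDiff_eq_zero_of_notMem hf _) _)]
  have h1 : ∑ d ∈ D, ∑ d' ∈ D, ‖∑ x ∈ Finset.Icc 1 L, mulDiff d (mulDiff d' f) x‖ ^ 2 ≤
      ∑ t ∈ D ×ˢ D ×ˢ D,
        ‖∑ x ∈ Finset.Icc 1 L, mulDiff t.1 (mulDiff t.2.1 (mulDiff t.2.2 f)) x‖ := by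
    refine le_trans (le_of_eq ?_) (norm_sum_le _ _)
    rw [← e, Complex.norm_real, Real.norm_of_nonneg (by positivity)]
  have hc : (D.card : ℝ) ≤ 2 * L := by
    have : (D.card : ℤ) ≤ 2 * L := by rw [hD, Int.card_Ioo]; omega
    exact_mod_cast this
  have hL0 : (0 : ℝ) < L := by exact_mod_cast hL
  calc _ ≤ (∑ t ∈ D ×ˢ D ×ˢ D,
        ‖∑ x ∈ Finset.Icc 1 L, mulDiff t.1 (mulDiff t.2.1 (mulDiff t.2.2 f)) x‖) ^ 2 := by gcongr
    _ ≤ _ := sq_sum_le_card_mul_sum_sq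
    _ ≤ 8 * L ^ 3 * ∑ t ∈ D ×ˢ D ×ˢ D,
        ‖∑ x ∈ Finset.Icc 1 L, mulDiff t.1 (mulDiff t.2.1 (mulDiff t.2.2 f)) x‖ ^ 2 := by
        gcongr
        rw [Finset.card_product, Finset.card_product]
        push_cast
        calc _ ≤ (2 * (L : ℝ)) * ((2 * L) * (2 * L)) := by gcongr
          _ = _ := by ring
    _ = _ := by simp only [Finset.sum_product]

end GowersNorm

/-! ### Box averages as unnormalized sums, and their trivial bounds -/

section BoxAverage

theorem fejerWeight_eq_zero {δ M : ℝ} {h : ℤ} (hh : h ∉ Finset.Icc (-⌊δ * M⌋) ⌊δ * M⌋) :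
    fejerWeight δ M h = 0 := by
  unfold fejerWeight
  rw [Finset.filter_eq_empty_iff.2, Finset.card_empty]
  · simp
  · rintro ⟨x, y⟩ hxy heq
    simp only [initInterval, Finset.mem_product, Finset.mem_Icc] at hxy
    rw [Finset.mem_Icc] at hh
    simp only at heq
    omega

/-- The weight counts representations as a difference of two elements of the interval, so summing
against it is summing over pairs. -/
theorem sum_fejerWeight_mul (δ M : ℝ) (g : ℤ → ℂ) :
    ∑ h ∈ Finset.Icc (-⌊δ * M⌋) ⌊δ * M⌋, (fejerWeight δ M h : ℂ) * g h =
      (∑ i ∈ initInterval (δ * M), ∑ i' ∈ initInterval (δ * M), g (i - i')) /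
        ((δ ^ 2 * M : ℝ) : ℂ) := by
  rw [← Finset.sum_product' (f := fun i i' => g (i - i')),
    ← Finset.sum_fiberwise_of_maps_to (t := Finset.Icc (-⌊δ * M⌋) ⌊δ * M⌋)
      (g := fun p : ℤ × ℤ => p.1 - p.2), Finset.sum_div]
  · refine Finset.sum_congr rfl fun h _ => ?_
    rw [Finset.sum_congr rfl (g := fun _ => g h)
      fun p hp => by rw [(Finset.mem_filter.1 hp).2], Finset.sum_const, nsmul_eq_mul, fejerWeight]
    push_cast
    ring
  · rintro ⟨x, y⟩ hxy
    simp only [initInterval, Finset.mem_product, Finset.mem_Icc] at hxy ⊢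
    omega

theorem tsum_fejerWeight_mulDiffs {f : ℤ → ℂ} {L : ℤ} (hf : ∀ x ∉ Finset.Icc 1 L, f x = 0)
    (δ M : ℝ) (P R : ℤ) :
    ∑' p : ℤ × ℤ × ℤ, (fejerWeight δ M p.2.1 : ℂ) * (fejerWeight δ M p.2.2 : ℂ) *
        mulDiffs [P * p.2.1, R * p.2.2] f p.1 =
      (∑ i ∈ initInterval (δ * M), ∑ i' ∈ initInterval (δ * M), ∑ j ∈ initInterval (δ * M),
        ∑ j' ∈ initInterval (δ * M), ∑ x ∈ Finset.Icc 1 L,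
          mulDiff (P * (i - i')) (mulDiff (R * (j - j')) f) x) / (((δ ^ 2 * M) ^ 2 : ℝ) : ℂ) := by
  rw [tsum_eq_sum (s := Finset.Icc 1 L ×ˢ Finset.Icc (-⌊δ * M⌋) ⌊δ * M⌋ ×ˢ
    Finset.Icc (-⌊δ * M⌋) ⌊δ * M⌋)]
  · rw [Finset.sum_product_right]
    simp only [Finset.sum_product, mulDiffs, List.foldr]
    have h1 : ∀ h₁ h₂ : ℤ, ∑ x ∈ Finset.Icc 1 L, (fejerWeight δ M h₁ : ℂ) * (fejerWeight δ M h₂ : ℂ) *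
        mulDiff (P * h₁) (mulDiff (R * h₂) f) x = (fejerWeight δ M h₁ : ℂ) *
        ((fejerWeight δ M h₂ : ℂ) * ∑ x ∈ Finset.Icc 1 L, mulDiff (P * h₁) (mulDiff (R * h₂) f) x) := by
      intro h₁ h₂
      rw [Finset.mul_sum, Finset.mul_sum]
      exact Finset.sum_congr rfl fun _ _ => by ring
    simp only [h1, ← Finset.mul_sum]
    have h2 : ∀ h₁ : ℤ, ∑ h₂ ∈ Finset.Icc (-⌊δ * M⌋) ⌊δ * M⌋, (fejerWeight δ M h₂ : ℂ) *
        ∑ x ∈ Finset.Icc 1 L, mulDiff (P * h₁) (mulDiff (R * h₂) f) x = _ := fun h₁ =>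
      sum_fejerWeight_mul δ M fun h₂ => ∑ x ∈ Finset.Icc 1 L, mulDiff (P * h₁) (mulDiff (R * h₂) f) x
    simp only [h2]
    rw [sum_fejerWeight_mul δ M fun h₁ => (∑ j ∈ initInterval (δ * M), ∑ j' ∈ initInterval (δ * M),
      ∑ x ∈ Finset.Icc 1 L, mulDiff (P * h₁) (mulDiff (R * (j - j')) f) x) /
        ((δ ^ 2 * M : ℝ) : ℂ)]
    simp only [← Finset.sum_div]
    rw [div_div]
    congr 1
    push_cast
    ring
  · rintro ⟨x, h₁, h₂⟩ ht
    simp only [Finset.mem_product, not_and_or] at ht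
    rcases ht with h | h | h
    · simp only [mulDiffs, List.foldr]
      rw [mulDiff_eq_zero_of_notMem (mulDiff_eq_zero_of_notMem hf _) _ _ h, mul_zero]
    · simp [fejerWeight_eq_zero h]
    · simp [fejerWeight_eq_zero h]

end BoxAverage

/-- The unnormalized sum underlying `boxAverage`, for `f` supported in `[1, L]`. -/
noncomputable def boxSum (q : ℕ) (A H L b : ℤ) (f : ℤ → ℂ) : ℂ :=
  ∑ a ∈ Finset.Icc 1 A, ∑ i ∈ Finset.Icc 1 H, ∑ i' ∈ Finset.Icc 1 H, ∑ j ∈ Finset.Icc 1 H,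
    ∑ j' ∈ Finset.Icc 1 H, ∑ x ∈ Finset.Icc 1 L,
      mulDiff (2 * q * (a + b) * (i - i')) (mulDiff (2 * q * a * (j - j')) f) x

theorem boxAverage_eq {f : ℤ → ℂ} {L : ℤ} (hf : ∀ x ∉ Finset.Icc 1 L, f x = 0) (q : ℕ)
    {δ δ' M : ℝ} (hA : 1 ≤ ⌊δ * M⌋) (b : ℤ) :
    boxAverage q δ δ' M b f =
      (boxSum q ⌊δ * M⌋ ⌊δ' * M⌋ L b f).re / (⌊δ * M⌋ * (δ' ^ 2 * M) ^ 2) := by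
  unfold boxAverage
  simp only [tsum_fejerWeight_mulDiffs hf]
  rw [Finset.expect_eq_sum_div_card, ← Finset.sum_div, div_div]
  have hc : ((initInterval (δ * M)).card : ℂ) = ((⌊δ * M⌋ : ℝ) : ℂ) := by
    have : ((initInterval (δ * M)).card : ℤ) = ⌊δ * M⌋ := by
      rw [initInterval, Int.card_Icc]; omega
    exact_mod_cast congrArg (Int.cast : ℤ → ℂ) this
  rw [hc, ← Complex.ofReal_mul, Complex.div_ofReal_re, mul_comm ((δ' ^ 2 * M) ^ 2)]
  rfl

/-- A shift of size at least `L` moves the support off itself. Retaining this as indicators lets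
long progressions be handled by counting. -/
theorem norm_sum_mulDiff_mulDiff_le {f : ℤ → ℂ} {L : ℤ} (hL : 1 ≤ L) (hf1 : IsOneBounded f)
    (hf : ∀ x ∉ Finset.Icc 1 L, f x = 0) (d d' : ℤ) :
    ‖∑ x ∈ Finset.Icc 1 L, mulDiff d (mulDiff d' f) x‖ ≤
      (if d ∈ Finset.Ioo (-L) L then 1 else 0) * (if d' ∈ Finset.Ioo (-L) L then 1 else 0) * L := by
  by_cases h : d ∈ Finset.Ioo (-L) L
  swap
  · rw [mulDiff_eq_zero_of_shift_notMem (mulDiff_eq_zero_of_notMem hf _) h]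
    simp [h]
  by_cases h' : d' ∈ Finset.Ioo (-L) L
  swap
  · rw [mulDiff_eq_zero_of_shift_notMem hf h', mulDiff_zero]
    simp [h']
  rw [if_pos h, if_pos h', one_mul, one_mul]
  refine (norm_sum_le _ _).trans ?_
  have hb : ∀ x ∈ Finset.Icc 1 L, ‖mulDiff d (mulDiff d' f) x‖ ≤ 1 := by
    intro x _
    simp only [mulDiff, norm_mul, map_mul, RCLike.norm_conj]
    exact mul_le_one₀ (mul_le_one₀ (hf1 _) (norm_nonneg _) (hf1 _)) (by positivity)
      (mul_le_one₀ (hf1 _) (norm_nonneg _) (hf1 _))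
  refine (Finset.sum_le_sum hb).trans (le_of_eq ?_)
  rw [Finset.sum_const, nsmul_eq_mul, mul_one]
  have : ((Finset.Icc 1 L).card : ℤ) = L := by rw [Int.card_Icc]; omega
  exact_mod_cast this

/-- The number of pairs in `[H]²` whose difference, dilated by `2a`, lies in `(-L, L)`. -/
theorem sum_sum_indicator_le {H L a : ℤ} (hH : 1 ≤ H) (hL : 1 ≤ L) (ha : 1 ≤ a) :
    ∑ i ∈ Finset.Icc 1 H, ∑ j ∈ Finset.Icc 1 H,
      (if 2 * a * (i - j) ∈ Finset.Ioo (-L) L then (1 : ℝ) else 0) ≤ H * (L / a + 1) := by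
  have ha0 : (0 : ℝ) < a := by exact_mod_cast ha
  have hin : ∀ i ∈ Finset.Icc 1 H, ∑ j ∈ Finset.Icc 1 H,
      (if 2 * a * (i - j) ∈ Finset.Ioo (-L) L then (1 : ℝ) else 0) ≤ L / a + 1 := by
    intro i _
    rw [Finset.sum_boole]
    have hsub : (Finset.Icc 1 H).filter (fun j => 2 * a * (i - j) ∈ Finset.Ioo (-L) L) ⊆
        Finset.Icc (i - L / (2 * a)) (i + L / (2 * a)) := by
      intro j hj
      rw [Finset.mem_filter, Finset.mem_Ioo] at hj
      obtain ⟨_, h1, h2⟩ := hj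
      have e1 : i - j ≤ L / (2 * a) := by
        rw [Int.le_ediv_iff_mul_le (by omega)]; linarith
      have e2 : -(i - j) ≤ L / (2 * a) := by
        rw [Int.le_ediv_iff_mul_le (by omega)]; linarith
      rw [Finset.mem_Icc]
      omega
    have h0 : 0 ≤ L / (2 * a) := Int.ediv_nonneg (by omega) (by omega)
    have hc : ((Finset.Icc (i - L / (2 * a)) (i + L / (2 * a))).card : ℤ) = 2 * (L / (2 * a)) + 1 := by
      rw [Int.card_Icc]; omega
    have hd : ((L / (2 * a) : ℤ) : ℝ) ≤ L / (2 * a) := by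
      rw [le_div_iff₀ (by positivity)]
      exact_mod_cast Int.ediv_mul_le L (by omega : 2 * a ≠ 0)
    calc _ ≤ ((Finset.Icc (i - L / (2 * a)) (i + L / (2 * a))).card : ℝ) := by
          exact_mod_cast Finset.card_le_card hsub
      _ = 2 * ((L / (2 * a) : ℤ) : ℝ) + 1 := by exact_mod_cast hc
      _ ≤ 2 * (L / (2 * a)) + 1 := by gcongr
      _ = _ := by field_simp
  refine (Finset.sum_le_sum hin).trans (le_of_eq ?_)
  rw [Finset.sum_const, nsmul_eq_mul]
  have : ((Finset.Icc 1 H).card : ℤ) = H := by rw [Int.card_Icc]; omega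
  rw [show ((Finset.Icc 1 H).card : ℝ) = H by exact_mod_cast this]

theorem sum_sum_indicator_le_sq {H : ℤ} (hH : 1 ≤ H) (P : ℤ → ℤ → Prop)
    [∀ i j, Decidable (P i j)] :
    ∑ i ∈ Finset.Icc 1 H, ∑ j ∈ Finset.Icc 1 H, (if P i j then (1 : ℝ) else 0) ≤ H ^ 2 := by
  have : ((Finset.Icc 1 H).card : ℤ) = H := by rw [Int.card_Icc]; omega
  have hc : ((Finset.Icc 1 H).card : ℝ) = H := by exact_mod_cast this
  calc _ ≤ ∑ i ∈ Finset.Icc 1 H, ∑ j ∈ Finset.Icc 1 H, (1 : ℝ) :=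
        Finset.sum_le_sum fun i _ => Finset.sum_le_sum fun j _ => by split_ifs <;> norm_num
    _ = _ := by simp only [Finset.sum_const, nsmul_eq_mul, hc]; ring

theorem norm_boxSum_le_sum {f : ℤ → ℂ} {A H L b : ℤ} (hL : 1 ≤ L) (hf1 : IsOneBounded f)
    (hf : ∀ x ∉ Finset.Icc 1 L, f x = 0) :
    ‖boxSum 1 A H L b f‖ ≤ ∑ a ∈ Finset.Icc 1 A,
      (∑ i ∈ Finset.Icc 1 H, ∑ j ∈ Finset.Icc 1 H,
        (if 2 * (a + b) * (i - j) ∈ Finset.Ioo (-L) L then (1 : ℝ) else 0)) *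
      (∑ i ∈ Finset.Icc 1 H, ∑ j ∈ Finset.Icc 1 H,
        (if 2 * a * (i - j) ∈ Finset.Ioo (-L) L then (1 : ℝ) else 0)) * L := by
  unfold boxSum
  simp only [Nat.cast_one, mul_one]
  refine (norm_sum_le _ _).trans (Finset.sum_le_sum fun a _ => ?_)
  rw [Finset.sum_mul, Finset.sum_mul]
  refine (norm_sum_le _ _).trans (Finset.sum_le_sum fun i _ => ?_)
  rw [Finset.sum_mul, Finset.sum_mul]
  refine (norm_sum_le _ _).trans (Finset.sum_le_sum fun i' _ => ?_)
  rw [Finset.mul_sum, Finset.sum_mul]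
  refine (norm_sum_le _ _).trans (Finset.sum_le_sum fun j _ => ?_)
  rw [Finset.mul_sum, Finset.sum_mul]
  refine (norm_sum_le _ _).trans (Finset.sum_le_sum fun j' _ => ?_)
  exact norm_sum_mulDiff_mulDiff_le hL hf1 hf _ _

theorem norm_boxSum_le {f : ℤ → ℂ} {A H L b : ℤ} (hA : 1 ≤ A) (hH : 1 ≤ H) (hL : 1 ≤ L)
    (hf1 : IsOneBounded f) (hf : ∀ x ∉ Finset.Icc 1 L, f x = 0) :
    ‖boxSum 1 A H L b f‖ ≤ A * H ^ 4 * L := by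
  have hL0 : (0 : ℝ) < L := by exact_mod_cast hL
  refine (norm_boxSum_le_sum hL hf1 hf).trans ?_
  calc _ ≤ ∑ a ∈ Finset.Icc 1 A, (H : ℝ) ^ 2 * H ^ 2 * L := by
        refine Finset.sum_le_sum fun a _ => ?_
        gcongr
        · exact sum_sum_indicator_le_sq hH _
        · exact sum_sum_indicator_le_sq hH _
    _ = _ := by
        have : ((Finset.Icc 1 A).card : ℤ) = A := by rw [Int.card_Icc]; omega
        rw [Finset.sum_const, nsmul_eq_mul,
          show ((Finset.Icc 1 A).card : ℝ) = A by exact_mod_cast this]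
        ring

/-- A bound for the box sum which is nontrivial when the progressions are longer than the support
of `f`. -/
theorem norm_boxSum_le_of_long {f : ℤ → ℂ} {A H L b : ℤ} (hA : 1 ≤ A) (hH : 1 ≤ H) (hL : 1 ≤ L)
    (hb : 0 ≤ b) (hf1 : IsOneBounded f) (hf : ∀ x ∉ Finset.Icc 1 L, f x = 0) {η : ℝ} (hη : 0 < η) :
    ‖boxSum 1 A H L b f‖ ≤ A * H ^ 2 * L * (η * H ^ 2 + (L / (η * A) + 1) ^ 2) := by
  have hA0 : (0 : ℝ) < A := by exact_mod_cast hA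
  have hL0 : (0 : ℝ) < L := by exact_mod_cast hL
  have hH0 : (0 : ℝ) < H := by exact_mod_cast hH
  refine (norm_boxSum_le_sum hL hf1 hf).trans ?_
  have hterm : ∀ a ∈ Finset.Icc 1 A,
      (∑ i ∈ Finset.Icc 1 H, ∑ j ∈ Finset.Icc 1 H,
        (if 2 * (a + b) * (i - j) ∈ Finset.Ioo (-L) L then (1 : ℝ) else 0)) *
      (∑ i ∈ Finset.Icc 1 H, ∑ j ∈ Finset.Icc 1 H,
        (if 2 * a * (i - j) ∈ Finset.Ioo (-L) L then (1 : ℝ) else 0)) * L ≤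
      H ^ 2 * L * ((if (a : ℝ) ≤ η * A then 1 else 0) * H ^ 2 + (L / (η * A) + 1) ^ 2) := by
    intro a ha
    rw [Finset.mem_Icc] at ha
    have ha0 : (0 : ℝ) < a := by exact_mod_cast (by omega : 0 < a)
    -- For `a ≤ η A` both indicator sums are bounded by `H ^ 2`. For larger `a`, each shift size has
    -- few differences that keep it below `L`, and `a + b ≥ a` gives the same for the other
    -- direction.
    by_cases hsmall : (a : ℝ) ≤ η * A
    · rw [if_pos hsmall]
      calc _ ≤ (H : ℝ) ^ 2 * H ^ 2 * L := by
            gcongr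
            · exact sum_sum_indicator_le_sq hH _
            · exact sum_sum_indicator_le_sq hH _
        _ = H ^ 2 * L * (1 * H ^ 2 + 0) := by ring
        _ ≤ _ := by gcongr; positivity
    · rw [if_neg hsmall]
      push Not at hsmall
      have hn : ∀ c : ℤ, a ≤ c → ∑ i ∈ Finset.Icc 1 H, ∑ j ∈ Finset.Icc 1 H,
          (if 2 * c * (i - j) ∈ Finset.Ioo (-L) L then (1 : ℝ) else 0) ≤
          H * (L / (η * A) + 1) := by
        intro c hc
        refine (sum_sum_indicator_le hH hL (by omega)).trans ?_
        have : (a : ℝ) ≤ c := by exact_mod_cast hc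
        gcongr
        linarith
      calc _ ≤ (H * ((L : ℝ) / (η * A) + 1)) * (H * (L / (η * A) + 1)) * L := by
            gcongr
            · exact hn (a + b) (by omega)
            · exact hn a le_rfl
        _ = _ := by ring
  refine (Finset.sum_le_sum hterm).trans ?_
  have hcard : ∑ a ∈ Finset.Icc 1 A, (if (a : ℝ) ≤ η * A then (1 : ℝ) else 0) ≤ η * A := by
    rw [Finset.sum_boole]
    have hsub : (Finset.Icc 1 A).filter (fun a : ℤ => (a : ℝ) ≤ η * A) ⊆
        Finset.Icc 1 ⌊η * A⌋ := by
      intro a ha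
      rw [Finset.mem_filter, Finset.mem_Icc] at ha
      rw [Finset.mem_Icc]
      exact ⟨ha.1.1, Int.le_floor.2 ha.2⟩
    have h0 : 0 ≤ ⌊η * A⌋ := Int.floor_nonneg.2 (by positivity)
    have hc : ((Finset.Icc 1 ⌊η * A⌋).card : ℤ) = ⌊η * A⌋ := by rw [Int.card_Icc]; omega
    calc _ ≤ ((Finset.Icc 1 ⌊η * A⌋).card : ℝ) := by exact_mod_cast Finset.card_le_card hsub
      _ = ⌊η * A⌋ := by exact_mod_cast hc
      _ ≤ _ := Int.floor_le _
  have hcA : ((Finset.Icc 1 A).card : ℤ) = A := by rw [Int.card_Icc]; omega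
  rw [← Finset.mul_sum, Finset.sum_add_distrib, ← Finset.sum_mul, Finset.sum_const, nsmul_eq_mul,
    show ((Finset.Icc 1 A).card : ℝ) = A by exact_mod_cast hcA]
  calc _ ≤ (H : ℝ) ^ 2 * L * (η * A * H ^ 2 + A * (L / (η * A) + 1) ^ 2) := by gcongr
    _ = _ := by ring

/-! ### Parameters, and the theorem for a single shift `b` -/

/-- No upper bound on `δ₂` or `δ₃` is assumed, so one is extracted from the large box sum. If `4L ≤
δ₄A`, then `δ₄ H²` is bounded directly. Otherwise `δ₄³ δ₂² δ₃² ≤ 2¹⁴`, and for `δ₃ > 1` inserting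
the hypothesis on `δ₃` twice into `δ₄ δ₃⁸` gives `2⁻⁴² (δ₄³ δ₂² δ₃²)³ ≤ 1`; this is where the
constant `2⁻²¹` is used in full. -/
theorem mul_sq_le_of_boxSum_bound {N M A H L δ₂ δ₃ δ₄ : ℝ} (hN : 1 ≤ N) (hM : M ^ 2 = N)
    (hM0 : 0 < M) (hA0 : 0 < A) (hH0 : 0 < H) (hL0 : 0 < L)
    (hA : δ₂ * M ≤ 2 * A) (hH : δ₃ * M ≤ 2 * H) (hL : L ≤ 2 * N) (h₂ : 0 < δ₂) (h₃ : 0 < δ₃)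
    (h₄ : 0 < δ₄) (h₄' : δ₄ ≤ 2) (hδ : δ₃ < 1 / 2 ^ 21 * δ₂ ^ 3 * δ₄ ^ 4)
    (hS : δ₄ / 2 * A * H ^ 4 * L ≤ A * H ^ 2 * L * (δ₄ / 4 * H ^ 2 + (L / (δ₄ / 4 * A) + 1) ^ 2)) :
    δ₄ * δ₃ ^ 2 ≤ 64 := by
  have e1 : δ₄ / 4 * H ^ 2 ≤ (4 * L / (δ₄ * A) + 1) ^ 2 := by
    have e : L / (δ₄ / 4 * A) = 4 * L / (δ₄ * A) := by field_simp
    rw [e] at hS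
    have : (A * H ^ 2 * L) * (δ₄ / 2 * H ^ 2) ≤
        (A * H ^ 2 * L) * (δ₄ / 4 * H ^ 2 + (4 * L / (δ₄ * A) + 1) ^ 2) := by
      calc _ = δ₄ / 2 * A * H ^ 4 * L := by ring
        _ ≤ _ := hS
    have := le_of_mul_le_mul_left this (by positivity)
    linarith
  have hHsq : δ₃ ^ 2 * N ≤ 4 * H ^ 2 := by
    calc δ₃ ^ 2 * N = (δ₃ * M) ^ 2 := by rw [← hM]; ring
      _ ≤ (2 * H) ^ 2 := by gcongr
      _ = _ := by ring
  rcases le_or_gt (4 * L / (δ₄ * A)) 1 with hw | hw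
  · have e2 : δ₄ / 4 * H ^ 2 ≤ (1 + 1) ^ 2 := e1.trans (by gcongr)
    have e3 : δ₄ * (δ₃ ^ 2 * N) ≤ δ₄ * (4 * H ^ 2) := by gcongr
    have e4 : δ₄ * δ₃ ^ 2 * 1 ≤ δ₄ * δ₃ ^ 2 * N := by gcongr
    linarith
  · have e2 : δ₄ / 4 * H ^ 2 ≤ (2 * (4 * L / (δ₄ * A))) ^ 2 :=
      e1.trans (by gcongr; linarith)
    have e3 : δ₄ ^ 3 * (H * A) ^ 2 ≤ 256 * L ^ 2 := by
      have : δ₄ / 4 * H ^ 2 ≤ 64 * L ^ 2 / (δ₄ * A) ^ 2 := by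
        refine e2.trans (le_of_eq ?_); ring
      rw [le_div_iff₀ (by positivity)] at this
      nlinarith
    have e4 : δ₂ * δ₃ * N ≤ 4 * (H * A) := by
      calc δ₂ * δ₃ * N = (δ₃ * M) * (δ₂ * M) := by rw [← hM]; ring
        _ ≤ (2 * H) * (2 * A) := by gcongr
        _ = _ := by ring
    have e5 : δ₄ ^ 3 * δ₂ ^ 2 * δ₃ ^ 2 ≤ 2 ^ 14 := by
      refine le_of_mul_le_mul_right (a := N ^ 2) ?_ (by positivity)
      calc δ₄ ^ 3 * δ₂ ^ 2 * δ₃ ^ 2 * N ^ 2 = δ₄ ^ 3 * (δ₂ * δ₃ * N) ^ 2 := by ring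
        _ ≤ δ₄ ^ 3 * (4 * (H * A)) ^ 2 := by gcongr
        _ = 16 * (δ₄ ^ 3 * (H * A) ^ 2) := by ring
        _ ≤ 16 * (256 * L ^ 2) := by gcongr
        _ ≤ 16 * (256 * (2 * N) ^ 2) := by gcongr
        _ = _ := by ring
    rcases le_or_gt δ₃ 1 with h | h
    · calc δ₄ * δ₃ ^ 2 ≤ 2 * 1 ^ 2 := by gcongr
        _ ≤ _ := by norm_num
    · have e6 : δ₄ * δ₃ ^ 8 ≤ 1 := by
        calc δ₄ * δ₃ ^ 8 = δ₄ * δ₃ ^ 6 * δ₃ ^ 2 := by ring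
          _ ≤ δ₄ * δ₃ ^ 6 * (1 / 2 ^ 21 * δ₂ ^ 3 * δ₄ ^ 4) ^ 2 := by gcongr
          _ = 1 / 2 ^ 42 * (δ₄ ^ 3 * δ₂ ^ 2 * δ₃ ^ 2) ^ 3 := by ring
          _ ≤ 1 / 2 ^ 42 * (2 ^ 14) ^ 3 := by gcongr
          _ = 1 := by norm_num
      have e7 : δ₃ ^ 2 ≤ δ₃ ^ 8 := pow_le_pow_right₀ h.le (by norm_num)
      have : δ₄ * δ₃ ^ 2 ≤ δ₄ * δ₃ ^ 8 := by gcongr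
      linarith

/-- The bounds `δ₄ ≤ 2` and `δ₄ δ₃² ≤ 64` make `θ` small. The last two conclusions reduce to `8 θ² ≤
δ₃²` and `8 θ² ≤ δ₂ δ₃`, the factor `8` covering `L ≤ 2N` and the two floors; the second is checked
after cubing, to match `δ₂³` in the hypothesis on `δ₃`. -/
theorem parameter_bounds {N M A H L δ₂ δ₃ δ₄ : ℝ} (hM : M ^ 2 = N)
    (hA : δ₂ * M ≤ 2 * A) (hH : δ₃ * M ≤ 2 * H) (hL : L ≤ 2 * N) (hM0 : 0 < M) (h₂ : 0 < δ₂)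
    (h₃ : 0 < δ₃) (h₄ : 0 < δ₄) (h₄' : δ₄ ≤ 2) (hδ : δ₃ < 1 / 2 ^ 21 * δ₂ ^ 3 * δ₄ ^ 4)
    (h : δ₄ * δ₃ ^ 2 ≤ 64) {θ : ℝ} (hθ : θ = 1 / 2 ^ 20 * (δ₃ * δ₄) ^ 2) :
    θ ≤ 1 / 1000 ∧ θ ≤ δ₄ / 2 ∧ θ ^ 2 * L ≤ H ^ 2 ∧ θ ^ 2 * L ≤ H * A := by
  have hN : 0 < N := by rw [← hM]; positivity
  have t1 : θ ≤ 1 / 2 ^ 14 * δ₄ := by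
    calc θ = 1 / 2 ^ 20 * (δ₄ * (δ₄ * δ₃ ^ 2)) := by rw [hθ]; ring
      _ ≤ 1 / 2 ^ 20 * (δ₄ * 64) := by gcongr
      _ = _ := by ring
  have hθ0 : 0 < θ := by rw [hθ]; positivity
  have t2 : (δ₃ * δ₄) ^ 2 ≤ 2 ^ 7 := by
    calc (δ₃ * δ₄) ^ 2 = δ₄ * (δ₄ * δ₃ ^ 2) := by ring
      _ ≤ 2 * 64 := by gcongr
      _ = _ := by norm_num
  have t3 : θ ≤ 1 / 2 ^ 13 := by rw [hθ]; linarith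
  refine ⟨t3.trans (by norm_num), by linarith, ?_, ?_⟩
  · have e1 : 8 * θ ^ 2 ≤ δ₃ ^ 2 := by
      calc 8 * θ ^ 2 = 8 / 2 ^ 40 * ((δ₃ * δ₄) ^ 2 * δ₄ ^ 2 * δ₃ ^ 2) := by rw [hθ]; ring
        _ ≤ 8 / 2 ^ 40 * (2 ^ 7 * 2 ^ 2 * δ₃ ^ 2) := by gcongr
        _ = 1 / 2 ^ 28 * δ₃ ^ 2 := by ring
        _ ≤ 1 * δ₃ ^ 2 := by gcongr; norm_num
        _ = _ := one_mul _
    have e2 : δ₃ ^ 2 * N ≤ 4 * H ^ 2 := by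
      calc δ₃ ^ 2 * N = (δ₃ * M) ^ 2 := by rw [← hM]; ring
        _ ≤ (2 * H) ^ 2 := by gcongr
        _ = _ := by ring
    have e3 : θ ^ 2 * L ≤ θ ^ 2 * (2 * N) := by gcongr
    have e4 : 8 * θ ^ 2 * N ≤ δ₃ ^ 2 * N := by gcongr
    linarith
  · have e0 : δ₂ * δ₃ * N ≤ 4 * (H * A) := by
      have : 0 < H := by
        have : 0 < δ₃ * M := by positivity
        linarith
      calc δ₂ * δ₃ * N = (δ₃ * M) * (δ₂ * M) := by rw [← hM]; ring
        _ ≤ (2 * H) * (2 * A) := by gcongr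
        _ = _ := by ring
    have e1 : 8 * θ ^ 2 ≤ δ₂ * δ₃ := by
      refine le_of_pow_le_pow_left₀ (n := 3) (by norm_num) (by positivity) ?_
      calc (8 * θ ^ 2) ^ 3 = 1 / 2 ^ 111 * (((δ₃ * δ₄) ^ 2) ^ 4 * δ₄ ^ 4) * δ₃ ^ 4 := by
            rw [hθ]; ring
        _ ≤ 1 / 2 ^ 111 * ((2 ^ 7) ^ 4 * 2 ^ 4) * δ₃ ^ 4 := by gcongr
        _ = 1 / 2 ^ 79 * (δ₃ ^ 3 * δ₃) := by ring
        _ ≤ 1 / 2 ^ 79 * (δ₃ ^ 3 * (1 / 2 ^ 21 * δ₂ ^ 3 * δ₄ ^ 4)) := by gcongr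
        _ ≤ 1 / 2 ^ 79 * (δ₃ ^ 3 * (1 / 2 ^ 21 * δ₂ ^ 3 * 2 ^ 4)) := by gcongr
        _ = 1 / 2 ^ 96 * (δ₂ * δ₃) ^ 3 := by ring
        _ ≤ 1 * (δ₂ * δ₃) ^ 3 := by gcongr; norm_num
        _ = _ := one_mul _
    have e3 : θ ^ 2 * L ≤ θ ^ 2 * (2 * N) := by gcongr
    have e4 : 8 * θ ^ 2 * N ≤ δ₂ * δ₃ * N := by gcongr
    linarith

theorem boxAverage_le {N M δ₂ δ₃ : ℝ} (hM : M ^ 2 = N) (hM0 : 0 < M) (h₃ : 0 < δ₃)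
    (hL : 1 ≤ ⌊2 * N⌋) (hA : 1 ≤ ⌊δ₂ * M⌋) (b : ℤ) {f : ℤ → ℂ} (hf1 : IsOneBounded f)
    (hf : ∀ x ∉ Finset.Icc 1 ⌊2 * N⌋, f x = 0) :
    boxAverage 1 δ₂ δ₃ M b f ≤ 2 * N * M ^ 2 := by
  have hN : 0 < N := by rw [← hM]; positivity
  rw [boxAverage_eq hf 1 hA]
  have hA0 : (0 : ℝ) < ⌊δ₂ * M⌋ := by exact_mod_cast hA
  rw [div_le_iff₀ (by positivity)]
  have hH0 : 0 ≤ ⌊δ₃ * M⌋ := Int.floor_nonneg.2 (by positivity)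
  have hHr : (⌊δ₃ * M⌋ : ℝ) ≤ δ₃ * M := Int.floor_le _
  have hLr : (⌊2 * N⌋ : ℝ) ≤ 2 * N := Int.floor_le _
  have hL0 : (0 : ℝ) < ⌊2 * N⌋ := by exact_mod_cast hL
  have hHr0 : (0 : ℝ) ≤ ⌊δ₃ * M⌋ := by exact_mod_cast hH0
  have hb : ‖boxSum 1 ⌊δ₂ * M⌋ ⌊δ₃ * M⌋ ⌊2 * N⌋ b f‖ ≤
      ⌊δ₂ * M⌋ * (⌊δ₃ * M⌋ : ℝ) ^ 4 * ⌊2 * N⌋ := by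
    rcases hH0.eq_or_lt with h | h
    · rw [← h]
      simp [boxSum]
    · exact norm_boxSum_le hA h hL hf1 hf
  calc _ ≤ ‖boxSum 1 ⌊δ₂ * M⌋ ⌊δ₃ * M⌋ ⌊2 * N⌋ b f‖ := Complex.re_le_norm _
    _ ≤ _ := hb
    _ ≤ ⌊δ₂ * M⌋ * (δ₃ * M) ^ 4 * (2 * N) := by gcongr
    _ = _ := by ring

/-- The box inverse theorem for a fixed shift `b`, with an explicit dependence on the parameters. -/
theorem gowersNorm_four_ge_of_boxAverage {N M δ₂ δ₃ δ₄ : ℝ} (hN : 1 ≤ N) (hM : M = Real.sqrt N)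
    (h₂ : 0 < δ₂) (h₃ : 0 < δ₃) (h₄ : 0 < δ₄) (hδ : δ₃ < 1 / 2 ^ 21 * δ₂ ^ 3 * δ₄ ^ 4) {b : ℤ}
    (hb : b ∈ initInterval (δ₂ * M)) {f : ℤ → ℂ} (hf1 : IsOneBounded f)
    (hf : ∀ x ∉ Finset.Icc 1 ⌊2 * N⌋, f x = 0)
    (h : δ₄ * N * M ^ 2 ≤ boxAverage 1 δ₂ δ₃ M b f) {θ : ℝ}
    (hθ : θ = 1 / 2 ^ 20 * (δ₃ * δ₄) ^ 2) :
    θ ≤ 1 / 1000 ∧ θ ≤ δ₄ / 2 ∧ θ ^ 4019 * N ^ 5 ≤ gowersNorm 4 f ^ (2 ^ 4) := by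
  have hM2 : M ^ 2 = N := by rw [hM, Real.sq_sqrt (by linarith)]
  have hM0 : 0 < M := by rw [hM]; exact Real.sqrt_pos.2 (by linarith)
  rw [initInterval, Finset.mem_Icc] at hb
  have hA : 1 ≤ ⌊δ₂ * M⌋ := by omega
  have hL : 1 ≤ ⌊2 * N⌋ := Int.le_floor.2 (by push_cast; linarith)
  have h₄' : δ₄ ≤ 2 := by
    have := h.trans (boxAverage_le hM2 hM0 h₃ hL hA b hf1 hf)
    refine le_of_mul_le_mul_right (a := N * M ^ 2) ?_ (by positivity)
    linarith
  rw [boxAverage_eq hf 1 hA] at h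
  have hA0 : (0 : ℝ) < ⌊δ₂ * M⌋ := by exact_mod_cast hA
  have hL0 : (0 : ℝ) < ⌊2 * N⌋ := by exact_mod_cast hL
  have hH0 : 0 ≤ ⌊δ₃ * M⌋ := Int.floor_nonneg.2 (by positivity)
  -- If the floor were zero, the box sum would be empty, contradicting positivity of the lower
  -- bound.
  have hH : 1 ≤ ⌊δ₃ * M⌋ := by
    rcases hH0.eq_or_lt with h0 | h0
    · rw [← h0] at h
      have : 0 < δ₄ * N * M ^ 2 := by positivity
      simp only [boxSum, zero_lt_one, Finset.Icc_eq_empty_of_lt, Finset.sum_empty,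
        Finset.sum_const_zero, Complex.zero_re, zero_div] at h
      linarith
    · omega
  rw [le_div_iff₀ (by positivity)] at h
  have hHr : (⌊δ₃ * M⌋ : ℝ) ≤ δ₃ * M := Int.floor_le _
  have hLr : (⌊2 * N⌋ : ℝ) ≤ 2 * N := Int.floor_le _
  have hHr0 : (1 : ℝ) ≤ ⌊δ₃ * M⌋ := by exact_mod_cast hH
  have hAr0 : (1 : ℝ) ≤ ⌊δ₂ * M⌋ := by exact_mod_cast hA
  have hH2 : δ₃ * M ≤ 2 * ⌊δ₃ * M⌋ := by
    have := Int.lt_floor_add_one (δ₃ * M)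
    linarith
  have hA2 : δ₂ * M ≤ 2 * ⌊δ₂ * M⌋ := by
    have := Int.lt_floor_add_one (δ₂ * M)
    linarith
  have hL2 : N ≤ ⌊2 * N⌋ := by
    have := Int.lt_floor_add_one (2 * N)
    linarith
  set A := ⌊δ₂ * M⌋
  set H := ⌊δ₃ * M⌋
  set L := ⌊2 * N⌋
  -- Clearing the weights' normalization loses only the factor `2` from the support length `2 * N`,
  -- since floors only decrease the left side.
  have hS : δ₄ / 2 * A * H ^ 4 * L ≤ ‖boxSum 1 A H L b f‖ := by
    calc δ₄ / 2 * A * H ^ 4 * L ≤ δ₄ / 2 * A * (δ₃ * M) ^ 4 * (2 * N) := by gcongr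
      _ = δ₄ * N * M ^ 2 * (A * (δ₃ ^ 2 * M) ^ 2) := by ring
      _ ≤ _ := h
      _ ≤ _ := Complex.re_le_norm _
  have hlong := norm_boxSum_le_of_long hA hH hL (by omega : 0 ≤ b) hf1 hf
    (by positivity : 0 < δ₄ / 4)
  have h64 := mul_sq_le_of_boxSum_bound hN hM2 hM0 hA0 (by linarith) hL0 hA2 hH2 hLr h₂ h₃ h₄ h₄'
    hδ (hS.trans hlong)
  obtain ⟨c1, c2, c3, c4⟩ := parameter_bounds hM2 hA2 hH2 hLr hM0 h₂ h₃ h₄ h₄' hδ h64 hθ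
  refine ⟨c1, c2, ?_⟩
  have hθ0 : 0 < θ := by rw [hθ]; positivity
  have hT : θ * A * H ^ 4 * L ≤ ‖∑ a ∈ Finset.Icc 1 A, ∑ i ∈ Finset.Icc 1 H,
      ∑ i' ∈ Finset.Icc 1 H, ∑ j ∈ Finset.Icc 1 H, ∑ j' ∈ Finset.Icc 1 H, ∑ x ∈ Finset.Icc 1 L,
          mulDiff (2 * (a + b) * (i - i')) (mulDiff (2 * a * (j - j')) f) x‖ := by
    have e : boxSum 1 A H L b f = ∑ a ∈ Finset.Icc 1 A, ∑ i ∈ Finset.Icc 1 H,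
        ∑ i' ∈ Finset.Icc 1 H, ∑ j ∈ Finset.Icc 1 H, ∑ j' ∈ Finset.Icc 1 H,
        ∑ x ∈ Finset.Icc 1 L,
          mulDiff (2 * (a + b) * (i - i')) (mulDiff (2 * a * (j - j')) f) x := by
      unfold boxSum
      simp only [Nat.cast_one, mul_one]
    rw [← e]
    exact le_trans (by gcongr) hS
  have h3 := sum_norm_sq_mulDiff_ge hf1 hA hH hL (by omega) (by omega) hf hθ0 c1 c3 c4 hT
  have h5 := (pow_le_pow_left₀ (by positivity) h3 2).trans (sq_sum_norm_sq_mulDiff_le hL hf)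
  set W := gowersNorm 4 f ^ (2 ^ 4)
  -- Squaring the `U³` bound gives `θ ^ 4018 * L ^ 8 ≤ 8 * L ^ 3 * W`; a further power of `θ` then
  -- absorbs the `8`.
  have h6 : θ ^ 4018 * (L : ℝ) ^ 5 ≤ 8 * W := by
    refine le_of_mul_le_mul_left (a := (L : ℝ) ^ 3) ?_ (by positivity)
    calc _ = (θ ^ 2009 * (L : ℝ) ^ 4) ^ 2 := by ring
      _ ≤ _ := h5
      _ = _ := by ring
  have h7 : 1000 * θ ^ 4019 ≤ θ ^ 4018 := two_mul_pow_succ_le hθ0 c1 4018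
  have h8 : θ ^ 4018 * N ^ 5 ≤ θ ^ 4018 * (L : ℝ) ^ 5 := by gcongr
  have h9 : 1000 * θ ^ 4019 * N ^ 5 ≤ θ ^ 4018 * N ^ 5 := by gcongr
  have h10 : 0 ≤ θ ^ 4019 * N ^ 5 := by positivity
  linarith

/-! ### Splitting into residue classes -/

/-- The restriction of `f` to the residue class of `u` modulo `q`, rescaled. -/
def residueRescale (q : ℕ) (u : ℤ) (f : ℤ → ℂ) : ℤ → ℂ := fun y => f (u + q * (y - 1))

theorem residueRescale_mulDiff (q : ℕ) (u h : ℤ) (f : ℤ → ℂ) :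
    residueRescale q u (mulDiff (q * h) f) = mulDiff h (residueRescale q u f) := by
  funext y
  simp only [residueRescale, mulDiff]
  congr 2
  ring

/-- The rescaled variable is at most `N / q + 1`, which is at most `2 * (N / q)` because `q ≤ N`.
This is why the one-class theorem allows support up to `2N`. -/
theorem residueRescale_eq_zero {q : ℕ} (hq : 0 < q) {N : ℝ} (hN : (q : ℝ) ≤ N) {f : ℤ → ℂ}
    (hf : ∀ x ∉ Finset.Icc 1 ⌊N⌋, f x = 0) {u : ℤ} (hu : u ∈ Finset.Icc 1 (q : ℤ)) :
    ∀ y ∉ Finset.Icc 1 ⌊2 * (N / q)⌋, residueRescale q u f y = 0 := by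
  intro y hy
  refine hf _ fun h => hy ?_
  rw [Finset.mem_Icc] at h hu ⊢
  have hq0 : (0 : ℝ) < q := by exact_mod_cast hq
  constructor
  · by_contra hcon
    have : (q : ℤ) * (y - 1) ≤ q * (-1) := by gcongr; omega
    omega
  · rw [Int.le_floor]
    have h1 := Int.le_floor.1 h.2
    push_cast at h1
    have h2 : (1 : ℝ) ≤ u := by exact_mod_cast hu.1
    rw [← mul_div_assoc, le_div_iff₀ hq0]
    nlinarith

theorem sum_Icc_eq_sum_residues {q : ℕ} (hq : 0 < q) {n m : ℤ} (hm : n ≤ q * m) {g : ℤ → ℂ}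
    (hg : ∀ x ∉ Finset.Icc 1 n, g x = 0) :
    ∑ x ∈ Finset.Icc 1 n, g x =
      ∑ u ∈ Finset.Icc 1 (q : ℤ), ∑ y ∈ Finset.Icc 1 m, residueRescale q u g y := by
  have hq0 : (0 : ℤ) < q := by exact_mod_cast hq
  have hsub : Finset.Icc 1 n ⊆ Finset.Icc 1 (q * m) := Finset.Icc_subset_Icc le_rfl hm
  rw [Finset.sum_subset hsub fun x _ hx => hg x hx, ← Finset.sum_product']
  symm
  refine Finset.sum_nbij' (fun t => t.1 + q * (t.2 - 1))
    (fun x => ((x - 1) % q + 1, (x - 1) / q + 1)) ?_ ?_ ?_ ?_ ?_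
  · rintro ⟨u, y⟩ h
    simp only [Finset.mem_product, Finset.mem_Icc] at h ⊢
    constructor
    · nlinarith
    · nlinarith
  · intro x h
    simp only [Finset.mem_product, Finset.mem_Icc] at h ⊢
    have h1 := Int.emod_nonneg (x - 1) hq0.ne'
    have h2 := Int.emod_lt_of_pos (x - 1) hq0
    have h3 := Int.mul_ediv_add_emod (x - 1) q
    refine ⟨⟨by omega, by omega⟩, ?_, ?_⟩
    · have := Int.ediv_nonneg (by omega : 0 ≤ x - 1) hq0.le
      omega
    · have : (x - 1) / q < m := by
        rw [Int.ediv_lt_iff_lt_mul hq0]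
        linarith
      omega
  · rintro ⟨u, y⟩ h
    simp only [Finset.mem_product, Finset.mem_Icc] at h ⊢
    have e : u + q * (y - 1) - 1 = (u - 1) + q * (y - 1) := by ring
    rw [e, Int.add_mul_emod_self_left, Int.add_mul_ediv_left _ _ hq0.ne',
      Int.emod_eq_of_lt (by omega) (by omega), Int.ediv_eq_zero_of_lt (by omega) (by omega)]
    simp
  · intro x _
    have := Int.mul_ediv_add_emod (x - 1) q
    simp only
    linarith
  · rintro ⟨u, y⟩ _
    rfl

theorem boxSum_eq_sum_residues {q : ℕ} (hq : 0 < q) {n m : ℤ} (hm : n ≤ q * m) {f : ℤ → ℂ}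
    (hf : ∀ x ∉ Finset.Icc 1 n, f x = 0) (A H b : ℤ) :
    boxSum q A H n b f =
      ∑ u ∈ Finset.Icc 1 (q : ℤ), boxSum 1 A H m b (residueRescale q u f) := by
  have key : ∀ k l : ℤ, ∑ x ∈ Finset.Icc 1 n, mulDiff (q * k) (mulDiff (q * l) f) x =
      ∑ u ∈ Finset.Icc 1 (q : ℤ), ∑ y ∈ Finset.Icc 1 m,
        mulDiff k (mulDiff l (residueRescale q u f)) y := by
    intro k l
    rw [sum_Icc_eq_sum_residues hq hm
      (mulDiff_eq_zero_of_notMem (mulDiff_eq_zero_of_notMem hf _) _)]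
    simp only [residueRescale_mulDiff]
  have e1 : ∀ a i i' : ℤ, 2 * (q : ℤ) * (a + b) * (i - i') =
      q * (2 * (1 : ℕ) * (a + b) * (i - i')) := fun a i i' => by
    rw [Nat.cast_one]; ring
  have e2 : ∀ a j j' : ℤ, 2 * (q : ℤ) * a * (j - j') = q * (2 * (1 : ℕ) * a * (j - j')) :=
    fun a j j' => by rw [Nat.cast_one]; ring
  simp only [boxSum, e1, e2, key]
  symm
  rw [Finset.sum_comm]
  refine Finset.sum_congr rfl fun a _ => ?_
  rw [Finset.sum_comm]
  refine Finset.sum_congr rfl fun i _ => ?_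
  rw [Finset.sum_comm]
  refine Finset.sum_congr rfl fun i' _ => ?_
  rw [Finset.sum_comm]
  refine Finset.sum_congr rfl fun j _ => ?_
  rw [Finset.sum_comm]

/-- Every shift is a multiple of `q`, so all corners of a box lie in one residue class, and dividing
by `q` yields shifts of modulus one. -/
theorem boxAverage_eq_sum_residues {q : ℕ} (hq : 0 < q) {N : ℝ} (hN : (q : ℝ) ≤ N) {f : ℤ → ℂ}
    (hf : ∀ x ∉ Finset.Icc 1 ⌊N⌋, f x = 0) {δ δ' M : ℝ} (hA : 1 ≤ ⌊δ * M⌋) (b : ℤ) :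
    boxAverage q δ δ' M b f =
      ∑ u ∈ Finset.Icc 1 (q : ℤ), boxAverage 1 δ δ' M b (residueRescale q u f) := by
  have hq0 : (0 : ℝ) < q := by exact_mod_cast hq
  have hle : ⌊N⌋ ≤ q * ⌊2 * (N / q)⌋ := by
    have h1 : (1 : ℝ) ≤ N / q := by rw [le_div_iff₀ hq0]; linarith
    have h2 : N / q ≤ ⌊2 * (N / q)⌋ := by
      have := Int.lt_floor_add_one (2 * (N / q))
      linarith
    have h3 : N ≤ q * ⌊2 * (N / q)⌋ := by
      rw [div_le_iff₀ hq0] at h2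
      linarith
    have h4 : (⌊N⌋ : ℝ) ≤ q * ⌊2 * (N / q)⌋ := (Int.floor_le N).trans h3
    exact_mod_cast h4
  rw [boxAverage_eq hf q hA, boxSum_eq_sum_residues hq hle hf, Complex.re_sum, Finset.sum_div]
  refine Finset.sum_congr rfl fun u hu => ?_
  rw [boxAverage_eq (residueRescale_eq_zero hq hN hf hu) 1 hA b]

theorem mulDiffs_ne_zero {g : ℤ → ℂ} (hs : List ℤ) (x : ℤ) (h : mulDiffs hs g x ≠ 0) :
    g x ≠ 0 ∧ ∀ k ∈ hs, g (x + k) ≠ 0 := by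
  induction hs generalizing x with
  | nil => exact ⟨h, by simp⟩
  | cons k hs ih =>
    have h' : mulDiffs hs g (x + k) * (starRingEnd ℂ) (mulDiffs hs g x) ≠ 0 := h
    have h1 := left_ne_zero_of_mul h'
    have h2 : mulDiffs hs g x ≠ 0 := fun h0 => right_ne_zero_of_mul h' (by rw [h0, map_zero])
    refine ⟨(ih x h2).1, ?_⟩
    intro l hl
    rcases List.mem_cons.1 hl with rfl | hl
    · exact (ih _ h1).1
    · exact (ih x h2).2 l hl

theorem residueRescale_mulDiffs (q : ℕ) (u : ℤ) (f : ℤ → ℂ) (hs : List ℤ) :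
    residueRescale q u (mulDiffs (hs.map fun h => (q : ℤ) * h) f) =
      mulDiffs hs (residueRescale q u f) := by
  induction hs with
  | nil => rfl
  | cons h hs ih =>
    change residueRescale q u (mulDiff (q * h) (mulDiffs (hs.map fun h => (q : ℤ) * h) f)) =
      mulDiff h (mulDiffs hs (residueRescale q u f))
    rw [residueRescale_mulDiff, ih]

/-- A nonzero term requires `x` and each `x + hᵢ` to lie in the class, hence every `hᵢ` is a
multiple of `q`. The sum is thus carried by the range of an injective rescaling of all variables. -/
theorem gowersNormOn_residueClass (s : ℕ) {q : ℕ} (hq : 0 < q) (u : ℤ) (f : ℤ → ℂ) :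
    gowersNormOn s (residueClass q u) f = gowersNorm s (residueRescale q u f) := by
  have hq0 : (q : ℤ) ≠ 0 := by exact_mod_cast hq.ne'
  unfold gowersNormOn gowersNorm
  congr 2
  set g := (residueClass q u).indicator f with hg
  have hgr : residueRescale q u f = residueRescale q u g := by
    funext y
    simp only [residueRescale, hg]
    rw [Set.indicator_of_mem]
    exact ⟨y - 1, rfl⟩
  let e : ℤ × (Fin s → ℤ) → ℤ × (Fin s → ℤ) := fun p => (u + q * (p.1 - 1), fun i => q * p.2 i)
  have he : Function.Injective e := by
    rintro ⟨x, h⟩ ⟨x', h'⟩ heq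
    simp only [e, Prod.mk.injEq, add_right_inj] at heq
    refine Prod.ext ?_ ?_
    · have := mul_left_cancel₀ hq0 heq.1
      simpa using this
    · funext i
      exact mul_left_cancel₀ hq0 (congrFun heq.2 i)
  have hsupp : Function.support (fun p : ℤ × (Fin s → ℤ) => mulDiffs (List.ofFn p.2) g p.1) ⊆
      Set.range e := by
    rintro ⟨x, h⟩ hp
    obtain ⟨h1, h2⟩ := mulDiffs_ne_zero _ _ (Function.mem_support.1 hp)
    obtain ⟨k, hk⟩ : x ∈ residueClass q u := Set.mem_of_indicator_ne_zero h1
    have h3 : ∀ i, ∃ l : ℤ, h i = q * l := by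
      intro i
      obtain ⟨k', hk'⟩ : x + h i ∈ residueClass q u :=
        Set.mem_of_indicator_ne_zero (h2 (h i) (by simp [List.mem_ofFn]))
      exact ⟨k' - k, by rw [mul_sub]; linarith⟩
    choose l hl using h3
    refine ⟨(k + 1, l), ?_⟩
    simp only [e, Prod.mk.injEq]
    exact ⟨by rw [hk]; ring, funext fun i => (hl i).symm⟩
  rw [← he.tsum_eq hsupp, hgr]
  refine tsum_congr fun p => ?_
  rw [← residueRescale_mulDiffs]
  simp only [residueRescale, e, List.map_ofFn]
  rfl

/-! ### Averaging and conclusion -/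

/-- Since `θ ≤ 1`, the exponent may be raised to a power of two; this converts the bound in `θ` into
the stated power of `δ₃ δ₄`. -/
theorem pow_two_pow_le_pow {θ c t : ℝ} (hθ : θ = c * t ^ 2) (hθ0 : 0 ≤ θ) (hθ1 : θ ≤ 1)
    {n k : ℕ} (hn : n ≤ 2 ^ k) : c ^ 2 ^ k * t ^ 2 ^ (k + 1) ≤ θ ^ n := by
  refine le_trans (le_of_eq ?_) (pow_le_pow_of_le_one hθ0 hθ1 hn)
  rw [hθ, mul_pow, ← pow_mul, pow_succ' 2 k]

/-- Markov-type averaging for a family of pairs with a pointwise dichotomy. -/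
theorem expect_ge_of_average {B U : Finset ℤ} {a G : ℤ → ℤ → ℝ} {m κ c : ℝ}
    (hB : B.Nonempty) (hU : U.Nonempty) (hm : 0 < m) (hκ : 0 < κ) (hc : 0 < c)
    (hG : ∀ b ∈ B, ∀ u ∈ U, 0 ≤ G b u) (ha : ∀ b ∈ B, ∀ u ∈ U, a b u ≤ 2 * m)
    (hdich : ∀ b ∈ B, ∀ u ∈ U, c / 2 * m ≤ a b u → κ ≤ G b u)
    (h : c * m * U.card ≤ 𝔼 b ∈ B, ∑ u ∈ U, a b u) :
    (∃ b ∈ B, ∃ u ∈ U, c / 2 * m ≤ a b u) ∧ c / 4 * κ ≤ 𝔼 u ∈ U, 𝔼 b ∈ B, G b u := by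
  have hBc : (0 : ℝ) < B.card := by exact_mod_cast hB.card_pos
  have hUc : (0 : ℝ) < U.card := by exact_mod_cast hU.card_pos
  rw [Finset.expect_eq_sum_div_card, le_div_iff₀ hBc] at h
  constructor
  · by_contra! hcon
    have h1 : ∑ b ∈ B, ∑ u ∈ U, a b u ≤ ∑ b ∈ B, ∑ u ∈ U, c / 2 * m :=
      Finset.sum_le_sum fun b hb => Finset.sum_le_sum fun u hu => (hcon b hb u hu).le
    simp only [Finset.sum_const, nsmul_eq_mul] at h1
    have : 0 < c * m * U.card * B.card := by positivity
    nlinarith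
  · have hpt : ∀ b ∈ B, ∀ u ∈ U, a b u ≤ c / 2 * m + 2 * m / κ * G b u := by
      intro b hb u hu
      rcases le_or_gt (c / 2 * m) (a b u) with h1 | h1
      · have h2 : 2 * m ≤ 2 * m / κ * G b u := by
          rw [div_mul_eq_mul_div, le_div_iff₀ hκ]
          have := hdich b hb u hu h1
          gcongr
        have := ha b hb u hu
        have : 0 < c / 2 * m := by positivity
        linarith
      · have := hG b hb u hu
        have : 0 ≤ 2 * m / κ * G b u := by positivity
        linarith
    have h1 : ∑ b ∈ B, ∑ u ∈ U, a b u ≤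
        ∑ b ∈ B, ∑ u ∈ U, (c / 2 * m + 2 * m / κ * G b u) :=
      Finset.sum_le_sum fun b hb => Finset.sum_le_sum fun u hu => hpt b hb u hu
    simp only [Finset.sum_add_distrib, Finset.sum_const, nsmul_eq_mul, ← Finset.mul_sum] at h1
    have e : 𝔼 u ∈ U, 𝔼 b ∈ B, G b u = (∑ b ∈ B, ∑ u ∈ U, G b u) / (B.card * U.card) := by
      simp only [Finset.expect_eq_sum_div_card]
      rw [← Finset.sum_div, div_div, Finset.sum_comm]
    rw [e, le_div_iff₀ (by positivity)]
    set W := ∑ b ∈ B, ∑ u ∈ U, G b u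
    have h2 : c / 2 * m * (B.card * U.card) ≤ 2 * m / κ * W := by nlinarith
    rw [div_mul_eq_mul_div (2 * m), le_div_iff₀ hκ] at h2
    refine le_of_mul_le_mul_left (a := 2 * m) ?_ (by positivity)
    calc _ = c / 2 * m * (B.card * U.card) * κ := by ring
      _ ≤ _ := h2

theorem lemma5p5 :
    (∃ C K c : ℝ, 0 < C ∧ 0 < K ∧ 0 < c ∧
      ∀ N M δ₁ δ₂ δ₃ δ₄ : ℝ, 0 < N → M = Real.sqrt N →
        0 < δ₁ → 0 < δ₂ → 0 < δ₃ → 0 < δ₄ →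
        δ₁ / δ₂ < C * δ₄ → δ₃ < C * δ₁ ^ 3 * δ₄ →
        ∃ B : Finset ℤ, B ⊆ initInterval (δ₂ * M) ∧ (B.card : ℝ) ≤ K * (δ₁ * δ₂ * M) ∧
          ∀ b ∈ initInterval (δ₂ * M), b ∉ B →
            ∀ f : ℤ → ℂ, IsOneBounded f → Function.support f ⊆ ↑(initInterval N) →
              δ₄ * N * M ^ 2 ≤ boxAverage 1 δ₂ δ₃ M b f →
              c * (δ₃ * δ₄) ^ (2 ^ 20) * N ^ 5 ≤ gowersNorm 4 f ^ (2 ^ 4)) ∧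
    (∃ C c : ℝ, 0 < C ∧ 0 < c ∧
      ∀ (N M δ₂ δ₃ δ₄ : ℝ) (q : ℕ), 0 < q → (q : ℝ) ≤ N → M = Real.sqrt (N / q) →
        0 < δ₂ → 0 < δ₃ → 0 < δ₄ → δ₃ < C * δ₂ ^ 3 * δ₄ ^ 4 →
        ∀ f : ℤ → ℤ → ℂ,
          (∀ b ∈ initInterval (δ₂ * M),
            IsOneBounded (f b) ∧ Function.support (f b) ⊆ ↑(initInterval N)) →
          δ₄ * N * M ^ 2 ≤ 𝔼 b ∈ initInterval (δ₂ * M), boxAverage q δ₂ δ₃ M b (f b) →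
          c * (δ₃ * δ₄) ^ (2 ^ 21) * (N / q) ^ 5 ≤
            𝔼 u ∈ initInterval q, 𝔼 b ∈ initInterval (δ₂ * M),
              gowersNormOn 4 (residueClass q u) (f b) ^ (2 ^ 4)) := by
  constructor
  · refine ⟨1 / 2 ^ 21, 1, (1 / 2 ^ 20) ^ 2 ^ 19, by norm_num, one_pos,
      pow_pos (by norm_num) _, ?_⟩
    intro N M δ₁ δ₂ δ₃ δ₄ hN hM h₁ h₂ h₃ h₄ hδ₁ hδ₃
    have hM0 : 0 < M := by rw [hM]; exact Real.sqrt_pos.2 hN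
    -- No `b` need be excluded: the equidistribution is over pairs `(a, a')` and holds for every `b`
    -- in the range.
    refine ⟨∅, Finset.empty_subset _, by simp only [Finset.card_empty, Nat.cast_zero]; positivity, ?_⟩
    intro b hb _ f hf1 hsupp h
    have hf : ∀ x ∉ Finset.Icc 1 ⌊N⌋, f x = 0 := fun x hx => by
      by_contra h0
      exact hx (by simpa [initInterval] using hsupp (Function.mem_support.2 h0))
    have hA : 1 ≤ ⌊δ₂ * M⌋ := by
      rw [initInterval, Finset.mem_Icc] at hb; omega
    -- For `N < 1` the support is empty and the box average vanishes.
    have hN1 : 1 ≤ N := by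
      by_contra! hlt
      have h0 : ⌊N⌋ = 0 := Int.floor_eq_zero_iff.2 ⟨hN.le, hlt⟩
      rw [boxAverage_eq hf 1 hA, h0] at h
      have : 0 < δ₄ * N * M ^ 2 := by positivity
      simp only [boxSum, zero_lt_one, Finset.Icc_eq_empty_of_lt, Finset.sum_empty,
        Finset.sum_const_zero, Complex.zero_re, zero_div] at h
      linarith
    -- Inserting `δ₁ < C δ₄ δ₂` into `δ₃ < C δ₁³ δ₄` eliminates `δ₁` and gives the form of the
    -- condition used for residue classes.
    have hδ : δ₃ < 1 / 2 ^ 21 * δ₂ ^ 3 * δ₄ ^ 4 := by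
      rw [div_lt_iff₀ h₂] at hδ₁
      calc δ₃ < 1 / 2 ^ 21 * δ₁ ^ 3 * δ₄ := hδ₃
        _ ≤ 1 / 2 ^ 21 * (1 / 2 ^ 21 * δ₄ * δ₂) ^ 3 * δ₄ := by gcongr
        _ = (1 / 2 ^ 21) ^ 3 * (1 / 2 ^ 21 * δ₂ ^ 3 * δ₄ ^ 4) := by ring
        _ ≤ 1 * (1 / 2 ^ 21 * δ₂ ^ 3 * δ₄ ^ 4) := by gcongr; norm_num
        _ = _ := one_mul _
    have hf2 : ∀ x ∉ Finset.Icc 1 ⌊2 * N⌋, f x = 0 := fun x hx => hf x fun h0 => hx <|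
      Finset.Icc_subset_Icc le_rfl (Int.floor_le_floor (by linarith)) h0
    obtain ⟨c1, -, c3⟩ :=
      gowersNorm_four_ge_of_boxAverage hN1 hM h₂ h₃ h₄ hδ hb hf1 hf2 h rfl
    refine le_trans ?_ c3
    gcongr
    exact pow_two_pow_le_pow rfl (by positivity) (by linarith) (by norm_num)
  -- The single-class theorem is applied with `δ₄ / 2`: this turns `2⁻²¹` into `2⁻²⁵` in the
  -- hypothesis and `2⁻²⁰` into `2⁻²²` in `θ`.
  · refine ⟨1 / 2 ^ 25, (1 / 2 ^ 22) ^ 2 ^ 20, by norm_num, pow_pos (by norm_num) _, ?_⟩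
    intro N M δ₂ δ₃ δ₄ q hq hqN hM h₂ h₃ h₄ hδ f hf h
    have hq0 : (0 : ℝ) < q := by exact_mod_cast hq
    have hN' : 1 ≤ N / q := by rw [le_div_iff₀ hq0]; linarith
    have hM2 : M ^ 2 = N / q := by rw [hM, Real.sq_sqrt (by linarith)]
    have hM0 : 0 < M := by rw [hM]; exact Real.sqrt_pos.2 (by linarith)
    have hne : (initInterval (δ₂ * M)).Nonempty := by
      rw [Finset.nonempty_iff_ne_empty]
      intro h0
      rw [h0, Finset.expect_empty] at h
      have : 0 < δ₄ * N * M ^ 2 := by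
        have : 0 < N := by linarith
        positivity
      linarith
    have hA : 1 ≤ ⌊δ₂ * M⌋ := by
      obtain ⟨b, hb⟩ := hne
      rw [initInterval, Finset.mem_Icc] at hb; omega
    have hL : 1 ≤ ⌊2 * (N / q)⌋ := Int.le_floor.2 (by push_cast; linarith)
    have hU : initInterval q = Finset.Icc 1 (q : ℤ) := by
      rw [initInterval, Int.floor_natCast]
    have hUc : ((initInterval q).card : ℝ) = q := by
      rw [hU, Int.card_Icc]; simp
    have hUne : (initInterval q).Nonempty := by
      rw [hU]; exact ⟨1, by rw [Finset.mem_Icc]; omega⟩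
    have hf0 : ∀ b ∈ initInterval (δ₂ * M), ∀ x ∉ Finset.Icc 1 ⌊N⌋, f b x = 0 :=
      fun b hb x hx => by
        by_contra h0
        exact hx (by simpa [initInterval] using (hf b hb).2 (Function.mem_support.2 h0))
    have hf1 : ∀ b ∈ initInterval (δ₂ * M), ∀ u, IsOneBounded (residueRescale q u (f b)) :=
      fun b hb u x => (hf b hb).1 _
    have hfu : ∀ b ∈ initInterval (δ₂ * M), ∀ u ∈ initInterval q,
        ∀ y ∉ Finset.Icc 1 ⌊2 * (N / q)⌋, residueRescale q u (f b) y = 0 :=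
      fun b hb u hu => residueRescale_eq_zero hq hqN (hf0 b hb) (hU ▸ hu)
    set θ : ℝ := 1 / 2 ^ 20 * (δ₃ * (δ₄ / 2)) ^ 2 with hθ
    have hθ0 : 0 < θ := by positivity
    have hδ' : δ₃ < 1 / 2 ^ 21 * δ₂ ^ 3 * (δ₄ / 2) ^ 4 := by
      refine hδ.trans_eq ?_
      ring
    have hcore : ∀ b ∈ initInterval (δ₂ * M), ∀ u ∈ initInterval q,
        δ₄ / 2 * (N / q * M ^ 2) ≤ boxAverage 1 δ₂ δ₃ M b (residueRescale q u (f b)) →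
        θ ≤ 1 / 1000 ∧ θ ≤ δ₄ / 2 / 2 ∧ θ ^ 4019 * (N / q) ^ 5 ≤
          gowersNorm 4 (residueRescale q u (f b)) ^ (2 ^ 4) := fun b hb u hu h0 =>
      gowersNorm_four_ge_of_boxAverage hN' hM h₂ h₃ (by positivity) hδ' hb (hf1 b hb u)
        (hfu b hb u hu) (by rw [mul_assoc]; exact h0) hθ
    have havg : δ₄ * (N / q * M ^ 2) * (initInterval q).card ≤
        𝔼 b ∈ initInterval (δ₂ * M), ∑ u ∈ initInterval q,
          boxAverage 1 δ₂ δ₃ M b (residueRescale q u (f b)) := by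
      rw [Finset.expect_congr rfl fun b hb =>
        boxAverage_eq_sum_residues hq hqN (hf0 b hb) hA b, ← hU] at h
      refine le_trans (le_of_eq ?_) h
      rw [hUc]
      field_simp
    obtain ⟨⟨b₀, hb₀, u₀, hu₀, h0⟩, hmain⟩ := expect_ge_of_average
      (G := fun b u => gowersNorm 4 (residueRescale q u (f b)) ^ (2 ^ 4))
      (κ := θ ^ 4019 * (N / q) ^ 5) hne hUne
      (by positivity) (by positivity) h₄
      (fun b hb u hu => by rw [gowersNorm_four_pow (hfu b hb u hu)]; positivity)
      (fun b hb u hu => by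
        rw [← mul_assoc]
        exact boxAverage_le hM2 hM0 h₃ hL hA b (hf1 b hb u) (hfu b hb u hu))
      (fun b hb u hu h0 => (hcore b hb u hu h0).2.2) havg
    -- A single pair above the threshold supplies the numerical inequalities `θ ≤ 1 / 1000` and `θ ≤
    -- δ₄ / 4`, which do not depend on the pair.
    obtain ⟨c1, c2, -⟩ := hcore b₀ hb₀ u₀ hu₀ h0
    simp only [gowersNormOn_residueClass 4 hq]
    refine le_trans ?_ hmain
    have e : θ = 1 / 2 ^ 22 * (δ₃ * δ₄) ^ 2 := by rw [hθ]; ring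
    -- The averaging factor `δ₄ / 4` is paid for by one extra power of `θ`.
    calc _ ≤ θ ^ 4020 * (N / q) ^ 5 := by
          gcongr
          exact pow_two_pow_le_pow e hθ0.le (by linarith) (by norm_num)
      _ = θ * (θ ^ 4019 * (N / q) ^ 5) := by
          rw [show 4020 = 4019 + 1 by norm_num, pow_succ', mul_assoc]
      _ ≤ δ₄ / 4 * (θ ^ 4019 * (N / q) ^ 5) := by
          gcongr
          linarith
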